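/- Let $\sigma_1,\sigma_2$ be the standard generators of the three-strand braid group $B_3$ and put $[1,3]=\sigma_1\sigma_2$. For integers $x,y,z\ge 0$ let $L(x,y,z)$ be the oriented link in the 3-sphere that is the standard closure of the 3-braid $\sigma_1^{x}\sigma_2^{y}[1,3]^{z}$. Links are considered up to isotopy, $V_L$ is the Jones polynomial of $L$, the braid index of $L$ is the least $n$ such that $L$ is the closure of an $n$-strand braid, and for $r\ge 2$, $s\ge 1$ the torus link $T(r,s)$ is the closure of the $r$-strand braid $(\sigma_1\cdots\sigma_{r-1})^{s}$. 1. Let $x_i,y_i,z_i\ge 0$ and $L_i=L(x_i,y_i,z_i)$ for $i=1,2$. If $V_{L_1}=V_{L_2}$, then $L_1=L_2$. 2. For all $x_1,y_1,z_1\ge 0$ there are $x,y,z\ge 0$ with $z\equiv 0 \pmod 3$ and $L(x_1,y_1,z_1)=L(x,y,z)$. 3. Let $x_1,y_1,z_1\ge 0$ and $L_1=L(x_1,y_1,z_1)$. Then $L_1$ is a torus link of braid index three if and only if one of the following conditions holds, and in each case $L_1$ is the torus link that is named there: 1. $x_1=y_1=0$ and $z_1\ge 3$; then $L_1=T(3,z_1)$;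 2. $x_1=y_1=1$ and $z_1\ge 2$; then $L_1=T(3,z_1+1)$; 3. $\min(x_1,y_1)=1$, $\max(x_1,y_1)=3$, $z_1\equiv 0\pmod 3$ and $z_1\ge 3$; then $L_1=T(3,z_1+2)$; 4. $\min(x_1,y_1)=2$, $\max(x_1,y_1)=4$ and $z_1\equiv 2\pmod 3$; then $L_1=T(3,z_1+3)$; 5. $x_1=y_1=2$ and $z_1\equiv 2\pmod 3$; then $L_1=T(3,z_1+2)$; 6. $\min(x_1,y_1)=0$, $\max(x_1,y_1)=2$, $z_1\equiv 1\pmod 3$ and $z_1\ge 4$; then $L_1=T(3,z_1+1)$. -/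

import Mathlib

open scoped LaurentPolynomial

namespace LinkTheory

/-! ### Oriented link diagrams

An oriented link diagram in the plane, put in general position with respect to the height function,
is cut into horizontal slices, each of which contains exactly one minimum, maximum or crossing.
Slices are listed from bottom to top.  -/

/-- The non-trivial part of a slice. `cup up` is a local minimum, whose left leg points upwards if
`up` is true and whose right leg points upwards otherwise; `cap` is a local maximum; `cross e` is a
crossing, in which the strand from bottom left to top right is the overpass if `e` is true and the
underpass if `e` is false. -/
inductive Piece where
  | cup (up : Bool)
  | cap
  | cross (e : Bool)

/-- Number of endpoints at the bottom of a piece. -/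
def Piece.dom : Piece → ℕ
  | .cup _ => 0
  | .cap => 2
  | .cross _ => 2

/-- Number of endpoints at the top of a piece. -/
def Piece.cod : Piece → ℕ
  | .cup _ => 2
  | .cap => 0
  | .cross _ => 2

/-- A slice: a piece with `pos` vertical strands to its left (and any number to its right). -/
structure Slice where
  pos : ℕ
  piece : Piece

/-- A level of a diagram is recorded by the list of the directions of the strands that meet it, from
left to right (true: upwards). `step` gives the level above a slice from the level below it, and
`none` if the slice does not fit there. -/
def Slice.step : Slice → List Bool → Option (List Bool)
  | ⟨i, .cup up⟩, o =>
      if i ≤ o.length then some (o.take i ++ up :: (!up) :: o.drop i) else none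
  | ⟨i, .cap⟩, o =>
      match o.drop i with
      | a :: b :: r => if a = b then none else some (o.take i ++ r)
      | _ => none
  | ⟨i, .cross _⟩, o =>
      match o.drop i with
      | a :: b :: r => some (o.take i ++ b :: a :: r)
      | _ => none

/-- The level above a stack of slices. -/
def run : List Slice → List Bool → Option (List Bool)
  | [], o => some o
  | x :: w, o => (x.step o).bind (run w)

/-- An oriented link diagram: a stack of slices that fit together, with no endpoints. -/
structure Diagram where
  slices : List Slice
  closed : run slices [] = some []

/-! ### Links -/

/-- The local moves on sliced diagrams: the planar isotopies `far` (change of the relative height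
of two distant pieces), `zigzag`, `zigzag'` (straightening a strand), `slideCup`, `slideCap`
(a strand that crosses one leg of an extremum is moved to the other leg), and the three Reidemeister
moves, where the first one appears in the form of a kink at an extremum. -/
inductive Move : List Slice → List Slice → Prop
  | far (i k : ℕ) (p q : Piece) :
      Move [⟨i + p.dom + k, q⟩, ⟨i, p⟩] [⟨i, p⟩, ⟨i + p.cod + k, q⟩]
  | zigzag (i : ℕ) (up : Bool) : Move [⟨i, .cup up⟩, ⟨i + 1, .cap⟩] []
  | zigzag' (i : ℕ) (up : Bool) : Move [⟨i + 1, .cup up⟩, ⟨i, .cap⟩] []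
  | slideCup (i : ℕ) (up e : Bool) :
      Move [⟨i, .cup up⟩, ⟨i + 1, .cross e⟩] [⟨i + 1, .cup up⟩, ⟨i, .cross (!e)⟩]
  | slideCap (i : ℕ) (e : Bool) :
      Move [⟨i + 1, .cross e⟩, ⟨i, .cap⟩] [⟨i, .cross (!e)⟩, ⟨i + 1, .cap⟩]
  | reidemeister1Cup (i : ℕ) (up e : Bool) :
      Move [⟨i, .cup up⟩, ⟨i, .cross e⟩] [⟨i, .cup (!up)⟩]
  | reidemeister1Cap (i : ℕ) (e : Bool) :
      Move [⟨i, .cross e⟩, ⟨i, .cap⟩] [⟨i, .cap⟩]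
  | reidemeister2 (i : ℕ) (e : Bool) : Move [⟨i, .cross e⟩, ⟨i, .cross (!e)⟩] []
  | reidemeister3 (i : ℕ) (a b c : Bool) (h : a = b ∨ b = c) :
      Move [⟨i, .cross a⟩, ⟨i + 1, .cross b⟩, ⟨i, .cross c⟩]
        [⟨i + 1, .cross c⟩, ⟨i, .cross b⟩, ⟨i + 1, .cross a⟩]

/-- Two diagrams differ by a single local move. -/
def Diagram.Step (D D' : Diagram) : Prop :=
  ∃ u v l r : List Slice, Move l r ∧ D.slices = u ++ l ++ v ∧ D'.slices = u ++ r ++ v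

/-- Oriented links (up to isotopy): oriented link diagrams modulo planar isotopy and
Reidemeister moves. `Quot` identifies two diagrams if a finite sequence of moves or inverse moves
leads from one to the other. -/
def Link : Type := Quot Diagram.Step

/-- The link that is represented by a diagram. -/
def Diagram.link (D : Diagram) : Link := Quot.mk _ D

/-! ### The Jones polynomial

Polynomials in `t ^ (1/4)` and its inverse are elements of `ℤ[T;T⁻¹]`, where `T n` stands for
`t ^ (n/4)`. Kauffman's variable is `A = t ^ (-1/4)`.  -/

/-- The sign of the crossing in a slice above the level `o` (zero if there is no crossing). -/
def Slice.sign : Slice → List Bool → ℤ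
  | ⟨i, .cross e⟩, o =>
      match o.drop i with
      | a :: b :: _ => if (a == b) = e then 1 else -1
      | _ => 0
  | _, _ => 0

/-- The sum of the signs of the crossings in a stack of slices above the level `o`. -/
def writhe : List Slice → List Bool → ℤ
  | [], _ => 0
  | x :: w, o => x.sign o + writhe w ((x.step o).getD [])

/-- In a partial smoothed diagram, the endpoints on its top level carry labels, and two endpoints
have the same label if they are joined by an arc. This function adds a local minimum at `i`. -/
def addCup (i : ℕ) (s : List ℕ) : List ℕ :=
  s.take i ++ (s.foldr max 0 + 1) :: (s.foldr max 0 + 1) :: s.drop i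

/-- Adds a local maximum that joins the endpoints `i` and `i + 1` of a partial smoothed diagram;
returns the new labels, and the number (`0` or `1`) of loops that are closed in this way. -/
def addCap (i : ℕ) (s : List ℕ) : List ℕ × ℕ :=
  match s.drop i with
  | a :: b :: r =>
      if a = b then (s.take i ++ r, 1)
      else ((s.take i ++ r).map (fun c => if c = a then b else c), 0)
  | _ => (s, 0)

/-- The value `- A ^ 2 - A ^ (-2)` of a loop. -/
noncomputable def loopValue : ℤ[T;T⁻¹] := - LaurentPolynomial.T (-2) - LaurentPolynomial.T 2

/-- Kauffman's state sum: the sum, over all smoothings of the crossings, of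
`A ^ (number of A-smoothings - number of B-smoothings) * (- A ^ 2 - A ^ (-2)) ^ (number of loops - 1)`.
The slices are smoothed from bottom to top; `s` holds the labels of the endpoints that
are open so far, and `k` is the number of loops closed so far. The A-smoothing of `cross true` and the
B-smoothing of `cross false` consist of two vertical strands, and the other smoothings of a
maximum below a minimum. -/
noncomputable def stateSum : List Slice → List ℕ → ℕ → ℤ[T;T⁻¹]
  | [], _, k => loopValue ^ (k - 1)
  | ⟨i, .cup _⟩ :: w, s, k => stateSum w (addCup i s) k
  | ⟨i, .cap⟩ :: w, s, k => stateSum w (addCap i s).1 (k + (addCap i s).2)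
  | ⟨i, .cross e⟩ :: w, s, k =>
      LaurentPolynomial.T (if e then -1 else 1) * stateSum w s k +
        LaurentPolynomial.T (if e then 1 else -1) *
          stateSum w (addCup i (addCap i s).1) (k + (addCap i s).2)

/-- The Jones polynomial of a non-empty diagram, `(-A ^ 3) ^ (- writhe)` times the Kauffman bracket,
with the value `1` on the unknot. -/
noncomputable def Diagram.jones (D : Diagram) : ℤ[T;T⁻¹] :=
  LaurentPolynomial.C ((writhe D.slices []).negOnePow : ℤ) *
    LaurentPolynomial.T (3 * writhe D.slices []) * stateSum D.slices [] 0

/-- The Jones polynomial of a link, computed from a diagram of the link (it is the same for all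
diagrams of the link). -/
noncomputable def Link.jones (L : Link) : ℤ[T;T⁻¹] := (Quot.out L).jones

/-! ### Closed braids -/

/-- Braid words on `n` strands. The letter `(j, true)` is the generator `σ_{j+1}`, and
`(j, false)` is its inverse. -/
abbrev BraidWord (n : ℕ) : Type := List (Fin (n - 1) × Bool)

/-- `n` nested minima, from the outermost to the innermost one. -/
def nestedCups (n : ℕ) : List Slice := (List.range n).map fun i => ⟨i, .cup true⟩

/-- `n` nested maxima, from the innermost to the outermost one. -/
def nestedCaps (n : ℕ) : List Slice := (List.range n).reverse.map fun i => ⟨i, .cap⟩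

/-- The crossings of a braid word; `σ_i` is the positive crossing of two upward strands. -/
def BraidWord.crossings {n : ℕ} (β : BraidWord n) : List Slice :=
  β.map fun g => ⟨g.1, .cross g.2⟩

theorem run_append (u v : List Slice) (o : List Bool) :
    run (u ++ v) o = (run u o).bind (run v) := by
  induction u generalizing o with
  | nil => rfl
  | cons x u ih =>
    simp only [List.cons_append, run]
    cases x.step o with
    | none => rfl
    | some o' => exact ih o'

theorem run_nestedCups (n : ℕ) :
    run (nestedCups n) [] = some (List.replicate n true ++ List.replicate n false) := by
  induction n with
  | zero => rfl
  | succ n ih =>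
    have h : nestedCups (n + 1) = nestedCups n ++ [⟨n, .cup true⟩] := by
      simp [nestedCups, List.range_succ]
    rw [h, run_append, ih]
    simp [run, Slice.step, List.replicate_succ', ← List.replicate_succ]

theorem run_nestedCaps (n : ℕ) :
    run (nestedCaps n) (List.replicate n true ++ List.replicate n false) = some [] := by
  induction n with
  | zero => rfl
  | succ n ih =>
    have h : nestedCaps (n + 1) = ⟨n, .cap⟩ :: nestedCaps n := by
      simp [nestedCaps, List.range_succ]
    have h1 : List.replicate (n + 1) true ++ List.replicate (n + 1) false =
        List.replicate n true ++ true :: false :: List.replicate n false := by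
      rw [List.replicate_succ', List.replicate_succ]; simp
    rw [h, h1]
    simpa [run, Slice.step] using ih

theorem run_crossings {n : ℕ} (β : BraidWord n) (l : List Bool) :
    run β.crossings (List.replicate n true ++ l) = some (List.replicate n true ++ l) := by
  induction β with
  | nil => rfl
  | cons g β ih =>
    obtain ⟨k, hk⟩ : ∃ k, n = g.1 + (k + 2) := ⟨n - g.1 - 2, by omega⟩
    have h : List.replicate n true ++ l =
        List.replicate g.1 true ++ true :: true :: (List.replicate k true ++ l) := by
      conv_lhs => rw [hk]
      simp [← List.replicate_append_replicate, List.replicate_succ]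
    have h2 : (⟨g.1, .cross g.2⟩ : Slice).step (List.replicate n true ++ l) =
        some (List.replicate n true ++ l) := by
      rw [h]; simp [Slice.step]
    change ((⟨g.1, .cross g.2⟩ : Slice).step (List.replicate n true ++ l)).bind
      (run (BraidWord.crossings β)) = _
    rw [h2]
    exact ih

/-- The diagram of the standard closure of a braid word: the braid is on the left, its strands point
upwards, and their tops are joined to their bottoms by `n` nested arcs that run down on the right. -/
def BraidWord.closureDiagram {n : ℕ} (β : BraidWord n) : Diagram where
  slices := nestedCups n ++ β.crossings ++ nestedCaps n
  closed := by
    rw [run_append, run_append, run_nestedCups, Option.bind_some, run_crossings, Option.bind_some,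
      run_nestedCaps]

/-- The link that is the standard closure of a braid word. -/
def BraidWord.closure {n : ℕ} (β : BraidWord n) : Link := β.closureDiagram.link

/-- The braid index of a link: the least `n` such that the link is the closure of a braid on
`n` strands. -/
noncomputable def Link.braidIndex (L : Link) : ℕ :=
  sInf {n : ℕ | ∃ β : BraidWord n, β.closure = L}

/-- `wordPow β m` is the word `β ^ m`. -/
def wordPow {n : ℕ} (β : BraidWord n) (m : ℕ) : BraidWord n := (List.replicate m β).flatten

/-- The word `[1,n] = σ_1 σ_2 ⋯ σ_{n-1}` on `n` strands. -/
def ascending (n : ℕ) : BraidWord n := (List.finRange (n - 1)).map fun j => (j, true)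

/-- The torus link `T(r,s)`: the closure of `[1,r] ^ s`. -/
def torusLink (r s : ℕ) : Link := (wordPow (ascending r) s).closure

/-- Torus links: the links `T(r,s)` with `2 ≤ r` and `0 < s`. -/
def Link.IsTorusLink (L : Link) : Prop :=
  ∃ r s : ℕ, 2 ≤ r ∧ 0 < s ∧ L = torusLink r s

/-- The closure of the 3-braid word `σ_1 ^ x σ_2 ^ y [1,3] ^ z`. -/
def twistedLink (x y z : ℕ) : Link :=
  BraidWord.closure (n := 3)
    (wordPow [(0, true)] x ++ wordPow [(1, true)] y ++ wordPow (ascending 3) z)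

end LinkTheory

/-!
The closure of a braid does not change under conjugation and stabilization, because a crossing can be
carried around the closing arcs and a kink can be removed; both are sequences of local moves on
sliced diagrams (`same_closureSlices_comm`, `linkOf_closureSlices_conj`,
`linkOf_closureSlices_stabilize`). The full twist `[1,3] ^ 3` is central in the three-strand braid
group, and conjugation by the half twist exchanges the generators. Hence every `L(x,y,z)` is some
`L(x',y',3k)`, and `L(x,y,3k) = L(y,x,3k)` (`exists_twistedLink_eq`, `twistedLink_swap`). This gives
the second part and the identifications of torus links in the third one.

The first part says that the Jones polynomial determines `k` and the unordered pair `{x, y}` in this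
normal form. The Kauffman bracket is treated as a composition of linear operators, one for each slice,
on functionals of partial smoothings; its invariance under all local moves shows that the polynomial
of a link can be computed from any diagram (`Diagram.jones_link`). On three strands the functionals
obtained from closed braids are Markov traces on the Temperley-Lieb algebra, which leads to Jones's
formula with the trace of the reduced Burau matrix (`twistedLink_jones`). With `u = -t`, it gives
`u (1 - u) ^ 2 V = ± t ^ ((x + y + 6 k) / 2) P(u)` for
`P = -(1 + u ^ 2) (1 - u) ^ 2 + (-1) ^ k u ^ (3 k + 1) B(x,y)`. Since `P(0) = -1`, the lowest term
of `V` shows `x + y + 6 k`, so that `P` is known too. The polynomial `B(x,y)` is divisible by `u ^ 3`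
only for `{x, y} = {1, 2}`, where it vanishes, and so `P` and `x + y + 6 k` determine `k` and
`{x, y}` (`eq_of_jones_eq`).

For the third part, the braid index of torus links has to be bounded from below. Colourings of a
diagram by elements of a group `G` (representations of the link group) are carried along by the local
moves, without a change of what the colours generate (`Link.images`). If the colours are
pseudoreflections of an `N`-dimensional space, then those of a closed braid on `n < N` strands fix a
common vector, because `n` of them generate all. The torus link `T(r,s)` has a colouring in every group
with elements `D`, `E` such that `D ^ r` and `E ^ s` are central, in which `E D⁻¹` and its conjugates by
powers of `D` are colours. Two companion matrices `D`, `E` of size `N = min r s`, whose characteristic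
polynomials divide `X ^ r - 2` and `X ^ s - 1`, make these colours pseudoreflections without a common
fixed vector.
So `T(r,s)` is not the closure of a braid with
fewer than `min r s` strands (`le_of_closure_eq_torusLink`). A torus link of braid index three is
therefore some `T(3,n)` with `n ≥ 3`, and comparing normal forms ends the proof.
-/

namespace LinkTheory

/-! ### Local moves on stacks of slices -/

/-- The link of a stack of slices, and `none` if the stack is not a link diagram. -/
noncomputable def linkOf (w : List Slice) : Option Link :=
  open Classical in if h : run w [] = some [] then some (Diagram.link ⟨w, h⟩) else none

theorem Diagram.linkOf_slices (D : Diagram) : linkOf D.slices = some D.link := by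
  simp [linkOf, D.closed]

theorem Slice.step_succ (i : ℕ) (p : Piece) (a : Bool) (o : List Bool) :
    Slice.step ⟨i + 1, p⟩ (a :: o) = (Slice.step ⟨i, p⟩ o).map (a :: ·) := by
  cases p with
  | cup up => simp only [Slice.step, List.length_cons, Nat.add_le_add_iff_right]; split <;> simp
  | cap =>
    simp only [Slice.step, List.drop_succ_cons]
    rcases o.drop i with _ | ⟨x, _ | ⟨y, r⟩⟩ <;> simp
    split <;> simp
  | cross e =>
    simp only [Slice.step, List.drop_succ_cons]
    rcases o.drop i with _ | ⟨x, _ | ⟨y, r⟩⟩ <;> simp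

/-- A slice that is moved by one strand to the right. -/
def Slice.shift (x : Slice) : Slice := ⟨x.pos + 1, x.piece⟩

theorem run_shift (w : List Slice) (a : Bool) (o : List Bool) :
    run (w.map Slice.shift) (a :: o) = (run w o).map (a :: ·) := by
  induction w generalizing o with
  | nil => rfl
  | cons x w ih =>
    simp only [List.map_cons, run, Slice.shift, Slice.step_succ]
    cases x.step o with
    | none => rfl
    | some o' => exact ih o'

theorem Slice.step_shift_nil (x : Slice) : x.shift.step [] = none := by
  rcases x with ⟨i, _ | _ | _⟩ <;> simp [Slice.shift, Slice.step]

theorem run_shift_nil {w : List Slice} (h : w ≠ []) : run (w.map Slice.shift) [] = none := by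
  cases w with
  | nil => exact absurd rfl h
  | cons x w => simp [run, Slice.step_shift_nil]

/-- An induction principle for stacks of slices at the position `i`: an identity between their
actions on levels has to be checked only at the left end. -/
theorem run_congr_of_shift {l r : ℕ → List Slice}
    (hl : ∀ i, l (i + 1) = (l i).map Slice.shift) (hr : ∀ i, r (i + 1) = (r i).map Slice.shift)
    (hl0 : ∀ i, l i ≠ []) (hr0 : ∀ i, r i ≠ []) (h0 : ∀ o, run (l 0) o = run (r 0) o)
    (i : ℕ) (o : List Bool) : run (l i) o = run (r i) o := by
  induction i generalizing o with
  | zero => exact h0 o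
  | succ i ih =>
    rw [hl, hr]
    cases o with
    | nil => rw [run_shift_nil (hl0 i), run_shift_nil (hr0 i)]
    | cons a o => rw [run_shift, run_shift, ih]

theorem Slice.step_cup_zero (up : Bool) (o : List Bool) :
    Slice.step ⟨0, .cup up⟩ o = some (up :: (!up) :: o) := by
  simp [Slice.step]

theorem Slice.step_cap_zero (a b : Bool) (o : List Bool) :
    Slice.step ⟨0, .cap⟩ (a :: b :: o) = if a = b then none else some o := by
  simp [Slice.step]

theorem Slice.step_cross_zero (e a b : Bool) (o : List Bool) :
    Slice.step ⟨0, .cross e⟩ (a :: b :: o) = some (b :: a :: o) := by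
  simp [Slice.step]

theorem run_far (i k : ℕ) (p q : Piece) (o : List Bool) :
    run [⟨i + p.dom + k, q⟩, ⟨i, p⟩] o = run [⟨i, p⟩, ⟨i + p.cod + k, q⟩] o := by
  refine run_congr_of_shift (l := fun i => [⟨i + p.dom + k, q⟩, ⟨i, p⟩])
    (r := fun i => [⟨i, p⟩, ⟨i + p.cod + k, q⟩]) (fun i => ?_) (fun i => ?_) (by simp) (by simp)
    (fun o => ?_) i o
  · simp [Slice.shift]; omega
  · simp [Slice.shift]; omega
  · have hnil : ∀ k, Slice.step ⟨k + 1, q⟩ [] = none := fun k => Slice.step_shift_nil ⟨k, q⟩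
    have hcap : ∀ o : List Bool, o.length < 2 → Slice.step ⟨0, .cap⟩ o = none := by
      rintro (_ | ⟨a, _ | ⟨b, o⟩⟩) h <;> simp_all [Slice.step]
    have hcross : ∀ (o : List Bool) e, o.length < 2 → Slice.step ⟨0, .cross e⟩ o = none := by
      rintro (_ | ⟨a, _ | ⟨b, o⟩⟩) e h <;> simp_all [Slice.step]
    cases p with
    | cup up =>
      simp only [run, Piece.dom, Piece.cod, Slice.step_cup_zero, Option.bind_some, Nat.zero_add]
      rw [show 2 + k = k + 1 + 1 by omega, Slice.step_succ, Slice.step_succ]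
      cases Slice.step ⟨k, q⟩ o <;> simp
    | cap =>
      simp only [run, Piece.dom, Piece.cod, Nat.zero_add]
      rw [show 2 + k = k + 1 + 1 by omega]
      rcases o with _ | ⟨a, _ | ⟨b, o⟩⟩
      · simp [hnil, hcap]
      · simp [hnil, hcap, Slice.step_succ]
      · simp only [Slice.step_succ, Slice.step_cap_zero]
        by_cases hab : a = b
        · cases Slice.step ⟨k, q⟩ o <;> simp [Slice.step_cap_zero, hab]
        · cases h : Slice.step ⟨k, q⟩ o <;> simp [Slice.step_cap_zero, hab, h]
    | cross e =>
      simp only [run, Piece.dom, Piece.cod, Nat.zero_add]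
      rw [show 2 + k = k + 1 + 1 by omega]
      rcases o with _ | ⟨a, _ | ⟨b, o⟩⟩
      · simp [hnil, hcross]
      · simp [hnil, hcross, Slice.step_succ]
      · simp only [Slice.step_succ, Slice.step_cross_zero]
        cases h : Slice.step ⟨k, q⟩ o <;>
          simp [Slice.step_cross_zero, Slice.step_succ, h]

theorem run_slideCup (i : ℕ) (up e : Bool) (o : List Bool) :
    run [⟨i, .cup up⟩, ⟨i + 1, .cross e⟩] o = run [⟨i + 1, .cup up⟩, ⟨i, .cross (!e)⟩] o := by
  refine run_congr_of_shift (l := fun i => [⟨i, .cup up⟩, ⟨i + 1, .cross e⟩])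
    (r := fun i => [⟨i + 1, .cup up⟩, ⟨i, .cross (!e)⟩]) (fun _ => rfl) (fun _ => rfl)
    (by simp) (by simp) (fun o => ?_) i o
  rcases o with _ | ⟨a, o⟩ <;> simp [run, Slice.step]

theorem run_slideCap (i : ℕ) (e : Bool) (o : List Bool) :
    run [⟨i + 1, .cross e⟩, ⟨i, .cap⟩] o = run [⟨i, .cross (!e)⟩, ⟨i + 1, .cap⟩] o := by
  refine run_congr_of_shift (l := fun i => [⟨i + 1, .cross e⟩, ⟨i, .cap⟩])
    (r := fun i => [⟨i, .cross (!e)⟩, ⟨i + 1, .cap⟩]) (fun _ => rfl) (fun _ => rfl)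
    (by simp) (by simp) (fun o => ?_) i o
  rcases o with _ | ⟨a, _ | ⟨b, _ | ⟨c, o⟩⟩⟩ <;> simp [run, Slice.step]

theorem run_reidemeister1Cup (i : ℕ) (up e : Bool) (o : List Bool) :
    run [⟨i, .cup up⟩, ⟨i, .cross e⟩] o = run [⟨i, .cup (!up)⟩] o := by
  refine run_congr_of_shift (l := fun i => [⟨i, .cup up⟩, ⟨i, .cross e⟩])
    (r := fun i => [⟨i, .cup (!up)⟩]) (fun _ => rfl) (fun _ => rfl)
    (by simp) (by simp) (fun o => ?_) i o
  simp [run, Slice.step]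

theorem run_reidemeister1Cap (i : ℕ) (e : Bool) (o : List Bool) :
    run [⟨i, .cross e⟩, ⟨i, .cap⟩] o = run [⟨i, .cap⟩] o := by
  refine run_congr_of_shift (l := fun i => [⟨i, .cross e⟩, ⟨i, .cap⟩])
    (r := fun i => [⟨i, .cap⟩]) (fun _ => rfl) (fun _ => rfl)
    (by simp) (by simp) (fun o => ?_) i o
  rcases o with _ | ⟨a, _ | ⟨b, o⟩⟩ <;> simp [run, Slice.step, eq_comm]

theorem run_reidemeister3 (i : ℕ) (a b c : Bool) (o : List Bool) :
    run [⟨i, .cross a⟩, ⟨i + 1, .cross b⟩, ⟨i, .cross c⟩] o =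
      run [⟨i + 1, .cross c⟩, ⟨i, .cross b⟩, ⟨i + 1, .cross a⟩] o := by
  refine run_congr_of_shift (l := fun i => [⟨i, .cross a⟩, ⟨i + 1, .cross b⟩, ⟨i, .cross c⟩])
    (r := fun i => [⟨i + 1, .cross c⟩, ⟨i, .cross b⟩, ⟨i + 1, .cross a⟩]) (fun _ => rfl)
    (fun _ => rfl) (by simp) (by simp) (fun o => ?_) i o
  rcases o with _ | ⟨a, _ | ⟨b, _ | ⟨c, o⟩⟩⟩ <;> simp [run, Slice.step]

/-- The right side of a move fits wherever its left side does, and leads to the same level. -/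
theorem Move.run_eq_some {l r : List Slice} (m : Move l r) {o o' : List Bool}
    (h : run l o = some o') : run r o = some o' := by
  have key : ∀ l : ℕ → List Slice, (∀ i, l (i + 1) = (l i).map Slice.shift) → (∀ i, l i ≠ []) →
      (∀ o o', run (l 0) o = some o' → o = o') → ∀ i o o', run (l i) o = some o' → o = o' := by
    intro l hl hl0 h0 i
    induction i with
    | zero => exact h0
    | succ i ih =>
      intro o o' h
      rw [hl] at h
      cases o with
      | nil => rw [run_shift_nil (hl0 i)] at h; cases h
      | cons a o =>
        rw [run_shift] at h
        obtain ⟨o1, h1, rfl⟩ := Option.map_eq_some_iff.1 h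
        rw [ih _ _ h1]
  cases m with
  | far i k p q => rwa [← run_far]
  | slideCup i up e => rwa [← run_slideCup]
  | slideCap i e => rwa [← run_slideCap]
  | reidemeister1Cup i up e => rwa [← run_reidemeister1Cup i up e]
  | reidemeister1Cap i e => rwa [← run_reidemeister1Cap i e]
  | reidemeister3 i a b c _ => rwa [← run_reidemeister3]
  | zigzag i up =>
    refine congrArg some (key (fun i => [⟨i, .cup up⟩, ⟨i + 1, .cap⟩]) (fun _ => rfl) (by simp)
      (fun o o' h => ?_) i o o' h)
    rcases o with _ | ⟨a, o⟩ <;> simp [run, Slice.step] at h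
    cases a <;> cases up <;> simp_all
  | zigzag' i up =>
    refine congrArg some (key (fun i => [⟨i + 1, .cup up⟩, ⟨i, .cap⟩]) (fun _ => rfl) (by simp)
      (fun o o' h => ?_) i o o' h)
    rcases o with _ | ⟨a, o⟩ <;> simp [run, Slice.step] at h
    cases a <;> cases up <;> simp_all
  | reidemeister2 i e =>
    refine congrArg some (key (fun i => [⟨i, .cross e⟩, ⟨i, .cross (!e)⟩]) (fun _ => rfl) (by simp)
      (fun o o' h => ?_) i o o' h)
    rcases o with _ | ⟨a, _ | ⟨b, o⟩⟩ <;> simp [run, Slice.step] at h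
    exact h

/-- A move does not change the link, provided that both of its sides fit at the same places. This
has to be assumed, because the empty right side of a move fits everywhere. -/
theorem linkOf_move {l r : List Slice} (m : Move l r) (u v : List Slice)
    (h : ∀ o, run u [] = some o → run l o = run r o) :
    linkOf (u ++ l ++ v) = linkOf (u ++ r ++ v) := by
  have hrun : run (u ++ l ++ v) [] = run (u ++ r ++ v) [] := by
    simp only [run_append]
    cases hu : run u [] with
    | none => rfl
    | some o => simp [h o hu]
  unfold linkOf
  by_cases hl : run (u ++ l ++ v) [] = some []
  · rw [dif_pos hl, dif_pos (hrun ▸ hl)]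
    exact congrArg some (Quot.sound ⟨u, v, l, r, m, rfl, rfl⟩)
  · rw [dif_neg hl, dif_neg (hrun ▸ hl)]

/-- Two stacks of slices that can be replaced by each other in all link diagrams. -/
def Same (l r : List Slice) : Prop := ∀ u v, linkOf (u ++ l ++ v) = linkOf (u ++ r ++ v)

theorem Same.refl (l : List Slice) : Same l l := fun _ _ => rfl

theorem Same.symm {l r : List Slice} (h : Same l r) : Same r l := fun u v => (h u v).symm

theorem Same.trans {l r s : List Slice} (h : Same l r) (h' : Same r s) : Same l s :=
  fun u v => (h u v).trans (h' u v)

theorem Same.append {l r l' r' : List Slice} (h : Same l r) (h' : Same l' r') :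
    Same (l ++ l') (r ++ r') := fun u v => by
  have h1 := h u (l' ++ v)
  have h2 := h' (u ++ r) v
  simp only [List.append_assoc] at h1 h2 ⊢
  exact h1.trans h2

theorem Same.cons (x : Slice) {l r : List Slice} (h : Same l r) : Same (x :: l) (x :: r) :=
  (Same.refl [x]).append h

theorem Same.linkOf_eq {l r : List Slice} (h : Same l r) : linkOf l = linkOf r := by
  simpa using h [] []

theorem same_far (i k : ℕ) (p q : Piece) :
    Same [⟨i + p.dom + k, q⟩, ⟨i, p⟩] [⟨i, p⟩, ⟨i + p.cod + k, q⟩] := fun u v =>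
  linkOf_move (.far i k p q) u v fun o _ => run_far i k p q o

theorem same_slideCup (i : ℕ) (up e : Bool) :
    Same [⟨i, .cup up⟩, ⟨i + 1, .cross e⟩] [⟨i + 1, .cup up⟩, ⟨i, .cross (!e)⟩] := fun u v =>
  linkOf_move (.slideCup i up e) u v fun o _ => run_slideCup i up e o

theorem same_slideCap (i : ℕ) (e : Bool) :
    Same [⟨i + 1, .cross e⟩, ⟨i, .cap⟩] [⟨i, .cross (!e)⟩, ⟨i + 1, .cap⟩] := fun u v =>
  linkOf_move (.slideCap i e) u v fun o _ => run_slideCap i e o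

theorem same_reidemeister1Cup (i : ℕ) (up e : Bool) :
    Same [⟨i, .cup up⟩, ⟨i, .cross e⟩] [⟨i, .cup (!up)⟩] := fun u v =>
  linkOf_move (.reidemeister1Cup i up e) u v fun o _ => run_reidemeister1Cup i up e o

theorem same_reidemeister3 (i : ℕ) (e : Bool) :
    Same [⟨i, .cross e⟩, ⟨i + 1, .cross e⟩, ⟨i, .cross e⟩]
      [⟨i + 1, .cross e⟩, ⟨i, .cross e⟩, ⟨i + 1, .cross e⟩] := fun u v =>
  linkOf_move (.reidemeister3 i e e e (.inl rfl)) u v fun o _ => run_reidemeister3 i e e e o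

/-! ### Conjugation and stabilization of closed braids -/

theorem nestedCups_succ (n : ℕ) : nestedCups (n + 1) = nestedCups n ++ [⟨n, .cup true⟩] := by
  simp [nestedCups, List.range_succ]

theorem nestedCaps_succ (n : ℕ) : nestedCaps (n + 1) = ⟨n, .cap⟩ :: nestedCaps n := by
  simp [nestedCaps, List.range_succ]

/-- A crossing of two left legs of nested minima can be moved to the right legs. -/
theorem same_nestedCups_cross (n j : ℕ) (e : Bool) (hj : j + 1 < n) :
    Same (nestedCups n ++ [⟨j, .cross e⟩]) (nestedCups n ++ [⟨2 * n - 2 - j, .cross e⟩]) := by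
  induction n with
  | zero => omega
  | succ n ih =>
    rcases Nat.lt_or_ge (j + 1) n with h | h
    · -- the crossing passes the innermost minimum, moves to the right legs, and passes it again
      have h1 : Same [⟨n, .cup true⟩, ⟨j, .cross e⟩] [⟨j, .cross e⟩, ⟨n, .cup true⟩] := by
        have := same_far j (n - j - 2) (.cross e) (.cup true)
        simp only [Piece.dom, Piece.cod] at this
        rwa [show j + 2 + (n - j - 2) = n by omega] at this
      have h2 : Same [⟨2 * n - 2 - j, .cross e⟩, ⟨n, .cup true⟩]
          [⟨n, .cup true⟩, ⟨2 * (n + 1) - 2 - j, .cross e⟩] := by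
        have := same_far n (n - 2 - j) (.cup true) (.cross e)
        simp only [Piece.dom, Piece.cod] at this
        rwa [show n + 0 + (n - 2 - j) = 2 * n - 2 - j by omega,
          show n + 2 + (n - 2 - j) = 2 * (n + 1) - 2 - j by omega] at this
      have a1 := (Same.refl (nestedCups n)).append h1
      have a2 := (ih h).append (Same.refl [⟨n, .cup true⟩])
      have a3 := (Same.refl (nestedCups n)).append h2
      rw [nestedCups_succ]
      simp only [List.append_assoc, List.cons_append, List.nil_append] at a1 a2 a3 ⊢
      exact a1.trans (a2.trans a3)
    · -- a crossing of the two innermost minima slides over each of them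
      obtain rfl : n = j + 1 := by omega
      have hs : nestedCups (j + 1 + 1) = nestedCups j ++ [⟨j, .cup true⟩, ⟨j + 1, .cup true⟩] := by
        simp [nestedCups_succ]
      rw [hs, show 2 * (j + 1 + 1) - 2 - j = j + 2 by omega]
      simp only [List.append_assoc]
      refine (Same.refl _).append ?_
      have b1 := (same_slideCup j true (!e)).symm
      have b2 := same_far j 0 (.cup true) (.cup true)
      have b3 := (same_slideCup (j + 1) true e).symm
      simp only [Bool.not_not, Piece.dom, Piece.cod, Nat.add_zero] at b1 b2
      have c1 := b1.cons ⟨j, .cup true⟩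
      have c2 := b2.append (Same.refl [⟨j + 1, .cross (!e)⟩])
      have c3 := b3.cons ⟨j, .cup true⟩
      exact c1.trans (c2.trans c3)

/-- A crossing of two left legs of nested maxima can be moved to the right legs. -/
theorem same_cross_nestedCaps (n j : ℕ) (e : Bool) (hj : j + 1 < n) :
    Same (⟨j, .cross e⟩ :: nestedCaps n) (⟨2 * n - 2 - j, .cross e⟩ :: nestedCaps n) := by
  induction n with
  | zero => omega
  | succ n ih =>
    rcases Nat.lt_or_ge (j + 1) n with h | h
    · -- the crossing passes the innermost maximum, moves to the right legs, and passes it again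
      have h1 : Same [⟨j, .cross e⟩, ⟨n, .cap⟩] [⟨n, .cap⟩, ⟨j, .cross e⟩] := by
        have := (same_far j (n - j - 2) (.cross e) .cap).symm
        simp only [Piece.dom, Piece.cod] at this
        rwa [show j + 2 + (n - j - 2) = n by omega] at this
      have h2 : Same [⟨n, .cap⟩, ⟨2 * n - 2 - j, .cross e⟩]
          [⟨2 * (n + 1) - 2 - j, .cross e⟩, ⟨n, .cap⟩] := by
        have := (same_far n (n - 2 - j) .cap (.cross e)).symm
        simp only [Piece.dom, Piece.cod] at this
        rwa [show n + 0 + (n - 2 - j) = 2 * n - 2 - j by omega,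
          show n + 2 + (n - 2 - j) = 2 * (n + 1) - 2 - j by omega] at this
      have a1 := h1.append (Same.refl (nestedCaps n))
      have a2 := (ih h).cons ⟨n, .cap⟩
      have a3 := h2.append (Same.refl (nestedCaps n))
      rw [nestedCaps_succ]
      exact a1.trans (a2.trans a3)
    · -- a crossing of the two innermost maxima slides over each of them
      obtain rfl : n = j + 1 := by omega
      have hs : nestedCaps (j + 1 + 1) = [⟨j + 1, .cap⟩, ⟨j, .cap⟩] ++ nestedCaps j := by
        simp [nestedCaps_succ]
      rw [hs, show 2 * (j + 1 + 1) - 2 - j = j + 2 by omega]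
      refine Same.append (l := [⟨j, .cross e⟩, ⟨j + 1, .cap⟩, ⟨j, .cap⟩])
        (r := [⟨j + 2, .cross e⟩, ⟨j + 1, .cap⟩, ⟨j, .cap⟩]) ?_ (Same.refl _)
      have b1 := (same_slideCap j (!e)).symm
      have b2 := (same_far j 0 .cap .cap).symm
      have b3 := (same_slideCap (j + 1) e).symm
      simp only [Bool.not_not, Piece.dom, Piece.cod, Nat.add_zero] at b1 b2
      have c1 := b1.append (Same.refl [⟨j, .cap⟩])
      have c2 := b2.cons ⟨j + 1, .cross (!e)⟩
      have c3 := b3.append (Same.refl [⟨j, .cap⟩])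
      exact c1.trans (c2.trans c3)

/-- The crossings of a braid word on any number of strands; the letter `(i, true)` stands for
`σ_{i+1}`, and `(i, false)` for its inverse. -/
def crossings (w : List (ℕ × Bool)) : List Slice := w.map fun g => ⟨g.1, .cross g.2⟩

/-- The stack of slices of the closure of a braid word on `n` strands. -/
def closureSlices (n : ℕ) (w : List (ℕ × Bool)) : List Slice :=
  nestedCups n ++ crossings w ++ nestedCaps n

theorem crossings_append (w w' : List (ℕ × Bool)) :
    crossings (w ++ w') = crossings w ++ crossings w' := List.map_append

/-- A piece to the right of a braid can be moved past the braid. -/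
theorem same_crossings_far (w : List (ℕ × Bool)) (m : ℕ) (hw : ∀ g ∈ w, g.1 + 2 ≤ m) (p : Piece) :
    Same (⟨m, p⟩ :: crossings w) (crossings w ++ [⟨m, p⟩]) := by
  induction w with
  | nil => exact Same.refl _
  | cons g w ih =>
    have h1 := same_far g.1 (m - g.1 - 2) (.cross g.2) p
    have hi := hw g (by simp)
    simp only [Piece.dom, Piece.cod] at h1
    rw [show g.1 + 2 + (m - g.1 - 2) = m by omega] at h1
    have h2 := ih fun k hk => hw k (by simp [hk])
    exact (h1.append (Same.refl (crossings w))).trans (h2.cons _)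

/-- The first crossing of a closed braid travels along the closing arcs and becomes the last one. -/
theorem same_closureSlices_rotate (n : ℕ) (g : ℕ × Bool) (w : List (ℕ × Bool)) (hg : g.1 + 1 < n)
    (hw : ∀ g ∈ w, g.1 + 1 < n) :
    Same (closureSlices n (g :: w)) (closureSlices n (w ++ [g])) := by
  have h1 := (same_nestedCups_cross n g.1 g.2 hg).append (Same.refl (crossings w ++ nestedCaps n))
  have h2 := (same_crossings_far w (2 * n - 2 - g.1)
    (fun i hi => by have := hw i hi; omega) (.cross g.2)).append (Same.refl (nestedCaps n))
  have h3 := (Same.refl (crossings w)).append (same_cross_nestedCaps n g.1 g.2 hg).symm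
  have h2' := (Same.refl (nestedCups n)).append h2
  have h3' := (Same.refl (nestedCups n)).append h3
  simp only [closureSlices, crossings, List.map_cons, List.map_append, List.map_nil,
    List.append_assoc, List.cons_append, List.nil_append] at h1 h2' h3' ⊢
  exact h1.trans (h2'.trans h3')

/-- Markov's first move: conjugate braids have the same closure. -/
theorem same_closureSlices_comm (n : ℕ) (w w' : List (ℕ × Bool)) (hw : ∀ g ∈ w, g.1 + 1 < n)
    (hw' : ∀ g ∈ w', g.1 + 1 < n) :
    Same (closureSlices n (w ++ w')) (closureSlices n (w' ++ w)) := by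
  induction w generalizing w' with
  | nil => simpa using Same.refl _
  | cons j w ih =>
    have h1 := same_closureSlices_rotate n j (w ++ w') (hw j (by simp)) (by
      intro i hi
      rcases List.mem_append.1 hi with hi | hi
      · exact hw i (by simp [hi])
      · exact hw' i hi)
    have h2 := ih (w' ++ [j]) (fun i hi => hw i (by simp [hi])) (by
      intro i hi
      rcases List.mem_append.1 hi with hi | hi
      · exact hw' i hi
      · exact hw i (by simp_all))
    simpa using h1.trans (by simpa using h2)

theorem run_crossings_replicate (n : ℕ) (w : List (ℕ × Bool)) (hw : ∀ g ∈ w, g.1 + 1 < n)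
    (l : List Bool) :
    run (crossings w) (List.replicate n true ++ l) = some (List.replicate n true ++ l) := by
  induction w with
  | nil => rfl
  | cons i w ih =>
    have hi := hw i (by simp)
    have h := run_crossings (n := n) [(⟨i.1, by omega⟩, i.2)] l
    simp only [BraidWord.crossings, List.map_cons, List.map_nil, run, Option.bind_fun_some] at h
    simp only [crossings, List.map_cons, run, h]
    exact ih fun k hk => hw k (by simp [hk])

/-- Markov's second move: the last strand of a closed braid can be removed if it meets only one
crossing. -/
theorem linkOf_closureSlices_stabilize (n : ℕ) (w : List (ℕ × Bool))
    (hw : ∀ g ∈ w, g.1 + 1 < n + 1) :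
    linkOf (closureSlices (n + 2) (w ++ [(n, true)])) = linkOf (closureSlices (n + 1) w) := by
  have h1 := same_crossings_far w (n + 1) (fun i hi => by have := hw i hi; omega) (.cup true)
  have h2 := ((same_slideCap n false).symm).cons ⟨n + 1, .cup true⟩
  have h3 := (same_reidemeister1Cup (n + 1) true false).append (Same.refl [⟨n, .cap⟩])
  have h4 := ((Same.refl (nestedCups (n + 1))).append h1).append
    (Same.refl ([⟨n, .cross true⟩, ⟨n + 1, .cap⟩] ++ nestedCaps (n + 1)))
  have h5 := (Same.refl (nestedCups (n + 1) ++ crossings w)).append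
    ((h2.trans h3).append (Same.refl (nestedCaps (n + 1))))
  have h6 := linkOf_move (.zigzag' n false) (nestedCups (n + 1) ++ crossings w)
    (nestedCaps (n + 1)) (by
      intro o ho
      rw [run_append, run_nestedCups, Option.bind_some, run_crossings_replicate _ _ hw,
        Option.some_inj] at ho
      subst ho
      rw [List.replicate_succ' (n := n), List.append_assoc]
      have hl : (List.replicate n true).length = n := by simp
      simp [run, Slice.step, List.drop_append, List.take_append])
  simp only [closureSlices, nestedCups_succ (n + 1), nestedCaps_succ (n + 1), crossings, List.map_append, List.map_cons, List.map_nil,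
    List.append_assoc, List.cons_append, List.nil_append, Bool.not_true, Bool.not_false] at *
  rw [h4.linkOf_eq, h5.linkOf_eq, h6]

/-- The inverse of a braid word. -/
def invWord (w : List (ℕ × Bool)) : List (ℕ × Bool) := (w.map fun g => (g.1, !g.2)).reverse

theorem mem_invWord {w : List (ℕ × Bool)} {n : ℕ} (hw : ∀ g ∈ w, g.1 + 1 < n) :
    ∀ g ∈ invWord w, g.1 + 1 < n := by
  intro g hg
  simp only [invWord, List.mem_reverse, List.mem_map] at hg
  obtain ⟨g', hg', rfl⟩ := hg
  exact hw g' hg'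

theorem invWord_invWord (w : List (ℕ × Bool)) : invWord (invWord w) = w := by
  simp [invWord, List.map_reverse, Function.comp_def]

/-- A braid word followed by its inverse can be cancelled, by moves of the second type. -/
theorem linkOf_closureSlices_cancel (n : ℕ) (p u q : List (ℕ × Bool)) (hp : ∀ g ∈ p, g.1 + 1 < n)
    (hu : ∀ g ∈ u, g.1 + 1 < n) :
    linkOf (closureSlices n (p ++ u ++ invWord u ++ q)) = linkOf (closureSlices n (p ++ q)) := by
  induction u using List.reverseRecOn with
  | nil => simp [invWord]
  | append_singleton u g ih =>
    have hpu : ∀ g ∈ p ++ u, g.1 + 1 < n := by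
      intro i hi
      rcases List.mem_append.1 hi with hi | hi
      · exact hp i hi
      · exact hu i (by simp [hi])
    have hg := hu g (by simp)
    rw [← ih fun i hi => hu i (by simp [hi])]
    have h := linkOf_move (.reidemeister2 g.1 g.2) (nestedCups n ++ crossings (p ++ u))
      (crossings (invWord u ++ q) ++ nestedCaps n) (by
        intro o ho
        rw [run_append, run_nestedCups, Option.bind_some, run_crossings_replicate _ _ hpu,
          Option.some_inj] at ho
        subst ho
        exact run_crossings_replicate n [g, (g.1, !g.2)] (by simp [hg]) _)
    simpa [closureSlices, crossings, invWord] using h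

/-- Conjugate braid words have the same closure. -/
theorem linkOf_closureSlices_conj (n : ℕ) (u x : List (ℕ × Bool)) (hu : ∀ g ∈ u, g.1 + 1 < n)
    (hx : ∀ g ∈ x, g.1 + 1 < n) :
    linkOf (closureSlices n (u ++ x ++ invWord u)) = linkOf (closureSlices n x) := by
  have hxu : ∀ g ∈ x ++ invWord u, g.1 + 1 < n := by
    intro i hi
    rcases List.mem_append.1 hi with hi | hi
    · exact hx i hi
    · exact mem_invWord hu i hi
  have h1 := linkOf_closureSlices_cancel n x (invWord u) [] hx (mem_invWord hu)
  rw [invWord_invWord, List.append_nil, List.append_nil] at h1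
  rw [List.append_assoc, (same_closureSlices_comm n _ _ hu hxu).linkOf_eq, h1]

/-! ### The positive braid monoid -/

/-- The defining relations of the monoid of positive braids. -/
inductive BraidRel : FreeMonoid ℕ → FreeMonoid ℕ → Prop
  | far (i k : ℕ) : BraidRel (.of (i + 2 + k) * .of i) (.of i * .of (i + 2 + k))
  | braid (i : ℕ) : BraidRel (.of i * .of (i + 1) * .of i) (.of (i + 1) * .of i * .of (i + 1))

/-- The monoid of positive braids on an unbounded number of strands. -/
abbrev BraidMonoid : Type := PresentedMonoid BraidRel

/-- The generator `σ_{i+1}` of the braid monoid. -/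
def σ (i : ℕ) : BraidMonoid := PresentedMonoid.of BraidRel i

theorem σ_far {i j : ℕ} (h : i + 2 ≤ j) : σ j * σ i = σ i * σ j := by
  obtain ⟨k, rfl⟩ := Nat.exists_eq_add_of_le h
  exact (Con.eq _).2 (ConGen.Rel.of _ _ (BraidRel.far i k))

theorem σ_braid (i : ℕ) : σ i * σ (i + 1) * σ i = σ (i + 1) * σ i * σ (i + 1) :=
  (Con.eq _).2 (ConGen.Rel.of _ _ (BraidRel.braid i))

/-- The letters of a positive braid word. -/
def letters (w : FreeMonoid ℕ) : List (ℕ × Bool) := w.toList.map fun i => (i, true)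

/-- The congruence of positive braid words that can be replaced by each other in link diagrams. -/
def sameCon : Con (FreeMonoid ℕ) where
  r x y := Same (crossings (letters x)) (crossings (letters y))
  iseqv := ⟨fun _ => Same.refl _, Same.symm, Same.trans⟩
  mul' h h' := by
    simpa only [letters, FreeMonoid.toList_mul, List.map_append, crossings_append] using h.append h'

/-- The defining relations of the braid monoid are moves of link diagrams. -/
theorem conGen_braidRel_le : conGen BraidRel ≤ sameCon := by
  refine Con.conGen_le.2 fun x y h => ?_
  cases h with
  | far i k =>
    have := same_far i k (.cross true) (.cross true)
    exact this
  | braid i => exact same_reidemeister3 i true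

/-- The closure on `n` strands of a positive braid. -/
noncomputable def closedBraid (n : ℕ) (x : BraidMonoid) : Option Link :=
  Con.liftOn x (fun w => linkOf (closureSlices n (letters w))) fun w w' h => by
    have h' : Same (crossings (letters w)) (crossings (letters w')) := conGen_braidRel_le h
    exact (((Same.refl (nestedCups n)).append h').append (Same.refl (nestedCaps n))).linkOf_eq

/-- The positive braids on `n` strands. -/
def strands (n : ℕ) : Submonoid BraidMonoid := Submonoid.closure {x | ∃ i, i + 1 < n ∧ x = σ i}

theorem σ_mem_strands {i n : ℕ} (h : i + 1 < n) : σ i ∈ strands n :=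
  Submonoid.subset_closure ⟨i, h, rfl⟩

theorem strands_mono {m n : ℕ} (h : m ≤ n) : strands m ≤ strands n :=
  Submonoid.closure_mono fun _ ⟨i, hi, hx⟩ => ⟨i, by omega, hx⟩

/-- The positive braid of a word. -/
def braidOf (w : FreeMonoid ℕ) : BraidMonoid := PresentedMonoid.mk BraidRel w

theorem braidOf_mul (w w' : FreeMonoid ℕ) : braidOf (w * w') = braidOf w * braidOf w' :=
  map_mul (PresentedMonoid.mk BraidRel) w w'

theorem closedBraid_braidOf (n : ℕ) (w : FreeMonoid ℕ) :
    closedBraid n (braidOf w) = linkOf (closureSlices n (letters w)) := rfl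

theorem exists_word_of_mem_strands {n : ℕ} {x : BraidMonoid} (hx : x ∈ strands n) :
    ∃ w : FreeMonoid ℕ, (∀ g ∈ letters w, g.1 + 1 < n) ∧ braidOf w = x := by
  induction hx using Submonoid.closure_induction with
  | mem x hx =>
    obtain ⟨i, hi, rfl⟩ := hx
    exact ⟨.of i, by simpa [letters] using hi, rfl⟩
  | one => exact ⟨1, by simp [letters], rfl⟩
  | mul x y _ _ ihx ihy =>
    obtain ⟨w, hw, rfl⟩ := ihx
    obtain ⟨w', hw', rfl⟩ := ihy
    refine ⟨w * w', ?_, braidOf_mul w w'⟩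
    intro g hg
    simp only [letters, FreeMonoid.toList_mul, List.map_append, List.mem_append] at hg
    exact hg.elim (hw g) (hw' g)

theorem letters_mul (w w' : FreeMonoid ℕ) : letters (w * w') = letters w ++ letters w' := by
  simp [letters]

/-- Markov's first move. -/
theorem closedBraid_mul_comm {n : ℕ} {x y : BraidMonoid} (hx : x ∈ strands n)
    (hy : y ∈ strands n) : closedBraid n (x * y) = closedBraid n (y * x) := by
  obtain ⟨w, hw, rfl⟩ := exists_word_of_mem_strands hx
  obtain ⟨w', hw', rfl⟩ := exists_word_of_mem_strands hy
  simp only [← braidOf_mul, closedBraid_braidOf, letters_mul]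
  exact (same_closureSlices_comm n _ _ hw hw').linkOf_eq

/-- Markov's second move. -/
theorem closedBraid_stabilize {n : ℕ} {x : BraidMonoid} (hx : x ∈ strands (n + 1)) :
    closedBraid (n + 2) (x * σ n) = closedBraid (n + 1) x := by
  obtain ⟨w, hw, rfl⟩ := exists_word_of_mem_strands hx
  change closedBraid (n + 2) (braidOf w * braidOf (.of n)) = _
  simp only [← braidOf_mul, closedBraid_braidOf, letters_mul]
  exact linkOf_closureSlices_stabilize n _ hw

/-- Conjugate positive braids have the same closure. -/
theorem closedBraid_conj {n : ℕ} {u x y : BraidMonoid} (hu : u ∈ strands n) (hx : x ∈ strands n)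
    (hy : y ∈ strands n) (h : u * x = y * u) : closedBraid n x = closedBraid n y := by
  obtain ⟨w, hw, rfl⟩ := exists_word_of_mem_strands hu
  obtain ⟨wx, hwx, rfl⟩ := exists_word_of_mem_strands hx
  obtain ⟨wy, hwy, rfl⟩ := exists_word_of_mem_strands hy
  rw [closedBraid_braidOf, closedBraid_braidOf, ← linkOf_closureSlices_conj n _ _ hw hwx]
  have h2 := linkOf_closureSlices_cancel n (letters wy) (letters w) [] hwy hw
  simp only [List.append_nil] at h2
  rw [← h2]
  simp only [← braidOf_mul] at h
  have h3 : Same (crossings (letters (w * wx))) (crossings (letters (wy * w))) :=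
    conGen_braidRel_le ((Con.eq _).1 h)
  have h4 := ((Same.refl (nestedCups n)).append h3).append
    (Same.refl (crossings (invWord (letters w)) ++ nestedCaps n))
  simp only [letters_mul, crossings_append] at h4
  simpa [closureSlices, crossings_append] using h4.linkOf_eq

/-! ### Closures of powers of `σ_1 ⋯ σ_{n-1}` -/

/-- The braid `σ_1 ⋯ σ_m` on `m + 1` strands. -/
def asc : ℕ → BraidMonoid
  | 0 => 1
  | m + 1 => asc m * σ m

/-- The braid `σ_{m+1} σ_m ⋯` with `k` factors, whose indices descend. -/
def desc : ℕ → ℕ → BraidMonoid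
  | 0, _ => 1
  | k + 1, m => desc k m * σ (m - k)

theorem asc_mem (m : ℕ) : asc m ∈ strands (m + 1) := by
  induction m with
  | zero => exact one_mem _
  | succ m ih => exact mul_mem (strands_mono (by omega) ih) (σ_mem_strands (by omega))

theorem desc_mem (k m n : ℕ) (h : m + 1 < n) : desc k m ∈ strands n := by
  induction k with
  | zero => exact one_mem _
  | succ k ih => exact mul_mem ih (σ_mem_strands (by omega))

theorem desc_succ' {k m : ℕ} (h : k ≤ m + 1) : desc (k + 1) (m + 1) = σ (m + 1) * desc k m := by
  induction k with
  | zero => simp [desc]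
  | succ k ih =>
    rw [desc, ih (by omega), desc, mul_assoc, show m + 1 - (k + 1) = m - k by omega]

theorem σ_mul_asc {i m : ℕ} (h : m + 1 ≤ i) : σ i * asc m = asc m * σ i := by
  induction m with
  | zero => simp [asc]
  | succ m ih => rw [asc, ← mul_assoc, ih (by omega), mul_assoc, σ_far (by omega), mul_assoc]

theorem σ_succ_mul_asc {i m : ℕ} (h : i + 2 ≤ m) : σ (i + 1) * asc m = asc m * σ i := by
  induction m, h using Nat.le_induction with
  | base =>
    have h := σ_braid i
    simp only [asc, mul_assoc] at h ⊢
    rw [h, ← mul_assoc, σ_mul_asc le_rfl, mul_assoc]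
  | succ m hm ih => rw [asc, ← mul_assoc, ih, mul_assoc, ← σ_far (by omega), mul_assoc]

theorem desc_mul_asc {k m : ℕ} (h : k ≤ m) :
    desc k m * asc (m + 1) = asc (m + 1) * desc k (m - 1) := by
  induction k with
  | zero => simp [desc]
  | succ k ih =>
    obtain ⟨i, hi⟩ : ∃ i, m - k = i + 1 := ⟨m - k - 1, by omega⟩
    rw [desc, desc, mul_assoc, hi, σ_succ_mul_asc (by omega), ← mul_assoc, ih (by omega),
      mul_assoc, show m - 1 - k = i by omega]

/-- The last crossings of the factors `σ_1 ⋯ σ_{m+1}` are collected at the end; their indices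
descend there, since each crossing passes all the later factors. -/
theorem asc_succ_pow {k m : ℕ} (h : k ≤ m + 1) : asc (m + 1) ^ k = asc m ^ k * desc k m := by
  induction k with
  | zero => simp [desc]
  | succ k ih =>
    rw [pow_succ, ih (by omega), mul_assoc, desc_mul_asc (by omega), pow_succ, asc]
    rcases m with _ | m
    · obtain rfl : k = 0 := by omega
      simp [desc]
    · rw [desc_succ' (by omega)]
      simp only [mul_assoc, Nat.add_sub_cancel]

theorem σ_mul_desc {k m i : ℕ} (h : i + k + 1 ≤ m) : σ i * desc k m = desc k m * σ i := by
  induction k with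
  | zero => simp [desc]
  | succ k ih =>
    rw [desc, ← mul_assoc, ih (by omega), mul_assoc, mul_assoc, ← σ_far (by omega)]

theorem desc_mul_σ {k m i : ℕ} (h : m ≤ i + k) (hi : i < m) (hk : k ≤ m) :
    desc (k + 1) m * σ (i + 1) = σ i * desc (k + 1) m := by
  induction k with
  | zero => omega
  | succ k ih =>
    rcases Nat.lt_or_ge (i + k) m with h' | h'
    · rw [desc, desc, show m - k = i + 1 by omega, show m - (k + 1) = i by omega, mul_assoc,
        mul_assoc, ← mul_assoc (σ (i + 1)), ← σ_braid, ← mul_assoc, ← mul_assoc,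
        ← σ_mul_desc (i := i) (by omega)]
      simp only [mul_assoc]
    · rw [desc, mul_assoc, ← σ_far (by omega), ← mul_assoc, ih h' (by omega), mul_assoc]

theorem desc_mul_desc {k l m : ℕ} (hl : l ≤ k) (h : k ≤ m) :
    desc (k + 1) m * desc l m = desc l (m - 1) * desc (k + 1) m := by
  induction l with
  | zero => simp [desc]
  | succ l ih =>
    obtain ⟨i, hi⟩ : ∃ i, m - l = i + 1 := ⟨m - l - 1, by omega⟩
    have e : ∀ m, desc (l + 1) m = desc l m * σ (m - l) := fun _ => rfl
    rw [e, e, ← mul_assoc, ih (by omega), mul_assoc, hi, desc_mul_σ (by omega) (by omega) h,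
      ← mul_assoc, show m - 1 - l = i by omega]

theorem desc_pred_mem {k m : ℕ} (h : k ≤ m) : desc k (m - 1) ∈ strands (m + 1) := by
  rcases k with _ | k
  · exact one_mem _
  · exact desc_mem _ _ _ (by omega)

/-- The last strand of a closed braid on `m + 2` strands can be removed, after which one more factor
`desc k (m - 1)` remains. -/
theorem closedBraid_asc_succ {k m : ℕ} (h : k ≤ m) (j : ℕ) :
    closedBraid (m + 2) (asc (m + 1) ^ (k + 1) * desc k m ^ j) =
      closedBraid (m + 1) (asc m ^ (k + 1) * desc k (m - 1) ^ (j + 1)) := by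
  have hd : desc (k + 1) m * desc k m ^ j = desc k (m - 1) ^ j * desc (k + 1) m := by
    induction j with
    | zero => simp
    | succ j ih => rw [pow_succ', ← mul_assoc, desc_mul_desc le_rfl h, mul_assoc, ih, pow_succ',
        mul_assoc]
  have hs : desc (k + 1) m = σ m * desc k (m - 1) := by
    rcases m with _ | m
    · obtain rfl : k = 0 := by omega
      simp [desc]
    · exact desc_succ' (by omega)
  have h1 : asc m ^ (k + 1) * desc k (m - 1) ^ j ∈ strands (m + 1) :=
    mul_mem (pow_mem (asc_mem m) _) (pow_mem (desc_pred_mem h) _)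
  have hle : strands (m + 1) ≤ strands (m + 2) := strands_mono (by omega)
  rw [asc_succ_pow (by omega), mul_assoc, hd, hs, ← mul_assoc, ← mul_assoc,
    closedBraid_mul_comm (mul_mem (hle h1) (σ_mem_strands (by omega)))
      (hle (desc_pred_mem h)), ← mul_assoc,
    closedBraid_stabilize (mul_mem (desc_pred_mem h) h1),
    closedBraid_mul_comm (desc_pred_mem h) h1, mul_assoc, ← pow_succ]

/-- All strands but `k + 1` of the closure of `(σ_1 ⋯ σ_{k+n}) ^ (k + 1)` can be removed one by one,
where each of them leaves a factor `desc k (k - 1)`. The power with the exponent `j` collects the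
factors that appeared before. -/
theorem closedBraid_asc_pow (k n j : ℕ) :
    closedBraid (k + n + 1) (asc (k + n) ^ (k + 1) * desc k (k + n - 1) ^ j) =
      closedBraid (k + 1) (asc k ^ (k + 1) * desc k (k - 1) ^ (j + n)) := by
  induction n generalizing j with
  | zero => rfl
  | succ n ih =>
    have h := closedBraid_asc_succ (Nat.le_add_right k n) j
    rw [show k + (n + 1) - 1 = k + n by omega, ← add_assoc, h, ih, add_assoc, add_comm 1 n]

theorem BraidWord.closureDiagram_slices {n : ℕ} (β : BraidWord n) :
    β.closureDiagram.slices = closureSlices n (β.map fun g => ((g.1 : ℕ), g.2)) := by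
  have h : LinkTheory.crossings (β.map fun g => ((g.1 : ℕ), g.2)) = β.crossings := by
    simp [LinkTheory.crossings, BraidWord.crossings]
  rw [closureSlices, h]
  rfl

theorem BraidWord.some_closure {n : ℕ} (β : BraidWord n) :
    some β.closure = linkOf (closureSlices n (β.map fun g => ((g.1 : ℕ), g.2))) := by
  rw [BraidWord.closure, ← Diagram.linkOf_slices, BraidWord.closureDiagram_slices]

theorem letters_pow (w : FreeMonoid ℕ) (m : ℕ) :
    letters (w ^ m) = (List.replicate m (letters w)).flatten := by
  induction m with
  | zero => simp [letters]
  | succ m ih => rw [pow_succ', letters_mul, ih, List.replicate_succ, List.flatten_cons]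

theorem map_wordPow {n : ℕ} (β : BraidWord n) (w : FreeMonoid ℕ)
    (h : β.map (fun g => ((g.1 : ℕ), g.2)) = letters w) (m : ℕ) :
    (wordPow β m).map (fun g => ((g.1 : ℕ), g.2)) = letters (w ^ m) := by
  rw [letters_pow, wordPow, List.map_flatten, List.map_replicate, h]

theorem braidOf_pow (w : FreeMonoid ℕ) (m : ℕ) : braidOf (w ^ m) = braidOf w ^ m :=
  map_pow (PresentedMonoid.mk BraidRel) w m

theorem asc_eq_braidOf (m : ℕ) : asc m = braidOf (FreeMonoid.ofList (List.range m)) := by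
  induction m with
  | zero => rfl
  | succ m ih =>
    rw [asc, ih, List.range_succ]
    exact (braidOf_mul (FreeMonoid.ofList (List.range m)) (.of m)).symm

theorem some_torusLink (r s : ℕ) : some (torusLink r s) = closedBraid r (asc (r - 1) ^ s) := by
  rw [torusLink, BraidWord.some_closure, asc_eq_braidOf, ← braidOf_pow, closedBraid_braidOf,
    map_wordPow _ (FreeMonoid.ofList (List.range (r - 1)))]
  simp only [ascending, letters, List.map_map, FreeMonoid.toList_ofList]
  rw [← List.map_coe_finRange_eq_range, List.map_map]
  rfl

theorem map_twistedWord (x y z : ℕ) :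
    (wordPow (n := 3) [(0, true)] x ++ wordPow [(1, true)] y ++ wordPow (ascending 3) z).map
      (fun g : Fin (3 - 1) × Bool => ((g.1 : ℕ), g.2)) = letters (.of 0 ^ x * .of 1 ^ y * (.of 0 * .of 1) ^ z) := by
  rw [letters_mul, letters_mul, List.map_append, List.map_append, map_wordPow _ (.of 0),
    map_wordPow _ (.of 1), map_wordPow _ (.of 0 * .of 1)]
  · rfl
  · rfl
  · rfl

theorem some_twistedLink (x y z : ℕ) : some (twistedLink x y z) =
    closedBraid 3 (σ 0 ^ x * σ 1 ^ y * (σ 0 * σ 1) ^ z) := by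
  have h : σ 0 ^ x * σ 1 ^ y * (σ 0 * σ 1) ^ z =
      braidOf (.of 0 ^ x * .of 1 ^ y * (.of 0 * .of 1) ^ z) := by
    simp only [braidOf_mul, braidOf_pow]
    rfl
  rw [twistedLink, BraidWord.some_closure, h, closedBraid_braidOf, map_twistedWord]

theorem asc_two : asc 2 = σ 0 * σ 1 := by simp [asc]

theorem twistedLink_zero_zero (z : ℕ) : twistedLink 0 0 z = torusLink 3 z := by
  apply Option.some_injective
  rw [some_twistedLink, some_torusLink, asc_two]
  simp

/-! ### Normal forms of twisted three-braids -/

/-- The full twist of three strands, as a square of the half twist. -/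
theorem full_twist_eq : (σ 0 * σ 1) ^ 3 = (σ 0 * σ 1 * σ 0) * (σ 0 * σ 1 * σ 0) := by
  have h := σ_braid 0
  simp only [zero_add] at h
  calc (σ 0 * σ 1) ^ 3 = (σ 0 * σ 1 * σ 0) * (σ 1 * σ 0 * σ 1) := by
        simp only [pow_succ, pow_zero, one_mul, mul_assoc]
    _ = _ := by rw [← h]

theorem half_twist_mul_σ_zero : (σ 0 * σ 1 * σ 0) * σ 0 = σ 1 * (σ 0 * σ 1 * σ 0) := by
  have h := σ_braid 0
  simp only [zero_add] at h
  nth_rewrite 1 [h]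
  simp only [mul_assoc]

theorem half_twist_mul_σ_one : (σ 0 * σ 1 * σ 0) * σ 1 = σ 0 * (σ 0 * σ 1 * σ 0) := by
  have h := σ_braid 0
  simp only [zero_add] at h
  nth_rewrite 2 [h]
  simp only [mul_assoc]

theorem commute_full_twist_σ_zero : Commute ((σ 0 * σ 1) ^ 3) (σ 0) := by
  rw [full_twist_eq, Commute, SemiconjBy, mul_assoc, half_twist_mul_σ_zero, ← mul_assoc,
    half_twist_mul_σ_one, mul_assoc]

theorem commute_full_twist_σ_one : Commute ((σ 0 * σ 1) ^ 3) (σ 1) := by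
  rw [full_twist_eq, Commute, SemiconjBy, mul_assoc, half_twist_mul_σ_one, ← mul_assoc,
    half_twist_mul_σ_zero, mul_assoc]

theorem word_mem_strands (x y z : ℕ) : σ 0 ^ x * σ 1 ^ y * (σ 0 * σ 1) ^ z ∈ strands 3 :=
  have h0 : σ 0 ∈ strands 3 := σ_mem_strands (by omega)
  have h1 : σ 1 ∈ strands 3 := σ_mem_strands (by omega)
  mul_mem (mul_mem (pow_mem h0 _) (pow_mem h1 _)) (pow_mem (mul_mem h0 h1) _)

theorem semiconj_half_twist_σ_zero : SemiconjBy (σ 0 * σ 1 * σ 0) (σ 0) (σ 1) :=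
  half_twist_mul_σ_zero

theorem semiconj_half_twist_σ_one : SemiconjBy (σ 0 * σ 1 * σ 0) (σ 1) (σ 0) :=
  half_twist_mul_σ_one

/-- Two factors of a three-braid can be exchanged in front of a power of the full twist, if the full
twist commutes with the first one. -/
theorem closedBraid_rotate {x y : BraidMonoid} (hx : x ∈ strands 3) (hy : y ∈ strands 3) (k : ℕ)
    (h : Commute ((σ 0 * σ 1) ^ 3) x) :
    closedBraid 3 (x * y * (σ 0 * σ 1) ^ (3 * k)) =
      closedBraid 3 (y * x * (σ 0 * σ 1) ^ (3 * k)) := by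
  have h0 : σ 0 ∈ strands 3 := σ_mem_strands (by omega)
  have h1 : σ 1 ∈ strands 3 := σ_mem_strands (by omega)
  rw [mul_assoc, closedBraid_mul_comm hx (mul_mem hy (pow_mem (mul_mem h0 h1) _)), mul_assoc,
    pow_mul, (h.pow_left k).eq, mul_assoc]

/-- Conjugation by the half twist exchanges the two generators. -/
theorem twistedLink_swap (x y k : ℕ) : twistedLink x y (3 * k) = twistedLink y x (3 * k) := by
  have h0 : σ 0 ∈ strands 3 := σ_mem_strands (by omega)
  have h1 : σ 1 ∈ strands 3 := σ_mem_strands (by omega)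
  have hw : σ 1 ^ x * σ 0 ^ y * (σ 0 * σ 1) ^ (3 * k) ∈ strands 3 :=
    mul_mem (mul_mem (pow_mem h1 _) (pow_mem h0 _)) (pow_mem (mul_mem h0 h1) _)
  apply Option.some_injective
  rw [some_twistedLink, some_twistedLink]
  have hD : SemiconjBy (σ 0 * σ 1 * σ 0) ((σ 0 * σ 1) ^ (3 * k)) ((σ 0 * σ 1) ^ (3 * k)) := by
    rw [pow_mul]
    have h0 := commute_full_twist_σ_zero
    have h1 := commute_full_twist_σ_one
    exact ((h0.mul_right h1).mul_right h0).symm.pow_right k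
  rw [closedBraid_conj (y := σ 1 ^ x * σ 0 ^ y * (σ 0 * σ 1) ^ (3 * k))
      (mul_mem (mul_mem h0 h1) h0) (word_mem_strands _ _ _) hw
      (((semiconj_half_twist_σ_zero.pow_right x).mul_right
        (semiconj_half_twist_σ_one.pow_right y)).mul_right hD)]
  exact closedBraid_rotate (pow_mem h1 x) (pow_mem h0 y) k (commute_full_twist_σ_one.pow_right x)

theorem σ_pow_mul_asc_two (y : ℕ) : σ 1 ^ y * (σ 0 * σ 1) = σ 0 * σ 1 * σ 0 ^ y := by
  have h : SemiconjBy (σ 0 * σ 1) (σ 0) (σ 1) := by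
    have h := σ_braid 0
    simp only [zero_add, mul_assoc] at h
    simp only [SemiconjBy, mul_assoc, h]
  exact ((h.pow_right y).eq).symm

/-- Here `σ_2 ^ y [1,3] = [1,3] σ_1 ^ y`, and a conjugation brings `σ_1 ^ y` to the other powers of
`σ_1`. -/
theorem twistedLink_three_mul_add_one (x y k : ℕ) :
    twistedLink x y (3 * k + 1) = twistedLink (x + y + 1) 1 (3 * k) := by
  have h0 : σ 0 ∈ strands 3 := σ_mem_strands (by omega)
  have h1 : σ 1 ∈ strands 3 := σ_mem_strands (by omega)
  apply Option.some_injective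
  rw [some_twistedLink, some_twistedLink]
  have e : σ 0 ^ x * σ 1 ^ y * (σ 0 * σ 1) ^ (3 * k + 1) =
      σ 0 ^ (x + 1) * σ 1 * σ 0 ^ y * (σ 0 * σ 1) ^ (3 * k) := by
    rw [pow_succ', ← mul_assoc, mul_assoc (σ 0 ^ x), σ_pow_mul_asc_two, pow_succ]
    simp only [mul_assoc]
  rw [e, ← closedBraid_rotate (pow_mem h0 y) (mul_mem (pow_mem h0 _) h1) k
    (commute_full_twist_σ_zero.pow_right y), ← mul_assoc, ← pow_add, pow_one]
  congr 4
  omega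

/-- A conjugation completes `[1,3] ^ 2` to a full twist, since `σ_2 [1,3] ^ 2 σ_1 = [1,3] ^ 3`. -/
theorem twistedLink_succ_succ (x y k : ℕ) :
    twistedLink (x + 1) (y + 1) (3 * k + 2) = twistedLink x y (3 * (k + 1)) := by
  have h0 : σ 0 ∈ strands 3 := σ_mem_strands (by omega)
  have h1 : σ 1 ∈ strands 3 := σ_mem_strands (by omega)
  have hb := σ_braid 0
  simp only [zero_add] at hb
  apply Option.some_injective
  rw [some_twistedLink, some_twistedLink]
  have e : σ 0 ^ (x + 1) * σ 1 ^ (y + 1) * (σ 0 * σ 1) ^ (3 * k + 2) =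
      σ 0 * (σ 0 ^ x * σ 1 ^ y * (σ 1 * (σ 0 * σ 1) ^ 2)) * (σ 0 * σ 1) ^ (3 * k) := by
    rw [add_comm (3 * k), pow_add _ 2, pow_succ', pow_succ (σ 1)]
    simp only [mul_assoc]
  have e' : σ 1 * (σ 0 * σ 1) ^ 2 * σ 0 = (σ 0 * σ 1) ^ 3 := by
    rw [full_twist_eq]
    nth_rewrite 1 [hb]
    simp only [pow_two, mul_assoc]
  rw [e, closedBraid_rotate h0 (mul_mem (mul_mem (pow_mem h0 _) (pow_mem h1 _))
      (mul_mem h1 (pow_mem (mul_mem h0 h1) _))) k commute_full_twist_σ_zero,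
    mul_assoc (σ 0 ^ x * σ 1 ^ y), e', mul_assoc, ← pow_add]
  congr 3
  omega

/-- The powers of `σ_2` in `σ_2 ^ y [1,3] ^ 2 = σ_2 ^ (y + 1) σ_1 σ_2 ^ 2` are brought together. -/
theorem twistedLink_zero_left (y k : ℕ) :
    twistedLink 0 y (3 * k + 2) = twistedLink (y + 3) 1 (3 * k) := by
  have h0 : σ 0 ∈ strands 3 := σ_mem_strands (by omega)
  have h1 : σ 1 ∈ strands 3 := σ_mem_strands (by omega)
  have hb := σ_braid 0
  simp only [zero_add, mul_assoc] at hb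
  rw [twistedLink_swap]
  apply Option.some_injective
  rw [some_twistedLink, some_twistedLink]
  have e : σ 0 ^ 0 * σ 1 ^ y * (σ 0 * σ 1) ^ (3 * k + 2) =
      σ 1 ^ (y + 1) * (σ 0 * σ 1 ^ 2) * (σ 0 * σ 1) ^ (3 * k) := by
    have : (σ 0 * σ 1) ^ 2 = σ 1 * (σ 0 * σ 1 ^ 2) := by
      have := congrArg (· * σ 1) hb
      simpa only [pow_two, mul_assoc] using this
    rw [add_comm (3 * k), pow_add _ 2, this, pow_zero, one_mul, pow_succ (σ 1) y]
    simp only [mul_assoc]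
  rw [e, closedBraid_rotate (pow_mem h1 _) (mul_mem h0 (pow_mem h1 _)) k
    (commute_full_twist_σ_one.pow_right _), mul_assoc (σ 0), ← pow_add, pow_one,
    show 2 + (y + 1) = y + 3 by omega]

/-- The powers of `σ_1` in `σ_1 ^ x [1,3] ^ 2 = σ_1 ^ (x + 2) σ_2 σ_1` are brought together. -/
theorem twistedLink_zero_right (x k : ℕ) :
    twistedLink x 0 (3 * k + 2) = twistedLink (x + 3) 1 (3 * k) := by
  have h0 : σ 0 ∈ strands 3 := σ_mem_strands (by omega)
  have h1 : σ 1 ∈ strands 3 := σ_mem_strands (by omega)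
  have hb := σ_braid 0
  simp only [zero_add, mul_assoc] at hb
  apply Option.some_injective
  rw [some_twistedLink, some_twistedLink]
  have e : σ 0 ^ x * σ 1 ^ 0 * (σ 0 * σ 1) ^ (3 * k + 2) =
      σ 0 ^ (x + 2) * σ 1 * σ 0 * (σ 0 * σ 1) ^ (3 * k) := by
    have : (σ 0 * σ 1) ^ 2 = σ 0 ^ 2 * σ 1 * σ 0 := by
      simp only [pow_two, mul_assoc]
      rw [hb]
    rw [add_comm (3 * k), pow_add _ 2, this, pow_zero, mul_one, pow_add (σ 0) x]
    simp only [mul_assoc]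
  rw [e, ← closedBraid_rotate h0 (mul_mem (pow_mem h0 _) h1) k commute_full_twist_σ_zero,
    ← mul_assoc, ← pow_succ', pow_one]

/-- Every twisted link is the closure of some `σ_1 ^ x σ_2 ^ y` times a power of the full twist. -/
theorem exists_twistedLink_eq (x₁ y₁ z₁ : ℕ) :
    ∃ x y k, twistedLink x₁ y₁ z₁ = twistedLink x y (3 * k) := by
  obtain ⟨k, h | h | h⟩ : ∃ k, z₁ = 3 * k ∨ z₁ = 3 * k + 1 ∨ z₁ = 3 * k + 2 :=
    ⟨z₁ / 3, by omega⟩ <;> subst h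
  · exact ⟨_, _, _, rfl⟩
  · exact ⟨_, _, _, twistedLink_three_mul_add_one _ _ _⟩
  · rcases x₁ with _ | x
    · exact ⟨_, _, _, twistedLink_zero_left _ _⟩
    · rcases y₁ with _ | y
      · exact ⟨_, _, _, twistedLink_zero_right _ _⟩
      · exact ⟨_, _, _, twistedLink_succ_succ _ _ _⟩

/-! ### Symmetry of torus links -/

theorem exists_braidWord_closure {n : ℕ} {x : BraidMonoid} (hx : x ∈ strands n) :
    ∃ β : BraidWord n, some β.closure = closedBraid n x := by
  obtain ⟨w, hw, rfl⟩ := exists_word_of_mem_strands hx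
  refine ⟨(letters w).pmap (fun g hg => (⟨g.1, by omega⟩, g.2)) hw, ?_⟩
  rw [BraidWord.some_closure, closedBraid_braidOf, List.map_pmap]
  simp

/-- A torus link `T(n, s)` with `s ≤ n` is the closure of a braid on `s` strands. -/
theorem exists_closure_eq_torusLink {n s : ℕ} (hs : 0 < s) (h : s ≤ n) :
    ∃ β : BraidWord s, β.closure = torusLink n s := by
  obtain ⟨k, rfl⟩ : ∃ k, s = k + 1 := ⟨s - 1, by omega⟩
  obtain ⟨m, rfl⟩ := Nat.exists_eq_add_of_le h
  have e := closedBraid_asc_pow k m 0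
  rw [pow_zero, mul_one] at e
  obtain ⟨β, hβ⟩ := exists_braidWord_closure (mul_mem (pow_mem (asc_mem k) (k + 1))
    (pow_mem (desc_pred_mem le_rfl) (0 + m)))
  refine ⟨β, Option.some_injective _ ?_⟩
  rw [hβ, some_torusLink, ← e, show k + 1 + m - 1 = k + m by omega,
    show k + 1 + m = k + m + 1 by omega]

/-- The symmetry `T(n,3) = T(3,n)`. After the superfluous strands are removed, the two braids are
conjugate by `σ_1`. -/
theorem torusLink_three_right {n : ℕ} (h : 3 ≤ n) : torusLink n 3 = torusLink 3 n := by
  obtain ⟨m, rfl⟩ := Nat.exists_eq_add_of_le h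
  have h0 : σ 0 ∈ strands 3 := σ_mem_strands (by omega)
  have h1 : σ 1 ∈ strands 3 := σ_mem_strands (by omega)
  apply Option.some_injective
  have e := closedBraid_asc_pow 2 m 0
  have hd : desc 2 1 = σ 1 * σ 0 := by simp [desc]
  rw [pow_zero, mul_one, zero_add, asc_two, hd] at e
  rw [some_torusLink, some_torusLink, show 3 + m = 2 + m + 1 by omega]
  rw [Nat.add_sub_cancel, e]
  have hc : SemiconjBy (σ 0) (σ 1 * σ 0) (σ 0 * σ 1) := by
    simp only [SemiconjBy, mul_assoc]
  have hu : σ 0 * ((σ 0 * σ 1) ^ 3 * (σ 1 * σ 0) ^ m) = (σ 0 * σ 1) ^ (2 + m + 1) * σ 0 := by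
    rw [show 2 + m + 1 = 3 + m by omega, pow_add]
    exact (commute_full_twist_σ_zero.symm.semiconjBy.mul_right (hc.pow_right m)).eq
  exact closedBraid_conj h0 (mul_mem (pow_mem (mul_mem h0 h1) _) (pow_mem (mul_mem h1 h0) _))
    (pow_mem (mul_mem h0 h1) _) hu

/-! ### The Kauffman bracket as a linear functional -/

/-- The action of a slice on functionals of partial smoothed diagrams: the value of the new
functional at a state is obtained by putting the slice on top of the state. -/
noncomputable def act : Slice → (List ℕ → ℤ[T;T⁻¹]) → List ℕ → ℤ[T;T⁻¹]
  | ⟨i, .cup _⟩, F, s => F (addCup i s)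
  | ⟨i, .cap⟩, F, s => loopValue ^ (addCap i s).2 * F (addCap i s).1
  | ⟨i, .cross e⟩, F, s =>
      LaurentPolynomial.T (if e then -1 else 1) * F s +
        LaurentPolynomial.T (if e then 1 else -1) *
          (loopValue ^ (addCap i s).2 * F (addCup i (addCap i s).1))

/-- The action of a stack of slices on functionals. -/
noncomputable def actAll (w : List Slice) (F : List ℕ → ℤ[T;T⁻¹]) : List ℕ → ℤ[T;T⁻¹] :=
  w.foldr act F

theorem actAll_append (u v : List Slice) (F : List ℕ → ℤ[T;T⁻¹]) :
    actAll (u ++ v) F = actAll u (actAll v F) := List.foldr_append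

theorem actAll_cons (x : Slice) (w : List Slice) (F : List ℕ → ℤ[T;T⁻¹]) :
    actAll (x :: w) F = act x (actAll w F) := rfl

theorem actAll_nil (F : List ℕ → ℤ[T;T⁻¹]) : actAll [] F = F := rfl

theorem act_cross (i : ℕ) (e : Bool) (F : List ℕ → ℤ[T;T⁻¹]) (s : List ℕ) :
    act ⟨i, .cross e⟩ F s = LaurentPolynomial.T (if e then -1 else 1) * F s +
      LaurentPolynomial.T (if e then 1 else -1) * act ⟨i, .cap⟩ (act ⟨i, .cup true⟩ F) s := rfl

theorem act_cup_eq (i : ℕ) (up up' : Bool) : act ⟨i, .cup up⟩ = act ⟨i, .cup up'⟩ := rfl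

/-- A functional that depends only on which endpoints are joined, not on the labels. -/
def LabelInvariant (F : List ℕ → ℤ[T;T⁻¹]) : Prop :=
  ∀ (s : List ℕ) (f : ℕ → ℕ), Set.InjOn f {x | x ∈ s} → F (s.map f) = F s

theorem LabelInvariant.map_congr {F : List ℕ → ℤ[T;T⁻¹]} (hF : LabelInvariant F) (s : List ℕ)
    (f g : ℕ → ℕ) (h : ∀ x ∈ s, ∀ y ∈ s, f x = f y ↔ g x = g y) : F (s.map f) = F (s.map g) := by
  classical
  let k : ℕ → ℕ := fun z => if hz : ∃ x ∈ s, f x = z then g hz.choose else 0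
  have hk : ∀ x ∈ s, k (f x) = g x := fun x hx => by
    have hz : ∃ y ∈ s, f y = f x := ⟨x, hx, rfl⟩
    have : k (f x) = g hz.choose := dif_pos hz
    rw [this]
    exact (h _ hz.choose_spec.1 _ hx).1 hz.choose_spec.2
  have hmap : (s.map f).map k = s.map g := by
    rw [List.map_map]
    exact List.map_congr_left hk
  rw [← hmap]
  refine (hF (s.map f) k ?_).symm
  intro y hy z hz hyz
  simp only [List.mem_map, Set.mem_ofPred_eq] at hy hz
  obtain ⟨x, hx, rfl⟩ := hy
  obtain ⟨x', hx', rfl⟩ := hz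
  rw [hk x hx, hk x' hx'] at hyz
  exact (h x hx x' hx').2 hyz

theorem not_mem_of_foldr_max_lt {s : List ℕ} {m : ℕ} (h : s.foldr max 0 < m) : m ∉ s := by
  induction s with
  | nil => simp
  | cons a s ih =>
    simp only [List.foldr_cons, max_lt_iff] at h
    simp only [List.mem_cons, not_or]
    exact ⟨by omega, ih h.2⟩

/-- The label that a new arc receives does not matter, as long as it is new. -/
theorem act_cup_append {F : List ℕ → ℤ[T;T⁻¹]} (hF : LabelInvariant F) {p q : List ℕ} {i m : ℕ}
    (up : Bool) (hi : p.length = i) (hp : m ∉ p) (hq : m ∉ q) :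
    act ⟨i, .cup up⟩ F (p ++ q) = F (p ++ m :: m :: q) := by
  have hM : (p ++ q).foldr max 0 + 1 ∉ p ++ q := not_mem_of_foldr_max_lt (by omega)
  simp only [act, addCup, List.take_left' hi, List.drop_left' hi]
  generalize (p ++ q).foldr max 0 + 1 = M at hM
  simp only [List.mem_append, not_or] at hM
  have e : ∀ l : List ℕ, m ∉ l → M ∉ l → l.map (Equiv.swap M m) = l := fun l h1 h2 => by
    conv_rhs => rw [← List.map_id l]
    refine List.map_congr_left fun x hx => ?_
    exact Equiv.swap_apply_of_ne_of_ne (fun h => h2 (h ▸ hx)) (fun h => h1 (h ▸ hx))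
  rw [← hF _ (Equiv.swap M m) (Equiv.injective _).injOn]
  simp [e p hp hM.1, e q hq hM.2]

/-- The renaming that merges the label `a` into the label `b`. -/
def relabel (a b : ℕ) : ℕ → ℕ := fun c => if c = a then b else c

theorem act_cap_append (F : List ℕ → ℤ[T;T⁻¹]) {p q : List ℕ} {a b i : ℕ} (hi : p.length = i) :
    act ⟨i, .cap⟩ F (p ++ a :: b :: q) =
      (if a = b then loopValue else 1) * F ((p ++ q).map (relabel a b)) := by
  simp only [act, addCap, List.take_left' hi, List.drop_left' hi]
  by_cases h : a = b
  · subst h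
    have : relabel a a = id := by funext x; simp only [relabel, id]; split_ifs with h <;> simp [h]
    simp [this]
  · simp only [if_neg h, pow_zero]
    rfl

/-- The new functional is invariant because a cap merges labels, and a cup adds a new label; the
renaming `f` has to be extended to the new label. -/
theorem labelInvariant_act {F : List ℕ → ℤ[T;T⁻¹]} (hF : LabelInvariant F) (x : Slice) :
    LabelInvariant (act x F) := by
  have hcup : ∀ {F} (_ : LabelInvariant F) i, LabelInvariant (act ⟨i, .cup true⟩ F) := by
    intro F hF i s f hf
    have hM : s.foldr max 0 + 1 ∉ s := not_mem_of_foldr_max_lt (by omega)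
    have hM' : (s.map f).foldr max 0 + 1 ∉ s.map f := not_mem_of_foldr_max_lt (by omega)
    simp only [act, addCup]
    generalize s.foldr max 0 + 1 = M at hM
    generalize (s.map f).foldr max 0 + 1 = M' at hM'
    have e : ∀ x ∈ s, Function.update f M M' x = f x := fun x hx =>
      Function.update_of_ne (by rintro rfl; exact hM hx) _ _
    have h1 : (s.take i).map f = (s.take i).map (Function.update f M M') :=
      List.map_congr_left fun x hx => (e x (List.mem_of_mem_take hx)).symm
    have h2 : (s.drop i).map f = (s.drop i).map (Function.update f M M') :=
      List.map_congr_left fun x hx => (e x (List.mem_of_mem_drop hx)).symm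
    refine Eq.trans ?_ (hF (s.take i ++ M :: M :: s.drop i) (Function.update f M M') ?_)
    · rw [List.map_append, List.map_cons, List.map_cons, ← h1, ← h2, Function.update_self,
        List.map_take, List.map_drop]
    · have hmem : ∀ y, y ∈ s.take i ++ M :: M :: s.drop i → y = M ∨ y ∈ s := fun y hy => by
        simp only [List.mem_append, List.mem_cons] at hy
        rcases hy with hy | hy | hy | hy
        · exact .inr (List.mem_of_mem_take hy)
        · exact .inl hy
        · exact .inl hy
        · exact .inr (List.mem_of_mem_drop hy)
      intro y hy z hz hyz
      rcases hmem y hy with h | hy' <;> rcases hmem z hz with h' | hz'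
      · rw [h, h']
      · rw [h, Function.update_self, e z hz'] at hyz
        exact absurd (List.mem_map.2 ⟨z, hz', hyz.symm⟩) hM'
      · rw [h', Function.update_self, e y hy'] at hyz
        exact absurd (List.mem_map.2 ⟨y, hy', hyz⟩) hM'
      · rw [e y hy', e z hz'] at hyz
        exact hf hy' hz' hyz
  have hcap : ∀ {F} (_ : LabelInvariant F) i, LabelInvariant (act ⟨i, .cap⟩ F) := by
    intro F hF i s f hf
    rcases Nat.lt_or_ge s.length (i + 2) with h | h
    · have hd : ∀ t : List ℕ, t.length < i + 2 → addCap i t = (t, 0) := fun t ht => by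
        have : (t.drop i).length < 2 := by rw [List.length_drop]; omega
        unfold addCap
        generalize t.drop i = l at this
        rcases l with _ | ⟨a, _ | ⟨b, r⟩⟩
        · rfl
        · rfl
        · simp at this
      simp only [act]
      rw [hd _ h, hd _ (by simpa using h)]
      simp [hF s f hf]
    · obtain ⟨p, a, b, q, rfl, hi⟩ : ∃ p a b q, s = p ++ a :: b :: q ∧ p.length = i := by
        have : 2 ≤ (s.drop i).length := by rw [List.length_drop]; omega
        rcases hd : s.drop i with _ | ⟨a, _ | ⟨b, r⟩⟩
        · simp [hd] at this
        · simp [hd] at this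
        · exact ⟨s.take i, a, b, r, by rw [← hd, List.take_append_drop], by simp; omega⟩
      have hab : f a = f b ↔ a = b := hf.eq_iff (by simp) (by simp)
      rw [List.map_append, List.map_cons, List.map_cons, act_cap_append _ (by simpa using hi),
        act_cap_append _ hi, ← List.map_append, List.map_map]
      simp only [hab]
      congr 1
      have hmem : ∀ x ∈ (p ++ q).map (relabel a b), x ∈ p ++ a :: b :: q := by
        intro x hx
        simp only [List.mem_map, List.mem_append, relabel] at hx ⊢
        obtain ⟨y, hy, rfl⟩ := hx
        split_ifs
        · simp
        · rcases hy with hy | hy <;> simp [hy]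
      rw [← hF ((p ++ q).map (relabel a b)) f (hf.mono hmem), List.map_map]
      congr 1
      refine List.map_congr_left fun x hx => ?_
      have hx' : x ∈ p ++ a :: b :: q := by
        rcases List.mem_append.1 hx with h | h <;> simp [h]
      have hxa : f x = f a ↔ x = a := hf.eq_iff hx' (by simp)
      simp only [Function.comp, relabel, hxa]
      split_ifs <;> rfl
  rcases x with ⟨i, up | _ | e⟩
  · exact hcup hF i
  · exact hcap hF i
  · intro s f hf
    rw [act_cross, act_cross, hF s f hf, hcap (hcup hF i) i s f hf]

theorem labelInvariant_actAll {F : List ℕ → ℤ[T;T⁻¹]} (hF : LabelInvariant F) (w : List Slice) :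
    LabelInvariant (actAll w F) := by
  induction w with
  | nil => exact hF
  | cons x w ih => exact labelInvariant_act ih x

theorem exists_append_of_le_length {α : Type*} {s : List α} {i : ℕ} (h : i ≤ s.length) :
    ∃ p q, s = p ++ q ∧ p.length = i :=
  ⟨s.take i, s.drop i, (List.take_append_drop i s).symm, by simpa using h⟩

theorem exists_cons_cons_of_le_length {α : Type*} {s : List α} {i : ℕ} (h : i + 2 ≤ s.length) :
    ∃ p a b q, s = p ++ a :: b :: q ∧ p.length = i := by
  obtain ⟨p, q, rfl, hp⟩ := exists_append_of_le_length (show i ≤ s.length by omega)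
  rcases q with _ | ⟨a, _ | ⟨b, r⟩⟩
  · simp at h; omega
  · simp at h; omega
  · exact ⟨p, a, b, r, rfl, hp⟩

theorem exists_not_mem (s : List ℕ) : ∃ m, m ∉ s := ⟨_, not_mem_of_foldr_max_lt (Nat.lt_succ_self _)⟩

/-! ### Planar isotopy of smoothed diagrams -/

/-- A closed loop can be replaced by its value. -/
theorem act_cup_cap {F : List ℕ → ℤ[T;T⁻¹]} (hF : LabelInvariant F) {s : List ℕ} {i : ℕ}
    (up : Bool) (h : i ≤ s.length) :
    act ⟨i, .cup up⟩ (act ⟨i, .cap⟩ F) s = loopValue * F s := by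
  obtain ⟨p, q, rfl, hp⟩ := exists_append_of_le_length h
  obtain ⟨m, hm⟩ := exists_not_mem (p ++ q)
  simp only [List.mem_append, not_or] at hm
  rw [act_cup_append (labelInvariant_act hF _) up hp hm.1 hm.2, act_cap_append _ hp]
  have : relabel m m = id := by funext x; simp only [relabel, id]; split_ifs with h <;> simp [h]
  simp [this]

theorem act_zigzag {F : List ℕ → ℤ[T;T⁻¹]} (hF : LabelInvariant F) {s : List ℕ} {i : ℕ}
    (up : Bool) (h : i + 1 ≤ s.length) :
    act ⟨i, .cup up⟩ (act ⟨i + 1, .cap⟩ F) s = F s := by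
  obtain ⟨p, q, rfl, hp⟩ := exists_append_of_le_length (show i ≤ s.length by omega)
  rcases q with _ | ⟨c, q⟩
  · simp at h; omega
  obtain ⟨m, hm⟩ := exists_not_mem (p ++ c :: q)
  simp only [List.mem_append, List.mem_cons, not_or] at hm
  rw [act_cup_append (labelInvariant_act hF _) up hp hm.1 (by simp [hm.2]),
    List.append_cons, act_cap_append _ (by simp [hp]), if_neg (by tauto), one_mul]
  have e : ∀ l : List ℕ, m ∉ l → l.map (relabel m c) = l := fun l hl => by
    conv_rhs => rw [← List.map_id l]
    exact List.map_congr_left fun x hx => if_neg (by rintro rfl; exact hl hx)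
  simp [e p hm.1, e q hm.2.2, relabel]

theorem act_zigzag' {F : List ℕ → ℤ[T;T⁻¹]} (hF : LabelInvariant F) {s : List ℕ} {i : ℕ}
    (up : Bool) (h : i + 1 ≤ s.length) :
    act ⟨i + 1, .cup up⟩ (act ⟨i, .cap⟩ F) s = F s := by
  obtain ⟨p, q, rfl, hp⟩ := exists_append_of_le_length (show i ≤ s.length by omega)
  rcases q with _ | ⟨c, q⟩
  · simp at h; omega
  obtain ⟨m, hm⟩ := exists_not_mem (p ++ c :: q)
  simp only [List.mem_append, List.mem_cons, not_or] at hm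
  rw [List.append_cons, act_cup_append (labelInvariant_act hF _) up (by simp [hp])
    (by simp [hm]) hm.2.2, ← List.append_cons, act_cap_append _ hp, if_neg (Ne.symm hm.2.1), one_mul]
  -- The arc with the label `c` has been prolonged, and is called `m` now.
  rw [← hF (p ++ [c] ++ q) (relabel c m)]
  · have : relabel c m m = m := if_neg hm.2.1
    simp [relabel]
  · intro x hx y hy hxy
    have hx' : x ≠ m := by rintro rfl; simp_all
    have hy' : y ≠ m := by rintro rfl; simp_all
    simp only [relabel] at hxy
    split_ifs at hxy <;> simp_all

theorem act_cup_cup {F : List ℕ → ℤ[T;T⁻¹]} (hF : LabelInvariant F) {s : List ℕ} {i k : ℕ}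
    (up up' : Bool) (h : i + k ≤ s.length) :
    act ⟨i + k, .cup up⟩ (act ⟨i, .cup up'⟩ F) s =
      act ⟨i, .cup up'⟩ (act ⟨i + 2 + k, .cup up⟩ F) s := by
  obtain ⟨t, r, rfl, ht⟩ := exists_append_of_le_length h
  obtain ⟨p, q, rfl, hp⟩ := exists_append_of_le_length (show i ≤ t.length by omega)
  obtain ⟨m, hm⟩ := exists_not_mem (p ++ q ++ r)
  obtain ⟨n, hn⟩ := exists_not_mem (m :: (p ++ q ++ r))
  simp only [List.mem_append, List.mem_cons, not_or] at hm hn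
  rw [act_cup_append (labelInvariant_act hF _) up ht (m := m) (by simp [hm]) (by simp [hm]),
    List.append_assoc, act_cup_append hF up' hp (m := n) (by simp [hn]) (by simp [hn]),
    List.append_assoc,
    act_cup_append (labelInvariant_act hF _) up' hp (m := n) (by simp [hn]) (by simp [hn]),
    show p ++ n :: n :: (q ++ r) = (p ++ n :: n :: q) ++ r by simp,
    act_cup_append hF up (m := m) (by simp at ht ⊢; omega) (by simp [hm, Ne.symm hn.1])
      (by simp [hm])]
  simp

theorem not_mem_map_relabel {m a b : ℕ} {l : List ℕ} (hm : m ∉ l) (hb : m ≠ b) :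
    m ∉ l.map (relabel a b) := by
  simp only [List.mem_map, relabel, not_exists, not_and]
  intro x hx
  split_ifs
  · exact Ne.symm hb
  · rintro rfl; exact hm hx

theorem act_cap_cup {F : List ℕ → ℤ[T;T⁻¹]} (hF : LabelInvariant F) {s : List ℕ} {i k : ℕ}
    (up : Bool) (h : i + k + 2 ≤ s.length) :
    act ⟨i + k, .cap⟩ (act ⟨i, .cup up⟩ F) s = act ⟨i, .cup up⟩ (act ⟨i + 2 + k, .cap⟩ F) s := by
  obtain ⟨t, a, b, r, rfl, ht⟩ := exists_cons_cons_of_le_length h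
  obtain ⟨p, q, rfl, hp⟩ := exists_append_of_le_length (show i ≤ t.length by omega)
  obtain ⟨m, hm⟩ := exists_not_mem (p ++ q ++ a :: b :: r)
  simp only [List.mem_append, List.mem_cons, not_or] at hm
  rw [act_cap_append _ ht, List.append_assoc, List.map_append, act_cup_append hF up (by simpa) (m := m)
      (not_mem_map_relabel (by simp [hm]) (by simp [hm]))
      (not_mem_map_relabel (by simp [hm]) (by simp [hm])),
    List.append_assoc, act_cup_append (labelInvariant_act hF _) up hp (m := m) (by simp [hm]) (by simp [hm]),
    show p ++ m :: m :: (q ++ a :: b :: r) = (p ++ m :: m :: q) ++ a :: b :: r by simp,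
    act_cap_append _ (by simp at ht ⊢; omega)]
  have : relabel a b m = m := if_neg (by tauto)
  simp [this]

theorem act_cup_cap_far {F : List ℕ → ℤ[T;T⁻¹]} (hF : LabelInvariant F) {s : List ℕ} {i k : ℕ}
    (up : Bool) (h : i + 2 + k ≤ s.length) :
    act ⟨i + 2 + k, .cup up⟩ (act ⟨i, .cap⟩ F) s = act ⟨i, .cap⟩ (act ⟨i + k, .cup up⟩ F) s := by
  obtain ⟨t, r, rfl, ht⟩ := exists_append_of_le_length h
  obtain ⟨p, a, b, q, rfl, hp⟩ := exists_cons_cons_of_le_length (show i + 2 ≤ t.length by omega)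
  obtain ⟨m, hm⟩ := exists_not_mem (p ++ a :: b :: q ++ r)
  simp only [List.mem_append, List.mem_cons, not_or] at hm
  rw [act_cup_append (labelInvariant_act hF _) up ht (m := m) (by simp [hm]) (by simp [hm]),
    List.append_assoc, List.cons_append, List.cons_append, act_cap_append _ hp, List.append_assoc,
    List.cons_append, List.cons_append, act_cap_append _ hp, ← List.append_assoc p q r,
    List.map_append (l₁ := p ++ q), act_cup_append hF up (m := m) (by simp at ht ⊢; omega)
      (not_mem_map_relabel (by simp [hm]) (by simp [hm]))
      (not_mem_map_relabel (by simp [hm]) (by simp [hm]))]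
  have : relabel a b m = m := if_neg (by tauto)
  simp [this]

theorem act_cap_cap {F : List ℕ → ℤ[T;T⁻¹]} (hF : LabelInvariant F) {s : List ℕ} {i k : ℕ}
    (h : i + 2 + k + 2 ≤ s.length) :
    act ⟨i + 2 + k, .cap⟩ (act ⟨i, .cap⟩ F) s = act ⟨i, .cap⟩ (act ⟨i + k, .cap⟩ F) s := by
  obtain ⟨t, c, d, r, rfl, ht⟩ := exists_cons_cons_of_le_length h
  obtain ⟨p, a, b, q, rfl, hp⟩ := exists_cons_cons_of_le_length (show i + 2 ≤ t.length by omega)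
  rw [act_cap_append _ ht, List.append_assoc, List.map_append, List.cons_append, List.cons_append,
    List.map_cons, List.map_cons, act_cap_append _ (by simpa), List.append_assoc,
    List.cons_append, List.cons_append, act_cap_append _ hp, ← List.append_assoc p q,
    List.map_append (l₁ := p ++ q), List.map_cons, List.map_cons,
    act_cap_append _ (by simp at ht ⊢; omega), ← List.map_append, ← List.map_append, List.map_map,
    List.map_map, ← mul_assoc, ← mul_assoc, List.append_assoc]
  congr 1
  · simp only [relabel]
    grind
  · refine hF.map_congr _ _ _ fun x _ y _ => ?_
    simp only [relabel, Function.comp]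
    grind
/-! ### Invariance of the Kauffman bracket -/

theorem act_add_mul (x : Slice) (a b : ℤ[T;T⁻¹]) (F G : List ℕ → ℤ[T;T⁻¹]) (s : List ℕ) :
    act x (fun s => a * F s + b * G s) s = a * act x F s + b * act x G s := by
  rcases x with ⟨i, up | _ | e⟩ <;> simp only [act] <;> ring

theorem act_cross_eq (i : ℕ) (e : Bool) (F : List ℕ → ℤ[T;T⁻¹]) :
    act ⟨i, .cross e⟩ F = fun s => LaurentPolynomial.T (if e then -1 else 1) * F s +
      LaurentPolynomial.T (if e then 1 else -1) * act ⟨i, .cap⟩ (act ⟨i, .cup true⟩ F) s := rfl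

theorem addCap_append {p q : List ℕ} {a b i : ℕ} (hi : p.length = i) :
    addCap i (p ++ a :: b :: q) =
      if a = b then (p ++ q, 1) else ((p ++ q).map (relabel a b), 0) := by
  simp only [addCap, List.take_left' hi, List.drop_left' hi]
  rfl

theorem length_addCup {s : List ℕ} {i : ℕ} : (addCup i s).length = s.length + 2 := by
  simp only [addCup, List.length_append, List.length_cons, List.length_take, List.length_drop]
  omega

theorem length_addCap {s : List ℕ} {i : ℕ} (h : i + 2 ≤ s.length) :
    (addCap i s).1.length + 2 = s.length := by
  obtain ⟨p, a, b, q, rfl, hi⟩ := exists_cons_cons_of_le_length h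
  rw [addCap_append hi]
  split_ifs <;> simp <;> omega

theorem act_congr {x : Slice} {F G : List ℕ → ℤ[T;T⁻¹]} {s : List ℕ}
    (hx : x.pos + x.piece.dom ≤ s.length)
    (h : ∀ t : List ℕ, t.length + x.piece.dom = s.length + x.piece.cod → F t = G t) :
    act x F s = act x G s := by
  rcases x with ⟨i, up | _ | e⟩ <;> simp only [Piece.dom, Piece.cod] at hx h <;> simp only [act]
  · exact h _ length_addCup
  · rw [h _ (length_addCap hx)]
  · rw [h s rfl, h _ (by rw [length_addCup, length_addCap hx])]

/-- Distant extrema can exchange their heights. -/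
theorem act_far_flat {F : List ℕ → ℤ[T;T⁻¹]} (hF : LabelInvariant F) {s : List ℕ} {i k : ℕ}
    {p q : Piece} (hp : ∀ e, p ≠ .cross e) (hq : ∀ e, q ≠ .cross e)
    (h : i + p.dom + k + q.dom ≤ s.length) :
    act ⟨i + p.dom + k, q⟩ (act ⟨i, p⟩ F) s = act ⟨i, p⟩ (act ⟨i + p.cod + k, q⟩ F) s := by
  rcases p with up | _ | e
  · rcases q with up' | _ | e'
    · exact act_cup_cup hF up' up h
    · exact act_cap_cup hF up h
    · exact absurd rfl (hq e')
  · rcases q with up' | _ | e'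
    · exact act_cup_cap_far hF up' h
    · exact act_cap_cap hF h
    · exact absurd rfl (hq e')
  · exact absurd rfl (hp e)

theorem act_far_of_ne_cross {F : List ℕ → ℤ[T;T⁻¹]} (hF : LabelInvariant F) {s : List ℕ} {i k : ℕ}
    {p : Piece} (q : Piece) (hp : ∀ e, p ≠ .cross e) (h : i + p.dom + k + q.dom ≤ s.length) :
    act ⟨i + p.dom + k, q⟩ (act ⟨i, p⟩ F) s = act ⟨i, p⟩ (act ⟨i + p.cod + k, q⟩ F) s := by
  rcases q with up | _ | e
  · exact act_far_flat hF hp (by simp) h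
  · exact act_far_flat hF hp (by simp) h
  · have h' : i + p.dom + k + 2 ≤ s.length := h
    have h1 : act ⟨i + p.dom + k, .cap⟩ (act ⟨i + p.dom + k, .cup true⟩ (act ⟨i, p⟩ F)) s =
        act ⟨i + p.dom + k, .cap⟩ (act ⟨i, p⟩ (act ⟨i + p.cod + k, .cup true⟩ F)) s :=
      act_congr h' fun t ht => act_far_flat hF hp (by simp)
        (by have : t.length + 2 = s.length + 0 := ht
            exact (show i + p.dom + k + 0 ≤ t.length by omega))
    have h2 := act_far_flat (labelInvariant_act hF ⟨i + p.cod + k, .cup true⟩) (q := .cap) hp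
      (by simp) h
    simp only [act_cross_eq, act_add_mul]
    rw [h1, h2]

theorem act_far {F : List ℕ → ℤ[T;T⁻¹]} (hF : LabelInvariant F) {s : List ℕ} {i k : ℕ}
    (p q : Piece) (h : i + p.dom + k + q.dom ≤ s.length) :
    act ⟨i + p.dom + k, q⟩ (act ⟨i, p⟩ F) s = act ⟨i, p⟩ (act ⟨i + p.cod + k, q⟩ F) s := by
  rcases p with up | _ | e
  · exact act_far_of_ne_cross hF q (by simp) h
  · exact act_far_of_ne_cross hF q (by simp) h
  · have h' : i + 2 + k + q.dom ≤ s.length := h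
    have h1 := act_far_of_ne_cross (labelInvariant_act hF ⟨i, .cup true⟩) q (p := .cap) (by simp) h
    have h2 : act ⟨i, .cap⟩ (act ⟨i + 0 + k, q⟩ (act ⟨i, .cup true⟩ F)) s =
        act ⟨i, .cap⟩ (act ⟨i, .cup true⟩ (act ⟨i + 2 + k, q⟩ F)) s :=
      act_congr (show i + 2 ≤ s.length by omega) fun t ht =>
        act_far_of_ne_cross hF q (p := .cup true) (by simp)
          (by have : t.length + 2 = s.length + 0 := ht
              exact (show i + 0 + k + q.dom ≤ t.length by omega))
    simp only [Piece.dom, Piece.cod] at h1 ⊢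
    simp only [act_cross_eq, act_add_mul]
    rw [h1, h2]

theorem T_one_mul_T_neg_one :
    (LaurentPolynomial.T 1 * LaurentPolynomial.T (-1) : ℤ[T;T⁻¹]) = 1 := by
  rw [← LaurentPolynomial.T_add]; simp

theorem loopValue_eq : loopValue = -(LaurentPolynomial.T (-1) * LaurentPolynomial.T (-1)) -
    LaurentPolynomial.T 1 * LaurentPolynomial.T 1 := by
  simp only [loopValue, ← LaurentPolynomial.T_add]; norm_num

/-- Both smoothings of the crossing agree after a strand is straightened. -/
theorem act_slideCup {F : List ℕ → ℤ[T;T⁻¹]} (hF : LabelInvariant F) {s : List ℕ} {i : ℕ}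
    (up e : Bool) (h : i + 1 ≤ s.length) :
    act ⟨i, .cup up⟩ (act ⟨i + 1, .cross e⟩ F) s =
      act ⟨i + 1, .cup up⟩ (act ⟨i, .cross (!e)⟩ F) s := by
  simp only [act_cross_eq, act_add_mul]
  rw [act_zigzag (labelInvariant_act hF _) up h, act_zigzag' (labelInvariant_act hF _) up h,
    act_cup_eq i up true, act_cup_eq (i + 1) up true]
  cases e <;> simp <;> ring

theorem act_slideCap {F : List ℕ → ℤ[T;T⁻¹]} (hF : LabelInvariant F) {s : List ℕ} {i : ℕ}
    (e : Bool) (h : i + 3 ≤ s.length) :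
    act ⟨i + 1, .cross e⟩ (act ⟨i, .cap⟩ F) s = act ⟨i, .cross (!e)⟩ (act ⟨i + 1, .cap⟩ F) s := by
  have h1 : act ⟨i + 1, .cap⟩ (act ⟨i + 1, .cup true⟩ (act ⟨i, .cap⟩ F)) s =
      act ⟨i + 1, .cap⟩ F s := act_congr h fun t ht =>
    act_zigzag' hF true (by have : t.length + 2 = s.length + 0 := ht; omega)
  have h2 : act ⟨i, .cap⟩ (act ⟨i, .cup true⟩ (act ⟨i + 1, .cap⟩ F)) s = act ⟨i, .cap⟩ F s :=
    act_congr (show i + 2 ≤ s.length by omega) fun t ht =>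
    act_zigzag hF true (by have : t.length + 2 = s.length + 0 := ht; omega)
  simp only [act_cross_eq, h1, h2]
  cases e <;> simp <;> ring

/-- A kink changes the Kauffman bracket by the factor `(-A ^ 3) ^ (± 1)`. -/
theorem act_kinkCup {F : List ℕ → ℤ[T;T⁻¹]} (hF : LabelInvariant F) {s : List ℕ} {i : ℕ}
    (up up' e : Bool) (h : i ≤ s.length) :
    act ⟨i, .cup up⟩ (act ⟨i, .cross e⟩ F) s =
      -LaurentPolynomial.T (if e then 3 else -3) * act ⟨i, .cup up'⟩ F s := by
  have h1 := T_one_mul_T_neg_one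
  have h3 : (LaurentPolynomial.T 3 : ℤ[T;T⁻¹]) =
    LaurentPolynomial.T 1 * LaurentPolynomial.T 1 * LaurentPolynomial.T 1 := by
    simp only [← LaurentPolynomial.T_add]; norm_num
  have h3' : (LaurentPolynomial.T (-3) : ℤ[T;T⁻¹]) =
    LaurentPolynomial.T (-1) * LaurentPolynomial.T (-1) * LaurentPolynomial.T (-1) := by
    simp only [← LaurentPolynomial.T_add]; norm_num
  simp only [act_cross_eq, act_add_mul]
  rw [act_cup_cap (labelInvariant_act hF _) up h, act_cup_eq i up true, act_cup_eq i up' true,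
    loopValue_eq]
  cases e <;> simp only [Bool.false_eq_true, if_true, if_false, h3, h3'] <;> grind

theorem act_kinkCap {F : List ℕ → ℤ[T;T⁻¹]} (hF : LabelInvariant F) {s : List ℕ} {i : ℕ}
    (e : Bool) (h : i + 2 ≤ s.length) :
    act ⟨i, .cross e⟩ (act ⟨i, .cap⟩ F) s =
      -LaurentPolynomial.T (if e then 3 else -3) * act ⟨i, .cap⟩ F s := by
  have h1 := T_one_mul_T_neg_one
  have h3 : (LaurentPolynomial.T 3 : ℤ[T;T⁻¹]) =
    LaurentPolynomial.T 1 * LaurentPolynomial.T 1 * LaurentPolynomial.T 1 := by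
    simp only [← LaurentPolynomial.T_add]; norm_num
  have h3' : (LaurentPolynomial.T (-3) : ℤ[T;T⁻¹]) =
    LaurentPolynomial.T (-1) * LaurentPolynomial.T (-1) * LaurentPolynomial.T (-1) := by
    simp only [← LaurentPolynomial.T_add]; norm_num
  have h2 : act ⟨i, .cap⟩ (act ⟨i, .cup true⟩ (act ⟨i, .cap⟩ F)) s =
      loopValue * act ⟨i, .cap⟩ F s := by
    have e1 := act_congr (x := ⟨i, .cap⟩) (F := act ⟨i, .cup true⟩ (act ⟨i, .cap⟩ F))
      (G := fun t => loopValue * F t + 0 * F t) h fun t ht => by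
        rw [act_cup_cap hF true (by have : t.length + 2 = s.length + 0 := ht; omega)]; ring
    rw [e1, act_add_mul]; ring
  simp only [act_cross_eq, h2]
  rw [loopValue_eq]
  cases e <;> simp only [Bool.false_eq_true, if_true, if_false, h3, h3'] <;> grind

/-- The Temperley-Lieb generator, as an operator on functionals. -/
noncomputable def turn (i : ℕ) (F : List ℕ → ℤ[T;T⁻¹]) : List ℕ → ℤ[T;T⁻¹] :=
  act ⟨i, .cap⟩ (act ⟨i, .cup true⟩ F)

theorem labelInvariant_turn {F : List ℕ → ℤ[T;T⁻¹]} (hF : LabelInvariant F) (i : ℕ) :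
    LabelInvariant (turn i F) := labelInvariant_act (labelInvariant_act hF _) _

theorem turn_add_mul (i : ℕ) (a b : ℤ[T;T⁻¹]) (F G : List ℕ → ℤ[T;T⁻¹]) (s : List ℕ) :
    turn i (fun s => a * F s + b * G s) s = a * turn i F s + b * turn i G s := by
  simp only [turn, act]; ring

theorem turn_turn {F : List ℕ → ℤ[T;T⁻¹]} (hF : LabelInvariant F) {s : List ℕ} {i : ℕ}
    (h : i + 2 ≤ s.length) : turn i (turn i F) s = loopValue * turn i F s := by
  have e1 := act_congr (x := ⟨i, .cap⟩)
    (F := act ⟨i, .cup true⟩ (act ⟨i, .cap⟩ (act ⟨i, .cup true⟩ F)))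
    (G := fun t => loopValue * act ⟨i, .cup true⟩ F t + 0 * F t) h fun t ht => by
      rw [act_cup_cap (labelInvariant_act hF _) true
        (by have : t.length + 2 = s.length + 0 := ht; omega)]; ring
  simp only [turn]
  rw [e1, act_add_mul]; ring

theorem turn_turn_succ_turn {F : List ℕ → ℤ[T;T⁻¹]} (hF : LabelInvariant F) {s : List ℕ} {i : ℕ}
    (h : i + 3 ≤ s.length) : turn i (turn (i + 1) (turn i F)) s = turn i F s := by
  refine act_congr (show i + 2 ≤ s.length by omega) fun t ht => ?_
  have ht' : t.length + 2 = s.length + 0 := ht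
  exact (act_zigzag (labelInvariant_act (labelInvariant_turn hF i) _) true (by omega)).trans
    (act_zigzag' (labelInvariant_act hF _) true (by omega))

theorem turn_succ_turn_turn_succ {F : List ℕ → ℤ[T;T⁻¹]} (hF : LabelInvariant F) {s : List ℕ}
    {i : ℕ} (h : i + 3 ≤ s.length) :
    turn (i + 1) (turn i (turn (i + 1) F)) s = turn (i + 1) F s := by
  refine act_congr (show i + 1 + 2 ≤ s.length by omega) fun t ht => ?_
  have ht' : t.length + 2 = s.length + 0 := ht
  exact (act_zigzag' (labelInvariant_act (labelInvariant_turn hF (i + 1)) _) true (by omega)).trans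
    (act_zigzag (labelInvariant_act hF _) true (by omega))

theorem act_cross_eq_turn (i : ℕ) (e : Bool) (F : List ℕ → ℤ[T;T⁻¹]) :
    act ⟨i, .cross e⟩ F = fun s => LaurentPolynomial.T (if e then -1 else 1) * F s +
      LaurentPolynomial.T (if e then 1 else -1) * turn i F s := rfl

theorem act_reidemeister2 {F : List ℕ → ℤ[T;T⁻¹]} (hF : LabelInvariant F) {s : List ℕ} {i : ℕ}
    (e : Bool) (h : i + 2 ≤ s.length) :
    act ⟨i, .cross e⟩ (act ⟨i, .cross (!e)⟩ F) s = F s := by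
  have h1 := T_one_mul_T_neg_one
  simp only [act_cross_eq_turn, turn_add_mul]
  rw [turn_turn hF h, loopValue_eq]
  cases e <;> simp <;> grind

/-- Invariance under the third move follows from the relations of the Temperley-Lieb algebra. -/
theorem act_reidemeister3 {F : List ℕ → ℤ[T;T⁻¹]} (hF : LabelInvariant F) {s : List ℕ} {i : ℕ}
    (a b c : Bool) (habc : a = b ∨ b = c) (h : i + 3 ≤ s.length) :
    act ⟨i, .cross a⟩ (act ⟨i + 1, .cross b⟩ (act ⟨i, .cross c⟩ F)) s =
      act ⟨i + 1, .cross c⟩ (act ⟨i, .cross b⟩ (act ⟨i + 1, .cross a⟩ F)) s := by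
  have h1 := T_one_mul_T_neg_one
  simp only [act_cross_eq_turn, turn_add_mul]
  rw [turn_turn hF (show i + 2 ≤ s.length by omega),
    turn_turn hF (show i + 1 + 2 ≤ s.length by omega), turn_turn_succ_turn hF h,
    turn_succ_turn_turn_succ hF h, loopValue_eq]
  generalize F s = X0, turn i F s = X1, turn (i + 1) F s = X2, turn i (turn (i + 1) F) s = X3,
    turn (i + 1) (turn i F) s = X4
  cases a <;> cases b <;> cases c <;>
    simp only [Bool.false_eq_true, Bool.true_eq_false, or_self, if_true, if_false] at habc ⊢ <;>
    grind

/-! ### Invariance of the Jones polynomial -/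

theorem Slice.sign_succ (i : ℕ) (p : Piece) (a : Bool) (o : List Bool) :
    Slice.sign ⟨i + 1, p⟩ (a :: o) = Slice.sign ⟨i, p⟩ o := by
  cases p <;> simp [Slice.sign]

theorem writhe_shift {w : List Slice} {a : Bool} {o o' : List Bool} (h : run w o = some o') :
    writhe (w.map Slice.shift) (a :: o) = writhe w o := by
  induction w generalizing o with
  | nil => rfl
  | cons x w ih =>
    simp only [run] at h
    obtain ⟨o1, h1, h2⟩ := Option.bind_eq_some_iff.1 h
    simp only [List.map_cons, writhe, Slice.shift, Slice.step_succ, Slice.sign_succ, h1,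
      Option.map_some, Option.getD_some, ih h2]

theorem writhe_append {u v : List Slice} {o o' : List Bool} (h : run u o = some o') :
    writhe (u ++ v) o = writhe u o + writhe v o' := by
  induction u generalizing o with
  | nil => cases h; simp [writhe]
  | cons x u ih =>
    simp only [run] at h
    obtain ⟨o1, h1, h2⟩ := Option.bind_eq_some_iff.1 h
    simp only [List.cons_append, writhe, h1, Option.getD_some, ih h2, add_assoc]

/-- The writhes of two stacks of slices at the position `i` have to be compared only at the left
end. -/
theorem writhe_congr_of_shift {l r : ℕ → List Slice}
    (hl : ∀ i, l (i + 1) = (l i).map Slice.shift) (hr : ∀ i, r (i + 1) = (r i).map Slice.shift)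
    (hl0 : ∀ i, l i ≠ []) (n : ℤ)
    (h0 : ∀ o o', run (l 0) o = some o' → run (r 0) o = some o' →
      writhe (l 0) o = writhe (r 0) o + n)
    (i : ℕ) (o o' : List Bool) (h : run (l i) o = some o') (h' : run (r i) o = some o') :
    writhe (l i) o = writhe (r i) o + n := by
  induction i generalizing o o' with
  | zero => exact h0 o o' h h'
  | succ i ih =>
    rw [hl] at h ⊢
    rw [hr] at h' ⊢
    cases o with
    | nil => rw [run_shift_nil (hl0 i)] at h; cases h
    | cons a o =>
      rw [run_shift] at h h'
      obtain ⟨o1, h1, rfl⟩ := Option.map_eq_some_iff.1 h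
      obtain ⟨o2, h2, h3⟩ := Option.map_eq_some_iff.1 h'
      obtain rfl : o2 = o1 := by simpa using h3
      rw [writhe_shift h1, writhe_shift h2, ih _ _ h1 h2]

theorem writhe_far (i k : ℕ) (p q : Piece) {o o' : List Bool}
    (h : run [⟨i + p.dom + k, q⟩, ⟨i, p⟩] o = some o') :
    writhe [⟨i + p.dom + k, q⟩, ⟨i, p⟩] o = writhe [⟨i, p⟩, ⟨i + p.cod + k, q⟩] o := by
  refine (writhe_congr_of_shift (l := fun i => [⟨i + p.dom + k, q⟩, ⟨i, p⟩])
    (r := fun i => [⟨i, p⟩, ⟨i + p.cod + k, q⟩]) (fun i => ?_) (fun i => ?_) (by simp) 0 ?_ i o o' h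
    (by rw [← run_far]; exact h)).trans (add_zero _)
  · simp [Slice.shift]; omega
  · simp [Slice.shift]; omega
  intro o o' h h'
  simp only [Nat.zero_add, run] at h h'
  obtain ⟨o1, h1, h2⟩ := Option.bind_eq_some_iff.1 h
  obtain ⟨o2, h3, h4⟩ := Option.bind_eq_some_iff.1 h'
  simp only [Nat.zero_add, writhe, h1, h3, Option.getD_some, add_zero]
  cases p with
  | cup up =>
    rw [Slice.step_cup_zero, Option.some_inj] at h3
    subst h3
    simp only [Piece.dom, Piece.cod, Nat.zero_add]
    rw [show 2 + k = k + 1 + 1 by omega, Slice.sign_succ, Slice.sign_succ]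
    simp [Slice.sign]
  | cap =>
    rcases o with _ | ⟨a, _ | ⟨b, o⟩⟩
    · simp [Slice.step] at h3
    · simp [Slice.step] at h3
    · rw [Slice.step_cap_zero] at h3
      simp only [Piece.dom, Piece.cod, Nat.zero_add]
      split_ifs at h3
      obtain rfl := Option.some_inj.1 h3
      rw [show 2 + k = k + 1 + 1 by omega, Slice.sign_succ, Slice.sign_succ]
      simp [Slice.sign]
  | cross e =>
    rcases o with _ | ⟨a, _ | ⟨b, o⟩⟩
    · simp [Slice.step] at h3
    · simp [Slice.step] at h3
    · rw [Slice.step_cross_zero, Option.some_inj] at h3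
      simp only [Piece.dom, Piece.cod] at h1 ⊢
      subst h3
      rw [show 2 + k = k + 1 + 1 by omega, Slice.step_succ, Slice.step_succ, Option.map_map,
        Option.map_eq_some_iff] at h1
      obtain ⟨o1, -, rfl⟩ := h1
      rw [show 2 + k = k + 1 + 1 by omega, Slice.sign_succ, Slice.sign_succ, Slice.sign_succ,
        Slice.sign_succ]
      simp [Slice.sign, add_comm]

/-- The factor that turns the Kauffman bracket of a diagram of the given writhe into an
invariant. -/
noncomputable def framing (n : ℤ) : ℤ[T;T⁻¹] :=
  LaurentPolynomial.C (n.negOnePow : ℤ) * LaurentPolynomial.T (3 * n)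

theorem framing_add (m n : ℤ) : framing (m + n) = framing m * framing n := by
  simp only [framing, Int.negOnePow_add, mul_add, LaurentPolynomial.T_add, Units.val_mul, map_mul]
  ring

theorem framing_one : framing 1 = -LaurentPolynomial.T 3 := by simp [framing]

theorem framing_neg_one : framing (-1) = -LaurentPolynomial.T (-3) := by simp [framing]

theorem framing_kink (e : Bool) :
    framing (if e then -1 else 1) * -LaurentPolynomial.T (if e then 3 else -3) = 1 := by
  cases e
  · simp only [Bool.false_eq_true, if_false, framing_one, neg_mul_neg, ← LaurentPolynomial.T_add]
    simp
  · simp only [if_true, framing_neg_one, neg_mul_neg, ← LaurentPolynomial.T_add]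
    simp

theorem le_length_of_step {x : Slice} {o o' : List Bool} (h : x.step o = some o') :
    x.pos + x.piece.dom ≤ o.length ∧ o'.length + x.piece.dom = o.length + x.piece.cod := by
  have hd : ∀ {i : ℕ} {a b : Bool} {r}, o.drop i = a :: b :: r → i + 2 + r.length = o.length := by
    intro i a b r h
    have := congrArg List.length h
    simp only [List.length_drop, List.length_cons] at this
    omega
  rcases x with ⟨i, up | _ | e⟩ <;> simp only [Slice.step, Piece.dom, Piece.cod] at h ⊢
  · split_ifs at h with hi
    obtain rfl := Option.some_inj.1 h
    simp only [List.length_append, List.length_cons, List.length_take, List.length_drop]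
    omega
  · split at h
    · rename_i a b r heq
      split_ifs at h
      obtain rfl := Option.some_inj.1 h
      have := hd heq
      simp only [List.length_append, List.length_take]
      omega
    · cases h
  · split at h
    · rename_i a b r heq
      obtain rfl := Option.some_inj.1 h
      have := hd heq
      simp only [List.length_append, List.length_cons, List.length_take]
      omega
    · cases h

/-- Each local move preserves the Kauffman bracket, corrected by the writhe. -/
theorem framing_mul_actAll_move {l r : List Slice} (m : Move l r) {F : List ℕ → ℤ[T;T⁻¹]}
    (hF : LabelInvariant F) {o o' : List Bool} {s : List ℕ} (hs : s.length = o.length)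
    (h : run l o = some o') :
    framing (writhe l o) * actAll l F s = framing (writhe r o) * actAll r F s := by
  have h' := m.run_eq_some h
  cases m with
  | far i k p q =>
    rw [writhe_far i k p q h]
    congr 1
    refine act_far hF p q ?_
    simp only [run] at h
    obtain ⟨o1, h1, -⟩ := Option.bind_eq_some_iff.1 h
    have := (le_length_of_step h1).1
    simp only at this
    omega
  | zigzag i up =>
    have e := writhe_congr_of_shift (l := fun i => [⟨i, .cup up⟩, ⟨i + 1, .cap⟩])
      (r := fun _ => []) (fun _ => rfl) (fun _ => rfl) (by simp) 0
      (by intro o o' _ _; simp [writhe, Slice.sign]) i o o' h h'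
    rw [e, add_zero]
    congr 1
    simp only [run] at h
    obtain ⟨o1, h1, h2⟩ := Option.bind_eq_some_iff.1 h
    obtain ⟨o2, h2, -⟩ := Option.bind_eq_some_iff.1 h2
    have a1 := le_length_of_step h1
    have a2 := (le_length_of_step h2).1
    simp only [Piece.dom, Piece.cod] at a1 a2
    exact act_zigzag hF up (by omega)
  | zigzag' i up =>
    have e := writhe_congr_of_shift (l := fun i => [⟨i + 1, .cup up⟩, ⟨i, .cap⟩])
      (r := fun _ => []) (fun _ => rfl) (fun _ => rfl) (by simp) 0
      (by intro o o' _ _; simp [writhe, Slice.sign]) i o o' h h'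
    rw [e, add_zero]
    congr 1
    simp only [run] at h
    obtain ⟨o1, h1, -⟩ := Option.bind_eq_some_iff.1 h
    have a1 := le_length_of_step h1
    simp only [Piece.dom, Piece.cod] at a1
    exact act_zigzag' hF up (by omega)
  | slideCup i up e =>
    have e1 := writhe_congr_of_shift (l := fun i => [⟨i, .cup up⟩, ⟨i + 1, .cross e⟩])
      (r := fun i => [⟨i + 1, .cup up⟩, ⟨i, .cross (!e)⟩]) (fun _ => rfl) (fun _ => rfl) (by simp) 0
      (by
        intro o o' h _
        rcases o with _ | ⟨a, o⟩
        · simp [run, Slice.step] at h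
        · cases a <;> cases up <;> cases e <;> simp [writhe, Slice.sign, Slice.step]) i o o' h h'
    rw [e1, add_zero]
    congr 1
    simp only [run] at h'
    obtain ⟨o1, h1, -⟩ := Option.bind_eq_some_iff.1 h'
    have a1 := le_length_of_step h1
    simp only [Piece.dom, Piece.cod] at a1
    exact act_slideCup hF up e (by omega)
  | slideCap i e =>
    have e1 := writhe_congr_of_shift (l := fun i => [⟨i + 1, .cross e⟩, ⟨i, .cap⟩])
      (r := fun i => [⟨i, .cross (!e)⟩, ⟨i + 1, .cap⟩]) (fun _ => rfl) (fun _ => rfl) (by simp) 0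
      (by
        intro o o' h _
        rcases o with _ | ⟨a, _ | ⟨b, _ | ⟨c, o⟩⟩⟩
        · simp [run, Slice.step] at h
        · simp [run, Slice.step] at h
        · simp [run, Slice.step] at h
        · cases a <;> cases b <;> cases c <;> cases e <;>
            simp [writhe, Slice.sign, Slice.step, run] at h ⊢) i o o' h h'
    rw [e1, add_zero]
    congr 1
    simp only [run] at h
    obtain ⟨o1, h1, -⟩ := Option.bind_eq_some_iff.1 h
    have a1 := le_length_of_step h1
    simp only [Piece.dom, Piece.cod] at a1
    exact act_slideCap hF e (by omega)
  | reidemeister1Cup i up e =>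
    have e1 := writhe_congr_of_shift (l := fun i => [⟨i, .cup up⟩, ⟨i, .cross e⟩])
      (r := fun i => [⟨i, .cup (!up)⟩]) (fun _ => rfl) (fun _ => rfl) (by simp) (if e then -1 else 1)
      (by
        intro o o' h _
        cases up <;> cases e <;> simp [writhe, Slice.sign, Slice.step]) i o o' h h'
    simp only [run] at h
    obtain ⟨o1, h1, -⟩ := Option.bind_eq_some_iff.1 h
    have a1 := le_length_of_step h1
    simp only [Piece.dom, Piece.cod] at a1
    have e2 : actAll [⟨i, .cup up⟩, ⟨i, .cross e⟩] F s =
        -LaurentPolynomial.T (if e then 3 else -3) * actAll [⟨i, .cup (!up)⟩] F s :=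
      act_kinkCup hF up (!up) e (by omega)
    rw [e1, e2, framing_add]
    linear_combination (framing (writhe [⟨i, .cup (!up)⟩] o) * actAll [⟨i, .cup (!up)⟩] F s) *
      framing_kink e
  | reidemeister1Cap i e =>
    have e1 := writhe_congr_of_shift (l := fun i => [⟨i, .cross e⟩, ⟨i, .cap⟩])
      (r := fun i => [⟨i, .cap⟩]) (fun _ => rfl) (fun _ => rfl) (by simp) (if e then -1 else 1)
      (by
        intro o o' h _
        rcases o with _ | ⟨a, _ | ⟨b, o⟩⟩
        · simp [run, Slice.step] at h
        · simp [run, Slice.step] at h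
        · cases a <;> cases b <;> cases e <;> simp [writhe, Slice.sign, Slice.step, run] at h ⊢)
      i o o' h h'
    simp only [run] at h
    obtain ⟨o1, h1, -⟩ := Option.bind_eq_some_iff.1 h
    have a1 := le_length_of_step h1
    simp only [Piece.dom, Piece.cod] at a1
    have e2 : actAll [⟨i, .cross e⟩, ⟨i, .cap⟩] F s =
        -LaurentPolynomial.T (if e then 3 else -3) * actAll [⟨i, .cap⟩] F s :=
      act_kinkCap hF e (by omega)
    rw [e1, e2, framing_add]
    linear_combination (framing (writhe [⟨i, .cap⟩] o) * actAll [⟨i, .cap⟩] F s) * framing_kink e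
  | reidemeister2 i e =>
    have e1 := writhe_congr_of_shift (l := fun i => [⟨i, .cross e⟩, ⟨i, .cross (!e)⟩])
      (r := fun _ => []) (fun _ => rfl) (fun _ => rfl) (by simp) 0
      (by
        intro o o' h _
        rcases o with _ | ⟨a, _ | ⟨b, o⟩⟩
        · simp [run, Slice.step] at h
        · simp [run, Slice.step] at h
        · cases a <;> cases b <;> cases e <;> simp [writhe, Slice.sign, Slice.step]) i o o' h h'
    rw [e1, add_zero]
    congr 1
    simp only [run] at h
    obtain ⟨o1, h1, -⟩ := Option.bind_eq_some_iff.1 h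
    have a1 := le_length_of_step h1
    simp only [Piece.dom, Piece.cod] at a1
    exact act_reidemeister2 hF e (by omega)
  | reidemeister3 i a b c habc =>
    have e1 := writhe_congr_of_shift
      (l := fun i => [⟨i, .cross a⟩, ⟨i + 1, .cross b⟩, ⟨i, .cross c⟩])
      (r := fun i => [⟨i + 1, .cross c⟩, ⟨i, .cross b⟩, ⟨i + 1, .cross a⟩]) (fun _ => rfl)
      (fun _ => rfl) (by simp) 0
      (by
        intro o o' h _
        rcases o with _ | ⟨x, _ | ⟨y, _ | ⟨z, o⟩⟩⟩
        · simp [run, Slice.step] at h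
        · simp [run, Slice.step] at h
        · simp [run, Slice.step] at h
        · simp only [writhe, Slice.sign, Slice.step, List.drop_zero, List.take_zero,
            List.nil_append, List.drop_succ_cons, List.take_succ_cons, Option.getD_some,
            List.cons_append]
          ring) i o o' h h'
    rw [e1, add_zero]
    simp only [run] at h'
    obtain ⟨o1, h1, -⟩ := Option.bind_eq_some_iff.1 h'
    have a1 := le_length_of_step h1
    simp only [Piece.dom, Piece.cod] at a1
    exact congrArg (framing _ * ·) (act_reidemeister3 hF a b c habc (by omega))

/-- Every label occurs an even number of times. -/
def EvenLabels (s : List ℕ) : Prop := ∀ g : ℕ → ZMod 2, (s.map g).sum = 0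

theorem EvenLabels.addCup {s : List ℕ} (h : EvenLabels s) (i : ℕ) : EvenLabels (addCup i s) := by
  intro g
  have h1 := h g
  rw [← List.take_append_drop i s, List.map_append, List.sum_append] at h1
  simp only [LinkTheory.addCup, List.map_append, List.map_cons, List.sum_append, List.sum_cons]
  rw [← add_assoc (g _), CharTwo.add_self_eq_zero, zero_add, h1]

theorem EvenLabels.addCap {s : List ℕ} (h : EvenLabels s) {i : ℕ} (hi : i + 2 ≤ s.length) :
    EvenLabels (addCap i s).1 := by
  obtain ⟨p, a, b, q, rfl, hp⟩ := exists_cons_cons_of_le_length hi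
  rw [addCap_append hp]
  intro g
  split_ifs with hab
  · subst hab
    have h1 := h g
    simp only [List.map_append, List.map_cons, List.sum_append, List.sum_cons] at h1 ⊢
    rwa [← add_assoc (g a), CharTwo.add_self_eq_zero, zero_add] at h1
  · have h1 := h (g ∘ relabel a b)
    have ha : relabel a b a = b := if_pos rfl
    have hb : relabel a b b = b := if_neg (Ne.symm hab)
    simp only [List.map_append, List.map_cons, List.sum_append, List.sum_cons, Function.comp, ha,
      hb] at h1
    rw [← add_assoc (g b), CharTwo.add_self_eq_zero, zero_add] at h1
    simpa [Function.comp_def] using h1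

/-- The state sum in terms of operators. The definition of the state sum divides by the value of a
loop, with a truncated exponent `k - 1`; therefore at least one loop has to appear in the end. It
does, because the last cap joins two endpoints with the same label. -/
theorem loopValue_mul_stateSum {w : List Slice} {o : List Bool} {s : List ℕ} {k : ℕ}
    (hrun : run w o = some []) (hlen : s.length = o.length) (heven : EvenLabels s)
    (hne : s ≠ [] ∨ w ≠ [] ∨ 0 < k) :
    loopValue * stateSum w s k = loopValue ^ k * actAll w (fun _ => 1) s := by
  induction w generalizing o s k with
  | nil =>
    obtain rfl : o = [] := by simpa [run] using hrun
    obtain rfl : s = [] := by simpa using hlen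
    simp only [ne_eq, not_true_eq_false, false_or] at hne
    rw [stateSum, actAll_nil, mul_one, mul_pow_sub_one (by omega)]
  | cons x w ih =>
    simp only [run] at hrun
    obtain ⟨o1, h1, h2⟩ := Option.bind_eq_some_iff.1 hrun
    have hl := le_length_of_step h1
    rcases x with ⟨i, up | _ | e⟩ <;> simp only [Piece.dom, Piece.cod] at hl <;>
      simp only [stateSum, actAll_cons, act]
    · refine ih h2 (by rw [length_addCup]; omega) (heven.addCup i) (.inl ?_)
      exact List.ne_nil_of_length_pos (by rw [length_addCup]; omega)
    · have hlen' := length_addCap (s := s) (i := i) (by omega)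
      rw [ih h2 (by omega) (heven.addCap (by omega)), pow_add, mul_assoc]
      -- If no endpoint is left, the last two endpoints had the same label.
      by_cases hs : (addCap i s).1 = []
      · refine .inr (.inr ?_)
        rw [hs, List.length_nil] at hlen'
        obtain ⟨p, a, b, q, rfl, hp⟩ := exists_cons_cons_of_le_length (s := s) (i := i) (by omega)
        simp only [List.length_append, List.length_cons] at hlen'
        obtain rfl : p = [] := List.length_eq_zero_iff.1 (by omega)
        obtain rfl : q = [] := List.length_eq_zero_iff.1 (by omega)
        have hab := heven fun c => if c = a then 1 else 0
        by_cases h : a = b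
        · subst h
          rw [addCap_append hp]
          simp
        · simp [Ne.symm h] at hab
      · exact .inl hs
    · have hlen' := length_addCap (s := s) (i := i) (by omega)
      have hs : s ≠ [] := List.ne_nil_of_length_pos (by omega)
      have hs' : addCup i (addCap i s).1 ≠ [] :=
        List.ne_nil_of_length_pos (by rw [length_addCup]; omega)
      have e1 := ih (k := k) h2 (by omega) heven (.inl hs)
      have e2 := ih (k := k + (addCap i s).2) h2 (by rw [length_addCup]; omega)
        ((heven.addCap (by omega)).addCup i) (.inl hs')
      rw [pow_add] at e2
      linear_combination LaurentPolynomial.T (if e = true then -1 else 1) * e1 +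
        LaurentPolynomial.T (if e = true then 1 else -1) * e2

theorem loopValue_mul_jones (D : Diagram) (h : D.slices ≠ []) :
    loopValue * D.jones =
      framing (writhe D.slices []) * actAll D.slices (fun _ => 1) [] := by
  have := loopValue_mul_stateSum (k := 0) D.closed (s := []) rfl (fun _ => rfl) (.inr (.inl h))
  rw [pow_zero, one_mul] at this
  rw [← this, Diagram.jones, framing]
  ring

theorem labelInvariant_one : LabelInvariant fun _ => 1 := fun _ _ _ => rfl

theorem act_mul (x : Slice) (c : ℤ[T;T⁻¹]) (F : List ℕ → ℤ[T;T⁻¹]) (s : List ℕ) :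
    act x (fun t => c * F t) s = c * act x F s := by
  rcases x with ⟨i, up | _ | e⟩ <;> simp only [act] <;> ring

/-- Proportional functionals have proportional values at the states below. -/
theorem actAll_congr {u : List Slice} {o o' : List Bool} {s : List ℕ} {F G : List ℕ → ℤ[T;T⁻¹]}
    {c d : ℤ[T;T⁻¹]} (hu : run u o = some o') (hs : s.length = o.length)
    (h : ∀ t : List ℕ, t.length = o'.length → c * F t = d * G t) :
    c * actAll u F s = d * actAll u G s := by
  induction u generalizing o s with
  | nil =>
    obtain rfl : o = o' := by simpa [run] using hu
    exact h s hs
  | cons x u ih =>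
    simp only [run] at hu
    obtain ⟨o1, h1, h2⟩ := Option.bind_eq_some_iff.1 hu
    have hl := le_length_of_step h1
    rw [actAll_cons, actAll_cons, ← act_mul, ← act_mul]
    exact act_congr (by omega) fun t ht => ih h2 (by omega)

theorem loopValue_ne_zero : loopValue ≠ 0 := by
  intro h
  have := congrArg (LaurentPolynomial.eval₂ (RingHom.id ℤ) 1) h
  simp [loopValue] at this

theorem Move.ne_nil {l r : List Slice} (m : Move l r) : l ≠ [] := by
  cases m <;> simp

/-- Moves to the empty stack cannot be applied at the bottom of a diagram, where there are no
strands. So no diagram becomes empty by a move. -/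
theorem Move.run_nil {l : List Slice} (m : Move l []) : run l [] = none := by
  cases m with
  | zigzag i up => rcases i with _ | i <;> simp [run, Slice.step]
  | zigzag' i up => simp [run, Slice.step]
  | reidemeister2 i e => simp [run, Slice.step]

theorem Diagram.jones_eq_of_step {D D' : Diagram} (h : D.Step D') : D.jones = D'.jones := by
  obtain ⟨u, v, l, r, m, hD, hD'⟩ := h
  have hrun := D.closed
  rw [hD, run_append, run_append] at hrun
  obtain ⟨o1, h1, h2⟩ := Option.bind_eq_some_iff.1 hrun
  obtain ⟨o, hu, hl⟩ := Option.bind_eq_some_iff.1 h1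
  have hr := m.run_eq_some hl
  have hne : D.slices ≠ [] := by rw [hD]; simp [m.ne_nil]
  have hne' : D'.slices ≠ [] := by
    rw [hD']
    intro h
    simp only [List.append_eq_nil_iff] at h
    obtain ⟨⟨rfl, rfl⟩, rfl⟩ := h
    obtain rfl : [] = o := by simpa [run] using hu
    rw [m.run_nil] at hl
    cases hl
  apply mul_left_cancel₀ loopValue_ne_zero
  rw [loopValue_mul_jones D hne, loopValue_mul_jones D' hne', hD, hD',
    writhe_append (o' := o1) (by rw [run_append, hu]; exact hl), writhe_append hu,
    writhe_append (o' := o1) (by rw [run_append, hu]; exact hr), writhe_append hu]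
  simp only [framing_add, actAll_append]
  have := actAll_congr (F := actAll l (actAll v fun _ => 1)) (G := actAll r (actAll v fun _ => 1))
    (s := []) hu rfl
    fun t ht => framing_mul_actAll_move m (labelInvariant_actAll labelInvariant_one v) ht hl
  linear_combination (framing (writhe u []) * framing (writhe v o1)) * this

/-- The Jones polynomial of a link can be computed from any diagram of the link. -/
theorem Diagram.jones_link (D : Diagram) : D.link.jones = D.jones := by
  have h : ∀ D' : Diagram, D'.link = D.link → D'.jones = D.jones := by
    intro D' h
    have := congrArg (Quot.lift Diagram.jones fun _ _ => Diagram.jones_eq_of_step) h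
    exact this
  exact h _ (Quot.out_eq _)

/-! ### The Jones polynomial of closed three-braids -/

/-- The matrix of a generator of the braid monoid in the reduced Burau representation of the
three-strand braid group, with `t = T 4`. -/
noncomputable def burau (i : ℕ) : Matrix (Fin 2) (Fin 2) ℤ[T;T⁻¹] :=
  if i = 0 then !![-LaurentPolynomial.T 4, LaurentPolynomial.T 2; 0, 1]
  else !![1, 0; LaurentPolynomial.T 2, -LaurentPolynomial.T 4]

/-- The labels of the state that consists of three nested minima. -/
def cupState : List ℕ := [1, 2, 3, 3, 2, 1]

theorem actAll_nestedCups_three (F : List ℕ → ℤ[T;T⁻¹]) :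
    actAll (nestedCups 3) F [] = F cupState := by
  simp [nestedCups, List.range_succ, actAll_cons, actAll_nil, act, addCup, cupState]

/-- The functional `F`, restricted to the Temperley-Lieb algebra on three strands (the span of `1`,
`E₀`, `E₁`, `E₀ E₁`, `E₁ E₀`), is the Markov trace of multiplication by an element that acts by the
matrix `M` in the two-dimensional representation and by the scalar `c` in the one-dimensional
representation. -/
structure IsMarkovTrace (F : List ℕ → ℤ[T;T⁻¹]) (M : Matrix (Fin 2) (Fin 2) ℤ[T;T⁻¹])
    (c : ℤ[T;T⁻¹]) : Prop where
  inv : LabelInvariant F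
  one : F cupState = loopValue * (M 0 0 + M 1 1) + (loopValue ^ 3 - 2 * loopValue) * c
  turn0 : turn 0 F cupState = loopValue * (loopValue * M 0 0 + M 1 0)
  turn1 : turn 1 F cupState = loopValue * (M 0 1 + loopValue * M 1 1)
  turn01 : turn 0 (turn 1 F) cupState = loopValue * (M 0 0 + loopValue * M 1 0)
  turn10 : turn 1 (turn 0 F) cupState = loopValue * (loopValue * M 0 1 + M 1 1)

/-- The closing arcs alone give the Markov trace itself. -/
theorem isMarkovTrace_nestedCaps : IsMarkovTrace (actAll (nestedCaps 3) fun _ => 1) 1 1 where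
  inv := labelInvariant_actAll labelInvariant_one _
  one := by
    simp [nestedCaps, List.range_succ, actAll_cons, actAll_nil, act, addCap, cupState]
    ring
  turn0 := by
    simp [nestedCaps, List.range_succ, actAll_cons, actAll_nil, act, addCap, addCup, cupState, turn]
  turn1 := by
    simp [nestedCaps, List.range_succ, actAll_cons, actAll_nil, act, addCap, addCup, cupState, turn]
  turn01 := by
    simp [nestedCaps, List.range_succ, actAll_cons, actAll_nil, act, addCap, addCup, cupState, turn]
  turn10 := by
    simp [nestedCaps, List.range_succ, actAll_cons, actAll_nil, act, addCap, addCup, cupState, turn]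

theorem T_two_eq : (LaurentPolynomial.T 2 : ℤ[T;T⁻¹]) =
    LaurentPolynomial.T 1 * LaurentPolynomial.T 1 := by
  simp only [← LaurentPolynomial.T_add]; norm_num

theorem T_four_eq : (LaurentPolynomial.T 4 : ℤ[T;T⁻¹]) =
    LaurentPolynomial.T 1 * LaurentPolynomial.T 1 *
      (LaurentPolynomial.T 1 * LaurentPolynomial.T 1) := by
  simp only [← LaurentPolynomial.T_add]; norm_num

/-- Only the values at states with the same number of endpoints matter. -/
theorem turn_loopValue_mul {F G : List ℕ → ℤ[T;T⁻¹]} {s : List ℕ} {i : ℕ} (h : i + 2 ≤ s.length)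
    (hFG : ∀ t : List ℕ, t.length = s.length → F t = loopValue * G t) :
    turn i F s = loopValue * turn i G s := by
  have e : turn i F s = turn i (fun t => loopValue * G t + 0 * G t) s := by
    refine act_congr h fun t ht => act_congr ?_ fun r hr => ?_
    · have : t.length + 2 = s.length + 0 := ht
      change i + 0 ≤ t.length
      omega
    · have h1 : t.length + 2 = s.length + 0 := ht
      have h2 : r.length + 0 = t.length + 2 := hr
      rw [hFG r (by omega), zero_mul, add_zero]
  rw [e, turn_add_mul, zero_mul, add_zero]

theorem turn_add_mul_eq (i : ℕ) (a b : ℤ[T;T⁻¹]) (F G : List ℕ → ℤ[T;T⁻¹]) :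
    turn i (fun s => a * F s + b * G s) = fun s => a * turn i F s + b * turn i G s :=
  funext (turn_add_mul i a b F G)

/-- A positive crossing multiplies by `A⁻¹ + A Eᵢ` in the Temperley-Lieb algebra. In the
two-dimensional representation this is `A⁻¹` times the Burau matrix, and in the one-dimensional one,
where `Eᵢ` is zero, it is `A⁻¹`. -/
theorem IsMarkovTrace.cross {F : List ℕ → ℤ[T;T⁻¹]} {M : Matrix (Fin 2) (Fin 2) ℤ[T;T⁻¹]}
    {c : ℤ[T;T⁻¹]} (h : IsMarkovTrace F M c) {i : ℕ} (hi : i < 2) :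
    IsMarkovTrace (act ⟨i, .cross true⟩ F)
      ((LaurentPolynomial.T (-1) : ℤ[T;T⁻¹]) • (burau i * M)) (LaurentPolynomial.T (-1) * c) := by
  have hT := T_one_mul_T_neg_one
  have hlen : cupState.length = 6 := rfl
  have e00 := turn_turn h.inv (s := cupState) (i := 0) (by omega)
  have e11 := turn_turn h.inv (s := cupState) (i := 1) (by omega)
  have e010 : turn 0 (turn 1 (turn 0 F)) cupState = turn 0 F cupState :=
    turn_turn_succ_turn h.inv (by omega)
  have e101 : turn 1 (turn 0 (turn 1 F)) cupState = turn 1 F cupState :=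
    turn_succ_turn_turn_succ h.inv (by omega)
  have e011 : turn 0 (turn 1 (turn 1 F)) cupState = loopValue * turn 0 (turn 1 F) cupState :=
    turn_loopValue_mul (by omega) fun t ht => turn_turn h.inv (by omega)
  have e100 : turn 1 (turn 0 (turn 0 F)) cupState = loopValue * turn 1 (turn 0 F) cupState :=
    turn_loopValue_mul (by omega) fun t ht => turn_turn h.inv (by omega)
  obtain ⟨g1, g2, g3, g4, g5, g6⟩ := h
  have hM : ∀ i j, ((LaurentPolynomial.T (-1) : ℤ[T;T⁻¹]) • (burau 0 * M)) i j =
      if i = 0 then LaurentPolynomial.T (-1) * (-LaurentPolynomial.T 4 * M 0 j +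
        LaurentPolynomial.T 2 * M 1 j) else LaurentPolynomial.T (-1) * M 1 j := by
    intro i j
    fin_cases i <;> simp [burau, Matrix.vecMul, dotProduct, Fin.sum_univ_two]
  have hM' : ∀ i j, ((LaurentPolynomial.T (-1) : ℤ[T;T⁻¹]) • (burau 1 * M)) i j =
      if i = 0 then LaurentPolynomial.T (-1) * M 0 j else
      LaurentPolynomial.T (-1) * (LaurentPolynomial.T 2 * M 0 j -
        LaurentPolynomial.T 4 * M 1 j) := by
    intro i j
    fin_cases i <;> simp [burau, Matrix.vecMul, dotProduct, Fin.sum_univ_two, sub_eq_add_neg]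
  have h10 : (1 : Fin 2) ≠ 0 := by decide
  obtain rfl | rfl : i = 0 ∨ i = 1 := by omega
  · refine ⟨labelInvariant_act g1 _, ?_, ?_, ?_, ?_, ?_⟩ <;>
      simp only [act_cross_eq_turn, turn_add_mul_eq, if_true, hM, if_neg h10, e00, e010, e100, g2,
        g3, g4, g5, g6, T_two_eq, T_four_eq, loopValue_eq] <;>
      clear * - hT <;>
      generalize (LaurentPolynomial.T 1 : ℤ[T;T⁻¹]) = a at * <;>
      generalize (LaurentPolynomial.T (-1) : ℤ[T;T⁻¹]) = b at * <;>
      generalize M 0 0 = p <;> generalize M 0 1 = q <;> generalize M 1 0 = r <;>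
      generalize M 1 1 = s <;>
      grind
  · refine ⟨labelInvariant_act g1 _, ?_, ?_, ?_, ?_, ?_⟩ <;>
      simp only [act_cross_eq_turn, turn_add_mul_eq, if_true, hM', if_neg h10, e11, e101, e011, g2,
        g3, g4, g5, g6, T_two_eq, T_four_eq, loopValue_eq] <;>
      clear * - hT <;>
      generalize (LaurentPolynomial.T 1 : ℤ[T;T⁻¹]) = a at * <;>
      generalize (LaurentPolynomial.T (-1) : ℤ[T;T⁻¹]) = b at * <;>
      generalize M 0 0 = p <;> generalize M 0 1 = q <;> generalize M 1 0 = r <;>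
      generalize M 1 1 = s <;>
      grind

theorem isMarkovTrace_crossings (w : FreeMonoid ℕ) (hw : ∀ g ∈ letters w, g.1 < 2) :
    IsMarkovTrace (actAll (crossings (letters w) ++ nestedCaps 3) fun _ => 1)
      ((LaurentPolynomial.T (-(letters w).length) : ℤ[T;T⁻¹]) • FreeMonoid.lift burau w)
      (LaurentPolynomial.T (-(letters w).length)) := by
  induction w using FreeMonoid.recOn with
  | one => simpa [letters, crossings] using isMarkovTrace_nestedCaps
  | of_mul i w ih =>
    have e : letters (FreeMonoid.of i * w) = (i, true) :: letters w := rfl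
    rw [e] at hw ⊢
    have h := (ih fun g hg => hw g (by simp [hg])).cross (hw (i, true) (by simp))
    rw [map_mul, FreeMonoid.lift_eval_of]
    rw [Matrix.mul_smul, smul_smul, ← LaurentPolynomial.T_add] at h
    have e' : (-(((i, true) :: letters w).length : ℤ)) = -1 + -((letters w).length : ℤ) := by
      simp only [List.length_cons]; push_cast; ring
    rw [e']
    exact h

theorem writhe_crossings (n : ℕ) (w : FreeMonoid ℕ) (hw : ∀ g ∈ letters w, g.1 + 1 < n)
    (l : List Bool) :
    writhe (crossings (letters w)) (List.replicate n true ++ l) = (letters w).length := by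
  induction w using FreeMonoid.recOn with
  | one => rfl
  | of_mul i w ih =>
    have e : letters (FreeMonoid.of i * w) = (i, true) :: letters w := rfl
    rw [e] at hw ⊢
    have hi : i + 1 < n := hw (i, true) (by simp)
    have h1 := run_crossings_replicate n [(i, true)] (by simpa using hi) l
    simp only [crossings, List.map_cons, List.map_nil, run, Option.bind_fun_some] at h1
    have h2 := ih fun g hg => hw g (by simp [hg])
    have h3 : Slice.sign ⟨i, .cross true⟩ (List.replicate n true ++ l) = 1 := by
      obtain ⟨k, rfl⟩ : ∃ k, n = i + (k + 2) := ⟨n - i - 2, by omega⟩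
      simp [Slice.sign, ← List.replicate_append_replicate, List.replicate_succ]
    simp only [crossings, List.map_cons, writhe, h1, Option.getD_some, h3, List.length_cons]
    rw [crossings] at h2
    rw [h2]
    push_cast
    ring

theorem writhe_closureSlices_three (w : FreeMonoid ℕ) (hw : ∀ g ∈ letters w, g.1 < 2) :
    writhe (closureSlices 3 (letters w)) [] = (letters w).length := by
  have hw' : ∀ g ∈ letters w, g.1 + 1 < 3 := fun g hg => by have := hw g hg; omega
  have h1 := run_crossings_replicate 3 (letters w) hw' (List.replicate 3 false)
  rw [closureSlices, writhe_append (o' := List.replicate 3 true ++ List.replicate 3 false)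
    (by rw [run_append, run_nestedCups, Option.bind_some, h1]), writhe_append (run_nestedCups 3),
    writhe_crossings 3 w hw']
  simp [nestedCups, nestedCaps, List.range_succ, writhe, Slice.sign]

/-- Jones's formula for the closure of a positive three-braid. -/
theorem jones_of_slices_eq (D : Diagram) (w : FreeMonoid ℕ) (hw : ∀ g ∈ letters w, g.1 < 2)
    (hD : D.slices = closureSlices 3 (letters w)) :
    D.jones = LaurentPolynomial.C (((letters w).length : ℤ).negOnePow : ℤ) *
      LaurentPolynomial.T (2 * (letters w).length) *
        (LaurentPolynomial.T 4 + LaurentPolynomial.T (-4) + (FreeMonoid.lift burau w).trace) := by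
  have hne : D.slices ≠ [] := by rw [hD]; simp [closureSlices, nestedCups, List.range_succ]
  apply mul_left_cancel₀ loopValue_ne_zero
  rw [loopValue_mul_jones D hne, hD, writhe_closureSlices_three w hw, closureSlices,
    List.append_assoc, actAll_append, actAll_nestedCups_three, (isMarkovTrace_crossings w hw).one,
    framing, Matrix.trace_fin_two]
  simp only [Matrix.smul_apply, smul_eq_mul]
  generalize ((letters w).length : ℤ) = n
  have h1 : (LaurentPolynomial.T (3 * n) : ℤ[T;T⁻¹]) * LaurentPolynomial.T (-n) =
      LaurentPolynomial.T (2 * n) := by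
    rw [← LaurentPolynomial.T_add]; congr 1; ring
  have h2 : loopValue ^ 2 = LaurentPolynomial.T 4 + LaurentPolynomial.T (-4) + 2 := by
    have h : (LaurentPolynomial.T (-4) : ℤ[T;T⁻¹]) = LaurentPolynomial.T (-1) *
      LaurentPolynomial.T (-1) * (LaurentPolynomial.T (-1) * LaurentPolynomial.T (-1)) := by
      simp only [← LaurentPolynomial.T_add]; norm_num
    have hT := T_one_mul_T_neg_one
    rw [loopValue_eq, h, T_four_eq]
    grind
  rw [← h1]
  linear_combination (LaurentPolynomial.C (n.negOnePow : ℤ) * LaurentPolynomial.T (3 * n) *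
    LaurentPolynomial.T (-n) * loopValue) * h2

theorem twistedLink_jones (x y z : ℕ) :
    (twistedLink x y z).jones = LaurentPolynomial.C (((x + y + 2 * z : ℕ) : ℤ).negOnePow : ℤ) *
      LaurentPolynomial.T (2 * (x + y + 2 * z : ℕ)) *
        (LaurentPolynomial.T 4 + LaurentPolynomial.T (-4) +
          (burau 0 ^ x * burau 1 ^ y * (burau 0 * burau 1) ^ z).trace) := by
  have h := jones_of_slices_eq (BraidWord.closureDiagram (n := 3)
    (wordPow [(0, true)] x ++ wordPow [(1, true)] y ++ wordPow (ascending 3) z))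
    (.of 0 ^ x * .of 1 ^ y * (.of 0 * .of 1) ^ z) ?_ ?_
  · have hl : (letters (.of 0 ^ x * .of 1 ^ y * (.of 0 * .of 1) ^ z)).length = x + y + 2 * z := by
      simp only [letters_mul, letters_pow, List.length_append, List.length_flatten,
        List.map_replicate, List.sum_replicate, smul_eq_mul]
      simp [letters]
      ring
    rw [twistedLink, BraidWord.closure, Diagram.jones_link, h, hl]
    simp only [map_mul, map_pow, FreeMonoid.lift_eval_of]
  · intro g hg
    rw [← map_twistedWord, List.mem_map] at hg
    obtain ⟨g', -, rfl⟩ := hg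
    exact g'.1.2
  · rw [BraidWord.closureDiagram_slices, map_twistedWord]

/-! ### The Jones polynomial of a twisted three-braid determines its normal form -/

section Trace
open LaurentPolynomial

theorem burau_zero_pow (x : ℕ) : burau 0 ^ x =
    !![(-T 4) ^ x, T 2 * ∑ i ∈ Finset.range x, (-T 4) ^ i; 0, 1] := by
  induction x with
  | zero => simp [Matrix.one_fin_two]
  | succ x ih =>
    rw [pow_succ, ih, Finset.sum_range_succ]
    refine Matrix.ext fun i j => ?_
    fin_cases i <;> fin_cases j <;> simp [burau, Matrix.mul_apply, Fin.sum_univ_two, pow_succ]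
    ring

theorem burau_one_pow (y : ℕ) : burau 1 ^ y =
    !![1, 0; T 2 * ∑ i ∈ Finset.range y, (-T 4) ^ i, (-T 4) ^ y] := by
  induction y with
  | zero => simp [Matrix.one_fin_two]
  | succ x ih =>
    rw [pow_succ, ih, Finset.sum_range_succ]
    refine Matrix.ext fun i j => ?_
    fin_cases i <;> fin_cases j <;> simp [burau, Matrix.mul_apply, Fin.sum_univ_two, pow_succ]
    ring

/-- The full twist acts by a scalar. -/
theorem burau_full_twist : (burau 0 * burau 1) ^ 3 = (T 12 : ℤ[T;T⁻¹]) • 1 := by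
  have h4 : (T 4 : ℤ[T;T⁻¹]) = T 2 ^ 2 := by rw [T_pow]; norm_num
  have h12 : (T 12 : ℤ[T;T⁻¹]) = T 2 ^ 6 := by rw [T_pow]; norm_num
  rw [h12, pow_succ, pow_two, burau, burau, if_pos rfl, if_neg one_ne_zero, h4]
  generalize (T 2 : ℤ[T;T⁻¹]) = s
  refine Matrix.ext fun i j => ?_
  fin_cases i <;> fin_cases j <;>
    simp [Matrix.mul_apply, Fin.sum_univ_two] <;> ring

theorem trace_burau (x y k : ℕ) :
    (burau 0 ^ x * burau 1 ^ y * (burau 0 * burau 1) ^ (3 * k)).trace =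
      T 12 ^ k * ((-T 4) ^ x + (-T 4) ^ y + T 4 * (∑ i ∈ Finset.range x, (-T 4) ^ i) *
        ∑ i ∈ Finset.range y, (-T 4) ^ i) := by
  have h4 : (T 4 : ℤ[T;T⁻¹]) = T 2 ^ 2 := by rw [T_pow]; norm_num
  rw [pow_mul, burau_full_twist, smul_pow, one_pow, Matrix.mul_smul, mul_one, Matrix.trace_smul,
    burau_zero_pow, burau_one_pow, Matrix.trace_fin_two, smul_eq_mul]
  simp only [Matrix.mul_apply, Fin.sum_univ_two, Matrix.of_apply, Matrix.cons_val', Matrix.cons_val_zero,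
    Matrix.cons_val_one, Matrix.cons_val_fin_one]
  generalize (∑ i ∈ Finset.range x, (-T 4) ^ i : ℤ[T;T⁻¹]) = p
  generalize (∑ i ∈ Finset.range y, (-T 4) ^ i : ℤ[T;T⁻¹]) = q
  rw [h4]
  ring

end Trace

open Polynomial in
/-- The part of the Jones polynomial of the closure of `σ₁ ^ x σ₂ ^ y [1,3] ^ (3 * k)` that depends on
`x` and `y` separately, after multiplication by `(1 - X) ^ 2`, where `X = -t`. -/
noncomputable def jonesCore (x y : ℕ) : ℤ[X] :=
  (X ^ x + X ^ y) * (1 - X) ^ 2 - X * (1 - X ^ x) * (1 - X ^ y)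

open Polynomial in
/-- The Jones polynomial of the closure of `σ₁ ^ x σ₂ ^ y [1,3] ^ (3 * k)`, without its leading monomial
and multiplied by `X * (1 - X) ^ 2`, where `X = -t`. -/
noncomputable def jonesNumerator (x y k : ℕ) : ℤ[X] :=
  -(1 + X ^ 2) * (1 - X) ^ 2 + (-1) ^ k * X ^ (3 * k + 1) * jonesCore x y

open Polynomial in
/-- The factor on the left is `X * (1 - X) ^ 2` for `X = -t`, since `T 4` is `t`. -/
theorem twistedLink_jones_mul (x y k : ℕ) :
    (twistedLink x y (3 * k)).jones * (-LaurentPolynomial.T 4 * (1 + LaurentPolynomial.T 4) ^ 2) =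
      LaurentPolynomial.C (((x + y + 6 * k : ℕ) : ℤ).negOnePow : ℤ) *
        toLaurent (X ^ (2 * (x + y + 6 * k)) * (jonesNumerator x y k).comp (-X ^ 4)) := by
  have hT : (LaurentPolynomial.T 4 : ℤ[T;T⁻¹]) * LaurentPolynomial.T (-4) = 1 := by
    rw [← LaurentPolynomial.T_add]; simp
  have h12 : (LaurentPolynomial.T 12 : ℤ[T;T⁻¹]) = LaurentPolynomial.T 4 ^ 3 := by
    rw [LaurentPolynomial.T_pow]; norm_num
  have hX : toLaurent (X ^ (2 * (x + y + 6 * k))) =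
      (LaurentPolynomial.T (2 * (x + y + 2 * (3 * k) : ℕ)) : ℤ[T;T⁻¹]) := by
    rw [toLaurent_X_pow]
    congr 1
    push_cast
    ring
  have hu : toLaurent (X ^ 4 : ℤ[X]) = LaurentPolynomial.T 4 := by simp
  have hp := mul_neg_geom_sum (-LaurentPolynomial.T 4 : ℤ[T;T⁻¹]) x
  have hq := mul_neg_geom_sum (-LaurentPolynomial.T 4 : ℤ[T;T⁻¹]) y
  have hs : x + y + 6 * k = x + y + 2 * (3 * k) := by ring
  rw [twistedLink_jones, trace_burau, map_mul, hX, h12, hs, jonesNumerator, jonesCore]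
  simp only [add_comp, mul_comp, neg_comp, sub_comp, pow_comp, X_comp, one_comp, map_add, map_mul,
    map_neg, map_sub, map_pow, map_one, hu]
  generalize (LaurentPolynomial.C ((((x + y + 2 * (3 * k) : ℕ) : ℤ)).negOnePow : ℤ) : ℤ[T;T⁻¹]) = c
  generalize (LaurentPolynomial.T (2 * ((x + y + 2 * (3 * k) : ℕ) : ℤ)) : ℤ[T;T⁻¹]) = d
  generalize (∑ i ∈ Finset.range x, (-LaurentPolynomial.T 4) ^ i : ℤ[T;T⁻¹]) = p at *
  generalize (∑ i ∈ Finset.range y, (-LaurentPolynomial.T 4) ^ i : ℤ[T;T⁻¹]) = q at *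
  generalize (LaurentPolynomial.T 4 : ℤ[T;T⁻¹]) = v at *
  generalize (LaurentPolynomial.T (-4) : ℤ[T;T⁻¹]) = v' at *
  have hk : ((-1) ^ k * (-v) ^ (3 * k + 1) : ℤ[T;T⁻¹]) = -v * (v ^ 3) ^ k := by
    have hv : v ^ 3 = -1 * (-v) ^ 3 := by ring
    rw [hv, mul_pow, pow_succ, pow_mul]
    ring
  rw [hk, ← hp, ← hq]
  linear_combination (-c * d * (1 + v) ^ 2) * hT

open Polynomial in
theorem jonesNumerator_eval_zero (x y k : ℕ) : (jonesNumerator x y k).eval 0 = -1 := by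
  simp [jonesNumerator]

open Polynomial in
/-- The substitution `X ↦ -X ^ 4`, which stands for `X ↦ -t`, is injective. -/
theorem comp_neg_X_pow_injective {p q : ℤ[X]} (h : p.comp (-X ^ 4) = q.comp (-X ^ 4)) : p = q := by
  rw [← sub_eq_zero, ← sub_comp, comp_eq_zero_iff] at h
  rcases h with h | ⟨-, h⟩
  · exact sub_eq_zero.mp h
  · have h4 := congrArg (fun r => coeff r 4) h
    simp [coeff_X_pow] at h4

open Polynomial in
/-- The lowest exponent of the Jones polynomial determines `x + y + 6 k`, since the constant
coefficient of `jonesNumerator` is not zero. -/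
theorem jonesNumerator_eq_of_jones_eq {x y k x' y' k' : ℕ} (hle : x + y + 6 * k ≤ x' + y' + 6 * k')
    (h : (twistedLink x y (3 * k)).jones = (twistedLink x' y' (3 * k')).jones) :
    x + y + 6 * k = x' + y' + 6 * k' ∧ jonesNumerator x y k = jonesNumerator x' y' k' := by
  have h1 := twistedLink_jones_mul x y k
  rw [h, twistedLink_jones_mul x' y' k'] at h1
  obtain ⟨d, hd⟩ := Nat.exists_eq_add_of_le hle
  have hunit : ∀ n : ℤ, (LaurentPolynomial.C (n.negOnePow : ℤ) : ℤ[T;T⁻¹]) =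
      toLaurent (C (n.negOnePow : ℤ)) := fun n => by simp
  rw [hunit, hunit, ← map_mul, ← map_mul] at h1
  have h2 := toLaurent_injective h1
  have h3 : (C ((((x' + y' + 6 * k' : ℕ) : ℤ)).negOnePow : ℤ) : ℤ[X]) *
      (X ^ (2 * d) * (jonesNumerator x' y' k').comp (-X ^ 4)) =
      C ((((x + y + 6 * k : ℕ) : ℤ)).negOnePow : ℤ) * (jonesNumerator x y k).comp (-X ^ 4) := by
    apply mul_left_cancel₀ (pow_ne_zero (2 * (x + y + 6 * k)) (X_ne_zero (R := ℤ)))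
    rw [hd, mul_add, pow_add] at h2
    rw [hd]
    linear_combination h2
  have h4 := congrArg (eval 0) h3
  simp only [eval_mul, eval_C, eval_comp, eval_neg, eval_pow, eval_X, ne_eq, OfNat.ofNat_ne_zero,
    not_false_eq_true, zero_pow, neg_zero, jonesNumerator_eval_zero] at h4
  have hd0 : d = 0 := by
    by_contra hne
    rw [zero_pow (by omega)] at h4
    simp at h4
  subst hd0
  rw [add_zero] at hd
  refine ⟨hd.symm, ?_⟩
  rw [hd, mul_zero, pow_zero, one_mul] at h3
  refine (comp_neg_X_pow_injective (mul_left_cancel₀ ?_ h3)).symm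
  simp

open Polynomial in
theorem jonesCore_eq (x y : ℕ) : jonesCore x y = X ^ x - X ^ (x + 1) + X ^ (x + 2) +
    (X ^ y - X ^ (y + 1) + X ^ (y + 2)) - X ^ 1 - X ^ (x + y + 1) := by
  rw [jonesCore]; ring

/-- The lowest coefficients of `jonesCore x y` vanish only for `{x, y} = {1, 2}`. -/
theorem eq_of_X_pow_three_dvd_jonesCore {x y : ℕ} (h : Polynomial.X ^ 3 ∣ jonesCore x y) :
    x = 1 ∧ y = 2 ∨ x = 2 ∧ y = 1 := by
  rw [Polynomial.X_pow_dvd_iff] at h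
  have h0 := h 0 (by norm_num)
  have h1 := h 1 (by norm_num)
  have h2 := h 2 (by norm_num)
  simp only [jonesCore_eq, Polynomial.coeff_sub, Polynomial.coeff_add, Polynomial.coeff_X_pow]
    at h0 h1 h2
  clear h
  by_contra hne
  grind

theorem jonesCore_of_eq {x y : ℕ} (h : x = 1 ∧ y = 2 ∨ x = 2 ∧ y = 1) : jonesCore x y = 0 := by
  rcases h with ⟨rfl, rfl⟩ | ⟨rfl, rfl⟩ <;> rw [jonesCore] <;> ring

open Polynomial in
/-- Numerators for different `k` differ: otherwise both cores are divisible by `X ^ 3`, hence zero,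
and `x + y = x' + y' = 3` contradicts the equality of the exponents. -/
theorem false_of_jonesNumerator_eq {x y k x' y' k' : ℕ} (hk : k < k')
    (he : x + y + 6 * k = x' + y' + 6 * k')
    (h : jonesNumerator x y k = jonesNumerator x' y' k') : False := by
  obtain ⟨m, rfl⟩ := Nat.exists_eq_add_of_lt hk
  have h1 : jonesCore x y = (-1) ^ (m + 1) * X ^ (3 * (m + 1)) * jonesCore x' y' := by
    have h2 : ((-1) ^ k * X ^ (3 * k + 1) : ℤ[X]) ≠ 0 :=
      mul_ne_zero (pow_ne_zero _ (by norm_num)) (pow_ne_zero _ X_ne_zero)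
    apply mul_left_cancel₀ h2
    rw [jonesNumerator, jonesNumerator] at h
    linear_combination h
  have h3 := eq_of_X_pow_three_dvd_jonesCore (x := x) (y := y)
    (h1 ▸ Dvd.intro ((-1) ^ (m + 1) * X ^ (3 * m) * jonesCore x' y') (by ring))
  rw [jonesCore_of_eq h3] at h1
  have h4 : jonesCore x' y' = 0 := by
    have h5 : ((-1) ^ (m + 1) * X ^ (3 * (m + 1)) : ℤ[X]) ≠ 0 :=
      mul_ne_zero (pow_ne_zero _ (by norm_num)) (pow_ne_zero _ X_ne_zero)
    exact (mul_eq_zero.mp h1.symm).resolve_left h5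
  have h6 := eq_of_X_pow_three_dvd_jonesCore (x := x') (y := y') (h4 ▸ dvd_zero _)
  omega

open Polynomial in
theorem eq_or_swap_of_jonesNumerator_eq {x y x' y' k : ℕ} (he : x + y = x' + y')
    (h : jonesNumerator x y k = jonesNumerator x' y' k) :
    x = x' ∧ y = y' ∨ x = y' ∧ y = x' := by
  have h1 : (X ^ x + X ^ y : ℤ[X]) = X ^ x' + X ^ y' := by
    have h2 : ((-1) ^ k * X ^ (3 * k + 1) : ℤ[X]) ≠ 0 :=
      mul_ne_zero (pow_ne_zero _ (by norm_num)) (pow_ne_zero _ X_ne_zero)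
    have h3 : (1 - X + X ^ 2 : ℤ[X]) ≠ 0 := fun h0 => by
      have := congrArg (eval 0) h0
      simp at this
    apply mul_left_cancel₀ (mul_ne_zero h2 h3)
    rw [jonesNumerator, jonesNumerator, jonesCore_eq, jonesCore_eq, he] at h
    linear_combination h
  have h4 := congrArg (fun p => coeff p x) h1
  simp only [coeff_add, coeff_X_pow, if_true] at h4
  have h5 : x = x' ∨ x = y' := by
    by_contra hne
    push Not at hne
    rw [if_neg hne.1, if_neg hne.2] at h4
    split_ifs at h4 <;> omega
  omega

/-- The Jones polynomial determines the normal form of a twisted link up to the order of `x` and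
`y`. -/
theorem eq_of_jones_eq {x y k x' y' k' : ℕ}
    (h : (twistedLink x y (3 * k)).jones = (twistedLink x' y' (3 * k')).jones) :
    k = k' ∧ (x = x' ∧ y = y' ∨ x = y' ∧ y = x') := by
  have h1 : x + y + 6 * k = x' + y' + 6 * k' ∧ jonesNumerator x y k = jonesNumerator x' y' k' := by
    rcases le_total (x + y + 6 * k) (x' + y' + 6 * k') with hle | hle
    · exact jonesNumerator_eq_of_jones_eq hle h
    · exact (jonesNumerator_eq_of_jones_eq hle h.symm).imp Eq.symm Eq.symm
  obtain ⟨he, hP⟩ := h1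
  rcases lt_trichotomy k k' with hk | rfl | hk
  · exact (false_of_jonesNumerator_eq hk he hP).elim
  · exact ⟨rfl, eq_or_swap_of_jonesNumerator_eq (by omega) hP⟩
  · exact (false_of_jonesNumerator_eq hk he.symm hP.symm).elim

/-! ### Colourings of diagrams by group elements -/

section Colorings
variable {G : Type} [Group G]

/-- A slice of a coloured diagram, with the colours of the strands below and above it. The colours
are the values, under a representation of the link group, of the meridians around the strands, all
oriented as if the strands pointed upwards, so that the two legs of an extremum have inverse
colours. -/
inductive ColorStep : Slice → List G → List G → Prop
  | cup (up : Bool) (g : G) (c : List G) : ColorStep ⟨0, .cup up⟩ c (g :: g⁻¹ :: c)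
  | cap (g : G) (c : List G) : ColorStep ⟨0, .cap⟩ (g :: g⁻¹ :: c) c
  | overpass (a b : G) (c : List G) : ColorStep ⟨0, .cross true⟩ (a :: b :: c) (a * b * a⁻¹ :: a :: c)
  | underpass (a b : G) (c : List G) :
      ColorStep ⟨0, .cross false⟩ (a :: b :: c) (b :: b⁻¹ * a * b :: c)
  | succ {i : ℕ} {p : Piece} {c d : List G} (g : G) (h : ColorStep ⟨i, p⟩ c d) :
      ColorStep ⟨i + 1, p⟩ (g :: c) (g :: d)

theorem colorStep_succ {i : ℕ} {p : Piece} {c d : List G} :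
    ColorStep ⟨i + 1, p⟩ c d ↔ ∃ g c' d', c = g :: c' ∧ d = g :: d' ∧ ColorStep ⟨i, p⟩ c' d' := by
  constructor
  · rintro ⟨⟩
    exact ⟨_, _, _, rfl, rfl, ‹_›⟩
  · rintro ⟨g, c', d', rfl, rfl, h⟩
    exact .succ g h

theorem colorStep_cup {up : Bool} {c d : List G} :
    ColorStep ⟨0, .cup up⟩ c d ↔ ∃ g, d = g :: g⁻¹ :: c := by
  constructor
  · rintro ⟨⟩
    exact ⟨_, rfl⟩
  · rintro ⟨g, rfl⟩
    exact .cup up g c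

theorem colorStep_cap {c d : List G} : ColorStep ⟨0, .cap⟩ c d ↔ ∃ g, c = g :: g⁻¹ :: d := by
  constructor
  · rintro ⟨⟩
    exact ⟨_, rfl⟩
  · rintro ⟨g, rfl⟩
    exact .cap g d

theorem colorStep_cross {e : Bool} {c d : List G} : ColorStep ⟨0, .cross e⟩ c d ↔
    ∃ a b r, c = a :: b :: r ∧
      d = (if e then a * b * a⁻¹ else b) :: (if e then a else b⁻¹ * a * b) :: r := by
  constructor
  · rintro ⟨⟩
    · exact ⟨_, _, _, rfl, rfl⟩
    · exact ⟨_, _, _, rfl, rfl⟩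
  · rintro ⟨a, b, r, rfl, rfl⟩
    cases e
    · exact .underpass a b r
    · exact .overpass a b r

theorem ColorStep.append {i : ℕ} {p : Piece} {c d : List G} (a : List G) (ha : a.length = i)
    (h : ColorStep ⟨0, p⟩ c d) : ColorStep ⟨i, p⟩ (a ++ c) (a ++ d) := by
  subst ha
  induction a with
  | nil => exact h
  | cons g a ih => exact .succ g ih

theorem ColorStep.exists_append {i : ℕ} {p : Piece} {c d : List G} (h : ColorStep ⟨i, p⟩ c d) :
    ∃ a c' d', c = a ++ c' ∧ d = a ++ d' ∧ a.length = i ∧ ColorStep ⟨0, p⟩ c' d' := by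
  induction i generalizing c d with
  | zero => exact ⟨[], c, d, rfl, rfl, rfl, h⟩
  | succ i ih =>
    obtain ⟨g, c', d', rfl, rfl, h'⟩ := colorStep_succ.1 h
    obtain ⟨a, c', d', rfl, rfl, ha, h0⟩ := ih h'
    exact ⟨g :: a, c', d', rfl, rfl, by simp [ha], h0⟩

theorem ColorStep.length {x : Slice} {c d : List G} (h : ColorStep x c d) :
    d.length + x.piece.dom = c.length + x.piece.cod := by
  induction h with
  | succ g h ih => simp only [List.length_cons] at ih ⊢; omega
  | _ => simp [Piece.dom, Piece.cod]

/-- `Coloring w c c' C` means that there is a colouring of the stack `w` of slices, with the colours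
`c` at the bottom and `c'` at the top, in which `C` is the set of all colours. -/
def Coloring : List Slice → List G → List G → Set G → Prop
  | [], c, c', C => c' = c ∧ C = {g | g ∈ c}
  | x :: w, c, c', C => ∃ d C', ColorStep x c d ∧ Coloring w d c' C' ∧ C = {g | g ∈ c} ∪ C'

theorem Coloring.bottom_subset {w : List Slice} {c c' : List G} {C : Set G}
    (h : Coloring w c c' C) : {g | g ∈ c} ⊆ C := by
  cases w with
  | nil => exact h.2.ge
  | cons x w =>
    obtain ⟨d, C', -, -, rfl⟩ := h
    exact Set.subset_union_left

theorem coloring_append {u w : List Slice} {c c' : List G} {C : Set G} :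
    Coloring (u ++ w) c c' C ↔
      ∃ d C₁ C₂, Coloring u c d C₁ ∧ Coloring w d c' C₂ ∧ C = C₁ ∪ C₂ := by
  induction u generalizing c C with
  | nil =>
    constructor
    · intro h
      exact ⟨c, _, C, ⟨rfl, rfl⟩, h, (Set.union_eq_right.2 h.bottom_subset).symm⟩
    · rintro ⟨d, C₁, C₂, ⟨rfl, rfl⟩, h, rfl⟩
      rwa [Set.union_eq_right.2 h.bottom_subset]
  | cons x u ih =>
    constructor
    · rintro ⟨d, C', hx, h, rfl⟩
      obtain ⟨e, C₁, C₂, h1, h2, rfl⟩ := ih.1 h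
      exact ⟨e, _, C₂, ⟨d, C₁, hx, h1, rfl⟩, h2, (Set.union_assoc _ _ _).symm⟩
    · rintro ⟨e, _, C₂, ⟨d, C₁, hx, h1, rfl⟩, h2, rfl⟩
      exact ⟨d, C₁ ∪ C₂, hx, ih.2 ⟨e, C₁, C₂, h1, h2, rfl⟩, Set.union_assoc _ _ _⟩

theorem Coloring.top_subset {w : List Slice} {c c' : List G} {C : Set G}
    (h : Coloring w c c' C) : {g | g ∈ c'} ⊆ C := by
  induction w generalizing c C with
  | nil => exact h.1 ▸ h.2.ge
  | cons x w ih =>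
    obtain ⟨d, C', hx, h, rfl⟩ := h
    exact (ih h).trans Set.subset_union_right

/-- There is a colouring of the stack `w` of slices with the given colours at the bottom and at the
top. -/
def ColorRun (w : List Slice) (c c' : List G) : Prop := ∃ C, Coloring w c c' C

theorem colorRun_nil {c c' : List G} : ColorRun [] c c' ↔ c' = c :=
  ⟨fun ⟨_, h⟩ => h.1, fun h => ⟨_, h, rfl⟩⟩

theorem colorRun_cons {x : Slice} {w : List Slice} {c c' : List G} :
    ColorRun (x :: w) c c' ↔ ∃ d, ColorStep x c d ∧ ColorRun w d c' :=
  ⟨fun ⟨_, d, C', hx, h, _⟩ => ⟨d, hx, C', h⟩, fun ⟨d, hx, C', h⟩ => ⟨_, d, C', hx, h, rfl⟩⟩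

theorem colorRun_shift {w : List Slice} (hw : w ≠ []) {c c' : List G} :
    ColorRun (w.map Slice.shift) c c' ↔
      ∃ g d d', c = g :: d ∧ c' = g :: d' ∧ ColorRun w d d' := by
  induction w generalizing c with
  | nil => exact absurd rfl hw
  | cons x w ih =>
    simp only [List.map_cons, colorRun_cons, Slice.shift, colorStep_succ]
    rcases eq_or_ne w [] with rfl | hw
    · simp only [List.map_nil, colorRun_nil]
      constructor
      · rintro ⟨_, ⟨g, d, d', rfl, rfl, h⟩, rfl⟩
        exact ⟨g, d, d', rfl, rfl, d', h, rfl⟩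
      · rintro ⟨g, d, d', rfl, rfl, _, h, rfl⟩
        exact ⟨_, ⟨g, d, _, rfl, rfl, h⟩, rfl⟩
    · simp only [ih hw]
      constructor
      · rintro ⟨_, ⟨g, d, d', rfl, rfl, h⟩, _, _, e, h1, rfl, h'⟩
        cases h1
        exact ⟨_, d, e, rfl, rfl, d', h, h'⟩
      · rintro ⟨g, d, d', rfl, rfl, e, h, h'⟩
        exact ⟨_, ⟨g, d, e, rfl, rfl, h⟩, g, e, d', rfl, rfl, h'⟩

/-- Relations between colourings of stacks at the position `i` have to be checked only at the left
end. -/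
theorem colorRun_congr_of_shift {l r : ℕ → List Slice}
    (hl : ∀ i, l (i + 1) = (l i).map Slice.shift) (hr : ∀ i, r (i + 1) = (r i).map Slice.shift)
    (hl0 : ∀ i, l i ≠ []) (hr0 : ∀ i, r i ≠ [])
    (h0 : ∀ c c' : List G, ColorRun (l 0) c c' ↔ ColorRun (r 0) c c')
    (i : ℕ) (c c' : List G) : ColorRun (l i) c c' ↔ ColorRun (r i) c c' := by
  induction i generalizing c c' with
  | zero => exact h0 c c'
  | succ i ih => rw [hl, hr, colorRun_shift (hl0 i), colorRun_shift (hr0 i)]; simp only [ih]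

theorem colorRun_nil_of_shift {l : ℕ → List Slice}
    (hl : ∀ i, l (i + 1) = (l i).map Slice.shift) (hl0 : ∀ i, l i ≠ []) {m : ℕ}
    (h0 : ∀ c c' : List G, m ≤ c.length → (ColorRun (l 0) c c' ↔ c' = c))
    (i : ℕ) {c c' : List G} (hc : i + m ≤ c.length) : ColorRun (l i) c c' ↔ c' = c := by
  induction i generalizing c c' with
  | zero => exact h0 c c' (by omega)
  | succ i ih =>
    rw [hl, colorRun_shift (hl0 i)]
    rcases c with _ | ⟨g, c⟩
    · simp at hc
    · rw [List.length_cons] at hc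
      constructor
      · rintro ⟨_, d, d', h, rfl, h'⟩
        cases h
        rw [(ih (by omega)).1 h']
      · rintro rfl
        exact ⟨g, c, c, rfl, rfl, (ih (by omega)).2 rfl⟩

theorem colorRun_far (i k : ℕ) (p q : Piece) (c c' : List G) :
    ColorRun [⟨i + p.dom + k, q⟩, ⟨i, p⟩] c c' ↔ ColorRun [⟨i, p⟩, ⟨i + p.cod + k, q⟩] c c' := by
  refine colorRun_congr_of_shift (l := fun i => [⟨i + p.dom + k, q⟩, ⟨i, p⟩])
    (r := fun i => [⟨i, p⟩, ⟨i + p.cod + k, q⟩]) (fun i => ?_) (fun i => ?_) (by simp) (by simp)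
    (fun c c' => ?_) i c c'
  · simp [Slice.shift]; omega
  · simp [Slice.shift]; omega
  have e2 : 2 + k = k + 1 + 1 := by omega
  cases p with
  | cup up =>
    simp only [Piece.dom, Piece.cod, zero_add, e2, colorRun_cons, colorRun_nil, colorStep_cup,
      colorStep_succ]
    constructor
    · rintro ⟨d, h, _, ⟨g, rfl⟩, rfl⟩
      exact ⟨_, ⟨g, rfl⟩, _, ⟨g, _, _, rfl, rfl, _, _, _, rfl, rfl, h⟩, rfl⟩
    · rintro ⟨_, ⟨g, rfl⟩, _, ⟨_, _, _, h1, rfl, _, _, _, rfl, rfl, h⟩, rfl⟩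
      cases h1
      exact ⟨_, h, _, ⟨g, rfl⟩, rfl⟩
  | cap =>
    simp only [Piece.dom, Piece.cod, zero_add, e2, colorRun_cons, colorRun_nil, colorStep_cap,
      colorStep_succ]
    constructor
    · rintro ⟨_, ⟨g, _, _, rfl, rfl, g', _, _, rfl, rfl, h⟩, _, ⟨_, h1⟩, rfl⟩
      cases h1
      exact ⟨_, ⟨g, rfl⟩, _, h, rfl⟩
    · rintro ⟨_, ⟨g, rfl⟩, d, h, rfl⟩
      exact ⟨_, ⟨g, _, _, rfl, rfl, _, _, _, rfl, rfl, h⟩, _, ⟨g, rfl⟩, rfl⟩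
  | cross e =>
    simp only [Piece.dom, Piece.cod, zero_add, e2, colorRun_cons, colorRun_nil, colorStep_cross,
      colorStep_succ]
    constructor
    · rintro ⟨_, ⟨a, _, _, rfl, rfl, b, _, _, rfl, rfl, h⟩, _, ⟨_, _, _, h1, rfl⟩, rfl⟩
      cases h1
      exact ⟨_, ⟨a, b, _, rfl, rfl⟩, _, ⟨_, _, _, rfl, rfl, _, _, _, rfl, rfl, h⟩, rfl⟩
    · rintro ⟨_, ⟨a, b, r, rfl, rfl⟩, _, ⟨_, _, _, h1, rfl, _, _, _, rfl, rfl, h⟩, rfl⟩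
      cases h1
      exact ⟨_, ⟨a, _, _, rfl, rfl, b, _, _, rfl, rfl, h⟩, _, ⟨_, _, _, rfl, rfl⟩, rfl⟩

theorem colorRun_slideCup (i : ℕ) (up e : Bool) (c c' : List G) :
    ColorRun [⟨i, .cup up⟩, ⟨i + 1, .cross e⟩] c c' ↔
      ColorRun [⟨i + 1, .cup up⟩, ⟨i, .cross (!e)⟩] c c' := by
  refine colorRun_congr_of_shift (l := fun i => [⟨i, .cup up⟩, ⟨i + 1, .cross e⟩])
    (r := fun i => [⟨i + 1, .cup up⟩, ⟨i, .cross (!e)⟩]) (fun i => rfl) (fun i => rfl) (by simp)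
    (by simp) (fun c c' => ?_) i c c'
  simp only [colorRun_cons, colorRun_nil, colorStep_cup, colorStep_cross, colorStep_succ]
  constructor
  · rintro ⟨_, ⟨g, rfl⟩, _, ⟨_, _, _, h1, rfl, _, b, r, rfl, rfl⟩, rfl⟩
    cases h1
    cases e
    · exact ⟨_, ⟨b, r, _, rfl, rfl, b⁻¹ * g * b, rfl⟩, _, ⟨_, _, _, rfl, rfl⟩, by simp [mul_assoc]⟩
    · exact ⟨_, ⟨b, r, _, rfl, rfl, g, rfl⟩, _, ⟨_, _, _, rfl, rfl⟩, by simp [mul_assoc]⟩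
  · rintro ⟨_, ⟨b, r, _, rfl, rfl, g, rfl⟩, _, ⟨_, _, _, h1, rfl⟩, rfl⟩
    cases h1
    cases e
    · exact ⟨_, ⟨b * g * b⁻¹, rfl⟩, _, ⟨_, _, _, rfl, rfl, _, _, _, rfl, rfl⟩,
        by simp [mul_assoc]⟩
    · exact ⟨_, ⟨g, rfl⟩, _, ⟨_, _, _, rfl, rfl, _, _, _, rfl, rfl⟩, by simp [mul_assoc]⟩

theorem colorRun_slideCap (i : ℕ) (e : Bool) (c c' : List G) :
    ColorRun [⟨i + 1, .cross e⟩, ⟨i, .cap⟩] c c' ↔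
      ColorRun [⟨i, .cross (!e)⟩, ⟨i + 1, .cap⟩] c c' := by
  refine colorRun_congr_of_shift (l := fun i => [⟨i + 1, .cross e⟩, ⟨i, .cap⟩])
    (r := fun i => [⟨i, .cross (!e)⟩, ⟨i + 1, .cap⟩]) (fun i => rfl) (fun i => rfl) (by simp)
    (by simp) (fun c c' => ?_) i c c'
  simp only [colorRun_cons, colorRun_nil, colorStep_cap, colorStep_cross, colorStep_succ]
  constructor
  · rintro ⟨_, ⟨x, _, _, rfl, rfl, a, b, r, rfl, rfl⟩, _, ⟨g, h1⟩, rfl⟩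
    rw [List.cons.injEq, List.cons.injEq] at h1
    obtain ⟨rfl, h1, rfl⟩ := h1
    refine ⟨_, ⟨x, a, b :: r, rfl, rfl⟩, _,
      ⟨_, _, r, rfl, rfl, if !e then x else a⁻¹ * x * a, ?_⟩, ?_⟩
    · cases e
      · simp only [Bool.false_eq_true, if_false] at h1
        simp [h1]
      · simp only [if_true] at h1
        simp only [Bool.not_true, Bool.false_eq_true, if_false]
        have h3 : b = a⁻¹ * (a * b * a⁻¹) * a := by group
        rw [h3, h1]
        simp [mul_assoc]
    · cases e
      · simp only [Bool.false_eq_true, if_false] at h1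
        simp [h1]
      · simp
  · rintro ⟨_, ⟨x, a, _, rfl, rfl⟩, _, ⟨_, _, _, h1, rfl, g, rfl⟩, rfl⟩
    cases h1
    refine ⟨_, ⟨x, _, _, rfl, rfl, a, _, _, rfl, rfl⟩, _, ⟨x, ?_⟩, rfl⟩
    cases e <;> simp [mul_assoc]

theorem colorRun_reidemeister1Cup (i : ℕ) (up e : Bool) (c c' : List G) :
    ColorRun [⟨i, .cup up⟩, ⟨i, .cross e⟩] c c' ↔ ColorRun [⟨i, .cup (!up)⟩] c c' := by
  refine colorRun_congr_of_shift (l := fun i => [⟨i, .cup up⟩, ⟨i, .cross e⟩])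
    (r := fun i => [⟨i, .cup (!up)⟩]) (fun i => rfl) (fun i => rfl) (by simp)
    (by simp) (fun c c' => ?_) i c c'
  simp only [colorRun_cons, colorRun_nil, colorStep_cup, colorStep_cross]
  constructor
  · rintro ⟨_, ⟨g, rfl⟩, _, ⟨_, _, _, h1, rfl⟩, rfl⟩
    cases h1
    exact ⟨_, ⟨g⁻¹, rfl⟩, by cases e <;> simp⟩
  · rintro ⟨_, ⟨g, rfl⟩, rfl⟩
    exact ⟨_, ⟨g⁻¹, rfl⟩, _, ⟨_, _, _, rfl, rfl⟩, by cases e <;> simp⟩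

theorem colorRun_reidemeister1Cap (i : ℕ) (e : Bool) (c c' : List G) :
    ColorRun [⟨i, .cross e⟩, ⟨i, .cap⟩] c c' ↔ ColorRun [⟨i, .cap⟩] c c' := by
  refine colorRun_congr_of_shift (l := fun i => [⟨i, .cross e⟩, ⟨i, .cap⟩])
    (r := fun i => [⟨i, .cap⟩]) (fun i => rfl) (fun i => rfl) (by simp)
    (by simp) (fun c c' => ?_) i c c'
  simp only [colorRun_cons, colorRun_nil, colorStep_cap, colorStep_cross]
  constructor
  · rintro ⟨_, ⟨a, b, r, rfl, rfl⟩, _, ⟨g, h1⟩, rfl⟩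
    rw [List.cons.injEq, List.cons.injEq] at h1
    obtain ⟨h1, h2, rfl⟩ := h1
    refine ⟨_, ⟨a, ?_⟩, rfl⟩
    cases e
    · simp only [Bool.false_eq_true, if_false] at h1 h2
      have h3 : a = b * (b⁻¹ * a * b) * b⁻¹ := by group
      rw [h2, h1] at h3
      rw [h1, h3]
      simp
    · simp only [if_true] at h1 h2
      have h3 : b = a⁻¹ * (a * b * a⁻¹) * a := by group
      rw [h1, h2] at h3
      rw [h2, h3]
      simp
  · rintro ⟨_, ⟨g, rfl⟩, rfl⟩
    refine ⟨_, ⟨_, _, _, rfl, rfl⟩, _, ⟨g⁻¹, ?_⟩, rfl⟩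
    cases e <;> simp

theorem colorRun_reidemeister3 (i : ℕ) (a b d : Bool) (h : a = b ∨ b = d) (c c' : List G) :
    ColorRun [⟨i, .cross a⟩, ⟨i + 1, .cross b⟩, ⟨i, .cross d⟩] c c' ↔
      ColorRun [⟨i + 1, .cross d⟩, ⟨i, .cross b⟩, ⟨i + 1, .cross a⟩] c c' := by
  refine colorRun_congr_of_shift
    (l := fun i => [⟨i, .cross a⟩, ⟨i + 1, .cross b⟩, ⟨i, .cross d⟩])
    (r := fun i => [⟨i + 1, .cross d⟩, ⟨i, .cross b⟩, ⟨i + 1, .cross a⟩]) (fun i => rfl)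
    (fun i => rfl) (by simp) (by simp) (fun c c' => ?_) i c c'
  simp only [colorRun_cons, colorRun_nil, colorStep_succ, colorStep_cross]
  constructor
  · rintro ⟨_, ⟨x, y, _, rfl, rfl⟩, _, ⟨_, _, _, h1, rfl, _, z, r, rfl, rfl⟩, _,
      ⟨_, _, _, h2, rfl⟩, rfl⟩
    cases h1
    cases h2
    refine ⟨_, ⟨_, _, _, rfl, rfl, _, _, _, rfl, rfl⟩, _, ⟨_, _, _, rfl, rfl⟩, _,
      ⟨_, _, _, rfl, rfl, _, _, _, rfl, rfl⟩, ?_⟩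
    cases a <;> cases b <;> cases d <;> simp [mul_assoc] at h ⊢
  · rintro ⟨_, ⟨x, _, _, rfl, rfl, y, z, r, rfl, rfl⟩, _, ⟨_, _, _, h1, rfl⟩, _,
      ⟨_, _, _, h2, rfl, _, _, _, rfl, rfl⟩, rfl⟩
    cases h1
    cases h2
    refine ⟨_, ⟨_, _, _, rfl, rfl⟩, _, ⟨_, _, _, rfl, rfl, _, _, _, rfl, rfl⟩, _,
      ⟨_, _, _, rfl, rfl⟩, ?_⟩
    cases a <;> cases b <;> cases d <;> simp [mul_assoc] at h ⊢

theorem colorRun_zigzag (i : ℕ) (up : Bool) {c c' : List G} (hc : i + 1 ≤ c.length) :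
    ColorRun [⟨i, .cup up⟩, ⟨i + 1, .cap⟩] c c' ↔ c' = c := by
  refine colorRun_nil_of_shift (l := fun i => [⟨i, .cup up⟩, ⟨i + 1, .cap⟩]) (fun i => rfl)
    (by simp) (fun c c' hc => ?_) i hc
  simp only [colorRun_cons, colorRun_nil, colorStep_cup, colorStep_cap, colorStep_succ]
  constructor
  · rintro ⟨_, ⟨g, rfl⟩, _, ⟨_, _, d, h1, rfl, g', rfl⟩, rfl⟩
    cases h1
    simp
  · rintro rfl
    rcases c' with _ | ⟨g, c⟩
    · simp at hc
    · exact ⟨_, ⟨g, rfl⟩, _, ⟨_, _, _, rfl, rfl, g⁻¹, by simp⟩, rfl⟩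

theorem colorRun_zigzag' (i : ℕ) (up : Bool) {c c' : List G} (hc : i + 1 ≤ c.length) :
    ColorRun [⟨i + 1, .cup up⟩, ⟨i, .cap⟩] c c' ↔ c' = c := by
  refine colorRun_nil_of_shift (l := fun i => [⟨i + 1, .cup up⟩, ⟨i, .cap⟩]) (fun i => rfl)
    (by simp) (fun c c' hc => ?_) i hc
  simp only [colorRun_cons, colorRun_nil, colorStep_cup, colorStep_cap, colorStep_succ]
  constructor
  · rintro ⟨_, ⟨x, d, _, rfl, rfl, g, rfl⟩, _, ⟨_, h1⟩, rfl⟩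
    cases h1
    simp
  · rintro rfl
    rcases c' with _ | ⟨g, c⟩
    · simp at hc
    · exact ⟨_, ⟨g, c, _, rfl, rfl, g⁻¹, rfl⟩, _, ⟨g, by simp⟩, rfl⟩

theorem colorRun_reidemeister2 (i : ℕ) (e : Bool) {c c' : List G} (hc : i + 2 ≤ c.length) :
    ColorRun [⟨i, .cross e⟩, ⟨i, .cross (!e)⟩] c c' ↔ c' = c := by
  refine colorRun_nil_of_shift (l := fun i => [⟨i, .cross e⟩, ⟨i, .cross (!e)⟩]) (fun i => rfl)
    (by simp) (fun c c' hc => ?_) i hc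
  simp only [colorRun_cons, colorRun_nil, colorStep_cross]
  constructor
  · rintro ⟨_, ⟨a, b, r, rfl, rfl⟩, _, ⟨_, _, _, h1, rfl⟩, rfl⟩
    cases h1
    cases e <;> simp [mul_assoc]
  · rintro rfl
    rcases c' with _ | ⟨a, _ | ⟨b, r⟩⟩
    · simp at hc
    · simp at hc
    · exact ⟨_, ⟨a, b, r, rfl, rfl⟩, _, ⟨_, _, _, rfl, rfl⟩, by cases e <;> simp [mul_assoc]⟩

/-- The colourings of the two sides of a move with given colours at the bottom and at the top
correspond to each other. -/
theorem Move.colorRun_iff {l r : List Slice} (m : Move l r) {o o' : List Bool}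
    (h : run l o = some o') {c c' : List G} (hc : c.length = o.length) :
    ColorRun l c c' ↔ ColorRun r c c' := by
  cases m with
  | far i k p q => exact colorRun_far i k p q c c'
  | slideCup i up e => exact colorRun_slideCup i up e c c'
  | slideCap i e => exact colorRun_slideCap i e c c'
  | reidemeister1Cup i up e => exact colorRun_reidemeister1Cup i up e c c'
  | reidemeister1Cap i e => exact colorRun_reidemeister1Cap i e c c'
  | reidemeister3 i a b d hab => exact colorRun_reidemeister3 i a b d hab c c'
  | zigzag i up =>
    obtain ⟨o1, h1, h2⟩ := Option.bind_eq_some_iff.1 h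
    obtain ⟨o2, h3, -⟩ := Option.bind_eq_some_iff.1 h2
    have a1 := le_length_of_step h1
    have a2 := le_length_of_step h3
    simp only [Piece.dom, Piece.cod] at a1 a2
    rw [colorRun_nil]
    exact colorRun_zigzag i up (by omega)
  | zigzag' i up =>
    obtain ⟨o1, h1, h2⟩ := Option.bind_eq_some_iff.1 h
    have a1 := le_length_of_step h1
    simp only [Piece.dom, Piece.cod] at a1
    rw [colorRun_nil]
    exact colorRun_zigzag' i up (by omega)
  | reidemeister2 i e =>
    obtain ⟨o1, h1, h2⟩ := Option.bind_eq_some_iff.1 h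
    have a1 := le_length_of_step h1
    simp only [Piece.dom, Piece.cod] at a1
    rw [colorRun_nil]
    exact colorRun_reidemeister2 i e (by omega)

end Colorings
/-! ### The colours that generate a colouring -/

section Colorings
variable {G : Type} [Group G]

/-- A set of group elements that is closed under inversion and under conjugation by its elements. -/
structure ConjClosed (K : Set G) : Prop where
  inv_mem : ∀ {a : G}, a ∈ K → a⁻¹ ∈ K
  conj_mem : ∀ {a b : G}, a ∈ K → b ∈ K → a * b * a⁻¹ ∈ K

theorem ConjClosed.conj_mem' {K : Set G} (hK : ConjClosed K) {a b : G} (ha : a ∈ K) (hb : b ∈ K) :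
    a⁻¹ * b * a ∈ K := by
  simpa using hK.conj_mem (hK.inv_mem ha) hb

/-- The smallest conjugation closed set that contains `C`. -/
def conjClosure (C : Set G) : Set G := ⋂₀ {K | ConjClosed K ∧ C ⊆ K}

theorem conjClosure_subset_iff {C K : Set G} (hK : ConjClosed K) : conjClosure C ⊆ K ↔ C ⊆ K :=
  ⟨fun h => (Set.subset_sInter fun _ hL => hL.2).trans h, fun h => Set.sInter_subset_of_mem ⟨hK, h⟩⟩

theorem conjClosure_congr {C C' : Set G} (h : ∀ K : Set G, ConjClosed K → (C ⊆ K ↔ C' ⊆ K)) :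
    conjClosure C = conjClosure C' := by
  rw [conjClosure, conjClosure]
  congr 1
  ext K
  exact and_congr_right (h K)

theorem ColorStep.subset_above {K : Set G} (hK : ConjClosed K) {x : Slice} {c d : List G}
    (h : ColorStep x c d) (hx : ∀ up, x.piece ≠ .cup up) (hc : ∀ g ∈ c, g ∈ K) : ∀ g ∈ d, g ∈ K := by
  induction h with
  | cup up g c => exact absurd rfl (hx up)
  | cap g c => exact fun a ha => hc a (by simp [ha])
  | overpass a b c =>
    simp only [List.mem_cons, forall_eq_or_imp] at hc ⊢
    exact ⟨hK.conj_mem hc.1 hc.2.1, hc.1, hc.2.2⟩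
  | underpass a b c =>
    simp only [List.mem_cons, forall_eq_or_imp] at hc ⊢
    exact ⟨hc.2.1, hK.conj_mem' hc.2.1 hc.1, hc.2.2⟩
  | succ g h ih =>
    simp only [List.mem_cons, forall_eq_or_imp] at hc ⊢
    exact ⟨hc.1, ih hx hc.2⟩

theorem ColorStep.subset_below {K : Set G} (hK : ConjClosed K) {x : Slice} {c d : List G}
    (h : ColorStep x c d) (hx : x.piece ≠ .cap) (hd : ∀ g ∈ d, g ∈ K) : ∀ g ∈ c, g ∈ K := by
  induction h with
  | cup up g c => exact fun a ha => hd a (by simp [ha])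
  | cap g c => exact absurd rfl hx
  | overpass a b c =>
    simp only [List.mem_cons, forall_eq_or_imp] at hd ⊢
    refine ⟨hd.2.1, ?_, hd.2.2⟩
    have := hK.conj_mem' hd.2.1 hd.1
    simpa [mul_assoc] using this
  | underpass a b c =>
    simp only [List.mem_cons, forall_eq_or_imp] at hd ⊢
    refine ⟨?_, hd.1, hd.2.2⟩
    have := hK.conj_mem hd.1 hd.2.1
    simpa [mul_assoc] using this
  | succ g h ih =>
    simp only [List.mem_cons, forall_eq_or_imp] at hd ⊢
    exact ⟨hd.1, ih hx hd.2⟩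

/-- Without minima, the colours at the bottom generate all the others. -/
theorem Coloring.subset_of_bottom {K : Set G} (hK : ConjClosed K) {w : List Slice} {c c' : List G}
    {C : Set G} (h : Coloring w c c' C) (hw : ∀ x ∈ w, ∀ up, x.piece ≠ .cup up)
    (hc : ∀ g ∈ c, g ∈ K) : C ⊆ K := by
  induction w generalizing c C with
  | nil =>
    obtain ⟨rfl, rfl⟩ := h
    exact hc
  | cons x w ih =>
    obtain ⟨d, C', hx, h, rfl⟩ := h
    exact Set.union_subset hc (ih h (fun y hy => hw y (by simp [hy]))
      (hx.subset_above hK (hw x (by simp)) hc))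

/-- In every colouring of the stack `w`, the colours at the bottom and at the top generate all the
colours. -/
def Tame (w : List Slice) : Prop :=
  ∀ (G : Type) [Group G] (K : Set G), ConjClosed K → ∀ (c c' : List G) (C : Set G), Coloring w c c' C →
    (∀ g ∈ c, g ∈ K) → (∀ g ∈ c', g ∈ K) → C ⊆ K

end Colorings

section Tame

theorem tame_of_forall_ne_cup {w : List Slice} (hw : ∀ x ∈ w, ∀ up, x.piece ≠ .cup up) : Tame w :=
  fun _ _ _ hK _ _ _ h hc _ => h.subset_of_bottom hK hw hc

theorem tame_singleton (x : Slice) : Tame [x] := by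
  rintro G _ K hK c c' C ⟨d, _, hx, ⟨rfl, rfl⟩, rfl⟩ hc hc'
  exact Set.union_subset hc hc'

theorem tame_pair {x y : Slice} (h : (∀ up, x.piece ≠ .cup up) ∨ y.piece ≠ .cap) : Tame [x, y] := by
  rintro G _ K hK c c' C ⟨d, _, hx, ⟨_, _, hy, ⟨rfl, rfl⟩, rfl⟩, rfl⟩ hc hc'
  refine Set.union_subset hc (Set.union_subset ?_ hc')
  rcases h with h | h
  · exact hx.subset_above hK h hc
  · exact hy.subset_below hK h hc'

/-- The colours of the two legs of the extremum occur on the straightened strand. -/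
theorem tame_zigzag (i : ℕ) (up : Bool) : Tame [⟨i, .cup up⟩, ⟨i + 1, .cap⟩] := by
  rintro G _ K hK c c' C ⟨d, _, hx, ⟨_, _, hy, ⟨rfl, rfl⟩, rfl⟩, rfl⟩ hc hc'
  refine Set.union_subset hc (Set.union_subset (fun g hg => ?_) hc')
  obtain ⟨a, c, _, rfl, rfl, ha, h1⟩ := hx.exists_append
  obtain ⟨g', rfl⟩ := colorStep_cup.1 h1
  obtain ⟨b, _, d', h2, rfl, hb, h3⟩ := hy.exists_append
  obtain ⟨g'', rfl⟩ := colorStep_cap.1 h3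
  obtain ⟨b, e, rfl⟩ : ∃ b' e, b = b' ++ [e] :=
    ⟨_, _, (List.dropLast_append_getLast (List.ne_nil_of_length_pos (by omega))).symm⟩
  rw [List.append_assoc] at h2
  obtain ⟨rfl, h4⟩ := List.append_inj h2 (by simp at hb; omega)
  simp only [List.cons_append, List.nil_append, List.cons.injEq] at h4
  obtain ⟨rfl, rfl, rfl⟩ := h4
  simp only [List.mem_append, List.mem_cons, inv_inv, Set.mem_ofPred_eq] at hg hc
  have := hK.inv_mem (hc g' (by simp))
  grind

theorem tame_zigzag' (i : ℕ) (up : Bool) : Tame [⟨i + 1, .cup up⟩, ⟨i, .cap⟩] := by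
  rintro G _ K hK c c' C ⟨d, _, hx, ⟨_, _, hy, ⟨rfl, rfl⟩, rfl⟩, rfl⟩ hc hc'
  refine Set.union_subset hc (Set.union_subset (fun g hg => ?_) hc')
  obtain ⟨a, c, _, rfl, rfl, ha, h1⟩ := hx.exists_append
  obtain ⟨g', rfl⟩ := colorStep_cup.1 h1
  obtain ⟨b, _, d', h2, rfl, hb, h3⟩ := hy.exists_append
  obtain ⟨g'', rfl⟩ := colorStep_cap.1 h3
  obtain ⟨a, e, rfl⟩ : ∃ a' e, a = a' ++ [e] :=
    ⟨_, _, (List.dropLast_append_getLast (List.ne_nil_of_length_pos (by omega))).symm⟩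
  rw [List.append_assoc] at h2
  obtain ⟨rfl, h4⟩ := List.append_inj h2 (by simp at ha; omega)
  simp only [List.cons_append, List.nil_append, List.cons.injEq] at h4
  obtain ⟨rfl, rfl, rfl⟩ := h4
  simp only [List.mem_append, List.mem_cons, inv_inv, Set.mem_ofPred_eq] at hg hc
  have := hK.inv_mem (hc e (by simp))
  grind

/-- The legs of the minimum reach the top level, and those of the maximum the bottom level. -/
theorem tame_cup_cap (i k : ℕ) (up : Bool) : Tame [⟨i, .cup up⟩, ⟨i + 2 + k, .cap⟩] := by
  rintro G _ K hK c c' C ⟨d, _, hx, ⟨_, _, hy, ⟨rfl, rfl⟩, rfl⟩, rfl⟩ hc hc'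
  refine Set.union_subset hc (Set.union_subset (fun g hg => ?_) hc')
  obtain ⟨a, c, _, rfl, rfl, ha, h1⟩ := hx.exists_append
  obtain ⟨g', rfl⟩ := colorStep_cup.1 h1
  obtain ⟨b, _, d', h2, rfl, hb, h3⟩ := hy.exists_append
  obtain ⟨b1, b2, rfl, hb1⟩ := exists_append_of_le_length (s := b) (i := i) (by omega)
  obtain ⟨e, b2, rfl⟩ := List.exists_cons_of_ne_nil (l := b2)
    (List.ne_nil_of_length_pos (by simp at hb; omega))
  obtain ⟨e', b2, rfl⟩ := List.exists_cons_of_ne_nil (l := b2)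
    (List.ne_nil_of_length_pos (by simp at hb; omega))
  rw [List.append_assoc] at h2
  obtain ⟨rfl, h4⟩ := List.append_inj h2 (by omega)
  simp only [List.cons_append, List.cons.injEq] at h4
  obtain ⟨rfl, rfl, rfl⟩ := h4
  simp only [List.mem_append, List.mem_cons, Set.mem_ofPred_eq] at hg hc hc'
  grind

theorem tame_cup_cap' (i k : ℕ) (up : Bool) : Tame [⟨i + 2 + k, .cup up⟩, ⟨i, .cap⟩] := by
  rintro G _ K hK c c' C ⟨d, _, hx, ⟨_, _, hy, ⟨rfl, rfl⟩, rfl⟩, rfl⟩ hc hc'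
  refine Set.union_subset hc (Set.union_subset (fun g hg => ?_) hc')
  obtain ⟨a, c, _, rfl, rfl, ha, h1⟩ := hx.exists_append
  obtain ⟨g', rfl⟩ := colorStep_cup.1 h1
  obtain ⟨b, _, d', h2, rfl, hb, h3⟩ := hy.exists_append
  obtain ⟨g'', rfl⟩ := colorStep_cap.1 h3
  obtain ⟨b1, b2, rfl, hb1⟩ := exists_append_of_le_length (s := a) (i := i) (by omega)
  obtain ⟨e, b2, rfl⟩ := List.exists_cons_of_ne_nil (l := b2)
    (List.ne_nil_of_length_pos (by simp at ha; omega))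
  obtain ⟨e', b2, rfl⟩ := List.exists_cons_of_ne_nil (l := b2)
    (List.ne_nil_of_length_pos (by simp at ha; omega))
  rw [List.append_assoc] at h2
  obtain ⟨rfl, h4⟩ := List.append_inj h2 (by omega)
  simp only [List.cons_append, List.cons.injEq] at h4
  obtain ⟨rfl, rfl, rfl⟩ := h4
  simp only [List.mem_append, List.mem_cons, Set.mem_ofPred_eq] at hg hc hc'
  grind

/-- No colour is lost in a move: those at the bottom and at the top generate the colours in between.
-/
theorem Move.tame {l r : List Slice} (m : Move l r) : Tame l ∧ Tame r := by
  have hnil : Tame [] := tame_of_forall_ne_cup (by simp)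
  cases m with
  | far i k p q =>
    cases p with
    | cup up =>
      refine ⟨tame_pair (.inr (by simp)), ?_⟩
      cases q with
      | cap => exact tame_cup_cap i k up
      | _ => exact tame_pair (.inr (by simp))
    | cap =>
      refine ⟨?_, tame_pair (.inl (by simp))⟩
      cases q with
      | cup up => exact tame_cup_cap' i k up
      | _ => exact tame_pair (.inl (by simp))
    | cross e => exact ⟨tame_pair (.inr (by simp)), tame_pair (.inl (by simp))⟩
  | zigzag i up => exact ⟨tame_zigzag i up, hnil⟩
  | zigzag' i up => exact ⟨tame_zigzag' i up, hnil⟩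
  | slideCup i up e => exact ⟨tame_pair (.inr (by simp)), tame_pair (.inr (by simp))⟩
  | slideCap i e => exact ⟨tame_pair (.inl (by simp)), tame_pair (.inl (by simp))⟩
  | reidemeister1Cup i up e => exact ⟨tame_pair (.inr (by simp)), tame_singleton _⟩
  | reidemeister1Cap i e => exact ⟨tame_pair (.inl (by simp)), tame_singleton _⟩
  | reidemeister2 i e => exact ⟨tame_pair (.inl (by simp)), hnil⟩
  | reidemeister3 i a b d h =>
    exact ⟨tame_of_forall_ne_cup (by simp), tame_of_forall_ne_cup (by simp)⟩

end Tame

section Images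
variable {G : Type} [Group G]

theorem Coloring.length {w : List Slice} {c c' : List G} {C : Set G} (h : Coloring w c c' C)
    {o o' : List Bool} (hw : run w o = some o') (hc : c.length = o.length) :
    c'.length = o'.length := by
  induction w generalizing c C o with
  | nil =>
    obtain ⟨rfl, -⟩ := h
    cases hw
    exact hc
  | cons x w ih =>
    obtain ⟨d, C', hx, h, rfl⟩ := h
    obtain ⟨o1, h1, h2⟩ := Option.bind_eq_some_iff.1 hw
    have a1 := hx.length
    have a2 := (le_length_of_step h1).2
    exact ih h h2 (by omega)

/-- The sets generated by the colours in the colourings of a diagram by elements of `G`. -/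
def Diagram.images (G : Type) [Group G] (D : Diagram) : Set (Set G) :=
  {S | ∃ C, Coloring D.slices [] [] C ∧ conjClosure C = S}

/-- A part of a diagram can be exchanged if the colours at its bottom and its top allow it, and this
does not change the set that the colours generate. -/
theorem exists_coloring_of_colorRun {u v l r : List Slice} (hl : Tame l) (hr : Tame r) {o : List Bool}
    (hu : run u [] = some o)
    (hlr : ∀ c c' : List G, c.length = o.length → ColorRun l c c' → ColorRun r c c') {C : Set G}
    (h : Coloring (u ++ l ++ v) [] [] C) :
    ∃ C', Coloring (u ++ r ++ v) [] [] C' ∧ conjClosure C' = conjClosure C := by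
  obtain ⟨c', C₀, C₃, h0, h3, rfl⟩ := coloring_append.1 h
  obtain ⟨c, C₁, C₂, h1, h2, rfl⟩ := coloring_append.1 h0
  obtain ⟨C₂', h2'⟩ := hlr c c' (h1.length hu rfl) ⟨C₂, h2⟩
  refine ⟨_, coloring_append.2 ⟨c', _, C₃, coloring_append.2 ⟨c, C₁, C₂', h1, h2', rfl⟩, h3, rfl⟩,
    conjClosure_congr fun K hK => ?_⟩
  simp only [Set.union_subset_iff]
  constructor
  · rintro ⟨⟨a1, -⟩, a3⟩
    exact ⟨⟨a1, hl G K hK c c' C₂ h2 (h1.top_subset.trans a1) (h3.bottom_subset.trans a3)⟩, a3⟩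
  · rintro ⟨⟨a1, -⟩, a3⟩
    exact ⟨⟨a1, hr G K hK c c' C₂' h2' (h1.top_subset.trans a1) (h3.bottom_subset.trans a3)⟩, a3⟩

theorem Diagram.images_eq_of_step {D D' : Diagram} (h : D.Step D') : D.images G = D'.images G := by
  obtain ⟨u, v, l, r, m, hD, hD'⟩ := h
  have hrun := D.closed
  rw [hD, run_append, run_append] at hrun
  obtain ⟨o1, h1, -⟩ := Option.bind_eq_some_iff.1 hrun
  obtain ⟨o, hu, hl⟩ := Option.bind_eq_some_iff.1 h1
  rw [Diagram.images, Diagram.images, hD, hD']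
  ext S
  constructor
  · rintro ⟨C, h, rfl⟩
    exact exists_coloring_of_colorRun m.tame.1 m.tame.2 hu (fun c c' hc => (m.colorRun_iff hl hc).1) h
  · rintro ⟨C, h, rfl⟩
    exact exists_coloring_of_colorRun m.tame.2 m.tame.1 hu (fun c c' hc => (m.colorRun_iff hl hc).2) h

/-- The images of the representations of the link group: the subsets of `G` that are generated, under
conjugation and inversion, by the values of the meridians. -/
def Link.images (G : Type) [Group G] : Link → Set (Set G) :=
  Quot.lift (Diagram.images G) fun _ _ => Diagram.images_eq_of_step

/-! ### Colourings of closed braids -/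

/-- The colours below a closed braid, when the strands of the braid have the colours `L`. -/
def closeUp (L : List G) : List G := L ++ (L.map (·⁻¹)).reverse

theorem closeUp_append_singleton (L : List G) (g : G) :
    closeUp (L ++ [g]) = L ++ g :: g⁻¹ :: (L.map (·⁻¹)).reverse := by
  simp [closeUp]

theorem exists_coloring_nestedCups (L : List G) : ∃ C, Coloring (nestedCups L.length) [] (closeUp L) C := by
  induction L using List.reverseRecOn with
  | nil => exact ⟨_, rfl, rfl⟩
  | append_singleton L g ih =>
    obtain ⟨C, h⟩ := ih
    rw [List.length_append, List.length_singleton, nestedCups_succ, closeUp_append_singleton]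
    exact ⟨_, coloring_append.2 ⟨_, C, _, h, ⟨_, _, (ColorStep.cup true g _).append L rfl, ⟨rfl, rfl⟩,
      rfl⟩, rfl⟩⟩

theorem exists_coloring_nestedCaps (L : List G) : ∃ C, Coloring (nestedCaps L.length) (closeUp L) [] C := by
  induction L using List.reverseRecOn with
  | nil => exact ⟨_, rfl, rfl⟩
  | append_singleton L g ih =>
    obtain ⟨C, h⟩ := ih
    rw [List.length_append, List.length_singleton, nestedCaps_succ, closeUp_append_singleton]
    exact ⟨_, _, C, (ColorStep.cap g _).append L rfl, h, rfl⟩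

/-- A colouring of nested minima is determined by the colours of their left legs. -/
theorem Coloring.nestedCups {n : ℕ} {c : List G} {C : Set G} (h : Coloring (nestedCups n) [] c C) :
    ∃ L : List G, L.length = n ∧ c = closeUp L ∧
      ∀ K : Set G, ConjClosed K → (∀ g ∈ L, g ∈ K) → C ⊆ K := by
  induction n generalizing c C with
  | zero =>
    obtain ⟨rfl, rfl⟩ := h
    exact ⟨[], rfl, rfl, fun K _ _ => by simp⟩
  | succ n ih =>
    rw [nestedCups_succ] at h
    obtain ⟨d, C₁, _, h1, ⟨_, _, hx, ⟨rfl, rfl⟩, rfl⟩, rfl⟩ := coloring_append.1 h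
    obtain ⟨L, hL, rfl, hC⟩ := ih h1
    obtain ⟨a, b, _, h2, rfl, ha, h3⟩ := hx.exists_append
    obtain ⟨g, rfl⟩ := colorStep_cup.1 h3
    obtain ⟨rfl, rfl⟩ := List.append_inj h2 (by omega)
    refine ⟨L ++ [g], by simp [hL], (closeUp_append_singleton L g).symm, fun K hK hg => ?_⟩
    have h4 := hC K hK fun g hg' => hg g (by simp [hg'])
    have h5 := h1.top_subset.trans h4
    have h6 := hg g (by simp)
    refine Set.union_subset h4 (Set.union_subset h5 fun x hx => ?_)
    rw [Set.mem_ofPred_eq, List.mem_append, List.mem_cons, List.mem_cons] at hx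
    rcases hx with hx | rfl | rfl | hx
    · exact hg x (by simp [hx])
    · exact h6
    · exact hK.inv_mem h6
    · exact h5 (by simp only [closeUp, Set.mem_ofPred_eq, List.mem_append]; exact .inr hx)

/-- The colours in a coloured closed braid on `n` strands are generated by `n` of them. -/
theorem exists_generators_of_closure {n : ℕ} (β : BraidWord n) {S : Set G}
    (hS : S ∈ β.closure.images G) :
    ∃ L : List G, L.length = n ∧ (∀ g ∈ L, g ∈ S) ∧
      ∀ K : Set G, ConjClosed K → (∀ g ∈ L, g ∈ K) → S ⊆ K := by
  obtain ⟨C, h, rfl⟩ : ∃ C, Coloring β.closureDiagram.slices [] [] C ∧ conjClosure C = S := hS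
  have hsub : C ⊆ conjClosure C := Set.subset_sInter fun _ hL => hL.2
  rw [show β.closureDiagram.slices = LinkTheory.nestedCups n ++ (β.crossings ++ nestedCaps n) from
    List.append_assoc _ _ _] at h
  obtain ⟨c, C₁, C₂, h1, h2, rfl⟩ := coloring_append.1 h
  obtain ⟨L, hL, rfl, hC⟩ := h1.nestedCups
  refine ⟨L, hL, fun g hg => hsub (.inl (h1.top_subset ?_)), fun K hK hg => ?_⟩
  · simp [closeUp, hg]
  · rw [conjClosure_subset_iff hK]
    have h3 := hC K hK hg
    refine Set.union_subset h3 (h2.subset_of_bottom hK (fun x hx => ?_) (h1.top_subset.trans h3))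
    rw [List.mem_append] at hx
    rcases hx with hx | hx
    · obtain ⟨g, -, rfl⟩ := List.mem_map.1 hx
      simp
    · obtain ⟨g, -, rfl⟩ := List.mem_map.1 hx
      simp

end Images
/-! ### Pseudoreflections and the number of strands -/

section Pseudoreflections
variable {V : Type} [AddCommGroup V] [Module ℂ V]

/-- Invertible linear maps that differ from the identity by a map of rank at most one. -/
def pseudoreflections (V : Type) [AddCommGroup V] [Module ℂ V] : Set (Module.End ℂ V)ˣ :=
  {g | ∃ (φ : V →ₗ[ℂ] ℂ) (w : V), ∀ v, (g : Module.End ℂ V) v = v + φ v • w}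

theorem units_inv_apply (g : (Module.End ℂ V)ˣ) (v : V) :
    ((g⁻¹ : (Module.End ℂ V)ˣ) : Module.End ℂ V) ((g : Module.End ℂ V) v) = v := by
  rw [← Module.End.mul_apply, Units.inv_mul, Module.End.one_apply]

theorem units_apply_inv (g : (Module.End ℂ V)ˣ) (v : V) :
    (g : Module.End ℂ V) (((g⁻¹ : (Module.End ℂ V)ˣ) : Module.End ℂ V) v) = v := by
  rw [← Module.End.mul_apply, Units.mul_inv, Module.End.one_apply]

theorem conj_mem_pseudoreflections {g : (Module.End ℂ V)ˣ} (hg : g ∈ pseudoreflections V)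
    (h : (Module.End ℂ V)ˣ) : h * g * h⁻¹ ∈ pseudoreflections V := by
  obtain ⟨φ, w, hg⟩ := hg
  refine ⟨φ ∘ₗ (h⁻¹ : (Module.End ℂ V)ˣ).1, h.1 w, fun v => ?_⟩
  simp only [Units.val_mul, Module.End.mul_apply, hg, map_add, map_smul, units_apply_inv,
    LinearMap.comp_apply]

theorem conjClosed_pseudoreflections : ConjClosed (pseudoreflections V) where
  inv_mem := by
    rintro g ⟨φ, w, hg⟩
    refine ⟨-φ, (g⁻¹ : (Module.End ℂ V)ˣ).1 w, fun v => ?_⟩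
    have h := congrArg (g⁻¹ : (Module.End ℂ V)ˣ).1 (hg v)
    rw [units_inv_apply, map_add, map_smul] at h
    rw [LinearMap.neg_apply, neg_smul, eq_comm, ← sub_eq_add_neg, sub_eq_iff_eq_add]
    exact h
  conj_mem := fun {a _} _ hb => conj_mem_pseudoreflections hb a

theorem conjClosed_fixing (v : V) : ConjClosed {g : (Module.End ℂ V)ˣ | (g : Module.End ℂ V) v = v} where
  inv_mem := by
    intro g hg
    have h := units_inv_apply g v
    rwa [show (g : Module.End ℂ V) v = v from hg] at h
  conj_mem := by
    intro a b (ha : (a : Module.End ℂ V) v = v) (hb : (b : Module.End ℂ V) v = v)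
    have h := units_inv_apply a v
    rw [ha] at h
    change (a : Module.End ℂ V) ((b : Module.End ℂ V) ((a⁻¹ : (Module.End ℂ V)ˣ).1 v)) = v
    rw [h, hb, ha]

/-- A link whose group is represented without a common fixed vector by pseudoreflections on an
`N`-dimensional space is not the closure of a braid on fewer than `N` strands. -/
theorem finrank_le_of_closure [FiniteDimensional ℂ V] {n : ℕ} (β : BraidWord n)
    {S : Set (Module.End ℂ V)ˣ} (hS : S ∈ β.closure.images (Module.End ℂ V)ˣ)
    (hrefl : S ⊆ pseudoreflections V)
    (hfix : ∀ v : V, (∀ g ∈ S, (g : Module.End ℂ V) v = v) → v = 0) : Module.finrank ℂ V ≤ n := by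
  obtain ⟨L, hL, hLS, hgen⟩ := exists_generators_of_closure β hS
  by_contra hlt
  have hφ : ∀ i : Fin n, ∃ (φ : V →ₗ[ℂ] ℂ) (w : V), ∀ v,
      ((L.get (i.cast hL.symm) : (Module.End ℂ V)ˣ) : Module.End ℂ V) v = v + φ v • w :=
    fun i => hrefl (hLS _ (List.get_mem _ _))
  choose φ w hw using hφ
  have hker := LinearMap.ker_ne_bot_of_finrank_lt (f := LinearMap.pi φ) (by simpa using hlt)
  obtain ⟨v, hv, hv0⟩ := Submodule.exists_mem_ne_zero_of_ne_bot hker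
  refine hv0 (hfix v fun g hg => ?_)
  refine hgen _ (conjClosed_fixing v) (fun g hg => ?_) hg
  obtain ⟨i, rfl⟩ := List.get_of_mem hg
  have h := hw (i.cast hL) v
  have hi : φ (i.cast hL) v = 0 := congrFun hv (i.cast hL)
  rw [hi, zero_smul, add_zero] at h
  exact h

end Pseudoreflections

/-! ### Representations of torus link groups -/

section TorusColoring
variable {G : Type} [Group G]

theorem ColorRun.append {u w : List Slice} {c d c' : List G} (h : ColorRun u c d)
    (h' : ColorRun w d c') : ColorRun (u ++ w) c c' := by
  obtain ⟨C, h⟩ := h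
  obtain ⟨C', h'⟩ := h'
  exact ⟨_, coloring_append.2 ⟨d, C, C', h, h', rfl⟩⟩

theorem ColorRun.shift {w : List Slice} {c c' : List G} (h : ColorRun w c c') (g : G) :
    ColorRun (w.map Slice.shift) (g :: c) (g :: c') := by
  rcases eq_or_ne w [] with rfl | hw
  · rw [colorRun_nil.1 h]
    exact colorRun_nil.2 rfl
  · exact (colorRun_shift hw).2 ⟨g, c, c', rfl, rfl, h⟩

/-- The leftmost strand passes over the other ones. -/
theorem colorRun_ascending (a : G) (l t : List G) :
    ColorRun ((List.range l.length).map fun i => ⟨i, .cross true⟩) (a :: l ++ t)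
      (l.map (fun b => a * b * a⁻¹) ++ a :: t) := by
  induction l with
  | nil => exact colorRun_nil.2 rfl
  | cons b l ih =>
    rw [List.length_cons, List.range_succ_eq_map, List.map_cons, List.map_map]
    have h := ih.shift (a * b * a⁻¹)
    rw [List.map_map] at h
    exact colorRun_cons.2 ⟨_, .overpass a b (l ++ t), h⟩

/-- The effect of `σ_1 ⋯ σ_{r-1}` on a periodic sequence of colours: a shift, followed by the
conjugation with the colour of the strand that passes over the others. -/
theorem colorRun_ascending_of_periodic {r : ℕ} {p : ℕ → G} (hp : p r = p 0) (t : List G) :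
    ColorRun ((ascending r).map fun g => (⟨g.1, .cross g.2⟩ : Slice))
      ((List.range r).map p ++ t)
      ((List.range r).map (fun i => p 0 * p (i + 1) * (p 0)⁻¹) ++ t) := by
  have hs : (ascending r).map (fun g => (⟨g.1, .cross g.2⟩ : Slice)) =
      (List.range (r - 1)).map fun i => ⟨i, .cross true⟩ := by
    rw [ascending, List.map_map, ← List.map_coe_finRange_eq_range, List.map_map]
    rfl
  rw [hs]
  cases r with
  | zero => exact colorRun_nil.2 rfl
  | succ m =>
    have h := colorRun_ascending (p 0) ((List.range m).map fun i => p (i + 1)) t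
    rw [List.length_map, List.length_range, List.map_map] at h
    have e1 : (List.range (m + 1)).map p = p 0 :: (List.range m).map fun i => p (i + 1) := by
      rw [List.range_succ_eq_map, List.map_cons, List.map_map]
      rfl
    have e2 : (List.range (m + 1)).map (fun i => p 0 * p (i + 1) * (p 0)⁻¹) =
        (List.range m).map (fun i => p 0 * p (i + 1) * (p 0)⁻¹) ++ [p 0] := by
      rw [List.range_succ, List.map_append, List.map_singleton, hp, mul_inv_cancel_right]
    rw [e1, e2, List.append_assoc]
    exact h

/-- If `D ^ r` and `(y D) ^ s` are central, then the conjugates of `y` by the powers of `D` colour the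
torus link `T(r,s)`. -/
theorem exists_images_torusLink {r s : ℕ} {y D : G} (hD : Commute (D ^ r) y)
    (hy : Commute ((y * D) ^ s) y) :
    ∃ S ∈ (torusLink r s).images G, (∀ i < r, D ^ i * y * (D ^ i)⁻¹ ∈ S) ∧
      ∀ K : Set G, ConjClosed K → (∀ i < r, D ^ i * y * (D ^ i)⁻¹ ∈ K) → S ⊆ K := by
  set p : ℕ → G := fun i => D ^ i * y * (D ^ i)⁻¹ with hp
  set q : ℕ → ℕ → G := fun k i => (y * D) ^ k * p i * ((y * D) ^ k)⁻¹ with hq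
  have hpr : p r = p 0 := by
    simp only [hp, hD.eq, pow_zero]
    group
  have hqr : ∀ k, q k r = q k 0 := fun k => by simp only [hq, hpr]
  have hstep : ∀ k i, q k 0 * q k (i + 1) * (q k 0)⁻¹ = q (k + 1) i := fun k i => by
    simp only [hq, hp, pow_succ, pow_zero]
    group
  have hqs : ∀ i, q s i = p i := fun i => by
    have h : Commute ((y * D) ^ s) D := by
      have h1 : Commute ((y * D) ^ s) (y⁻¹ * (y * D)) :=
        (hy.inv_right).mul_right ((Commute.refl _).pow_left s)
      simpa using h1
    have h2 : Commute ((y * D) ^ s) (p i) :=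
      ((h.pow_right i).mul_right hy).mul_right (h.pow_right i).inv_right
    simp only [hq, h2.eq, mul_inv_cancel_right]
  have hrun : ∀ k t, ColorRun ((wordPow (ascending r) k).map fun g => (⟨g.1, .cross g.2⟩ : Slice))
      ((List.range r).map p ++ t) ((List.range r).map (q k) ++ t) := by
    intro k t
    induction k with
    | zero => exact colorRun_nil.2 (by simp [hq])
    | succ k ih =>
      have h := ih.append (colorRun_ascending_of_periodic (hqr k) t)
      simp only [hstep] at h
      rw [wordPow, List.replicate_succ', List.flatten_append, List.flatten_singleton, List.map_append]
      exact h
  set L := (List.range r).map p with hL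
  have hlen : L.length = r := by simp [hL]
  obtain ⟨C₁, h1⟩ := exists_coloring_nestedCups L
  obtain ⟨C₃, h3⟩ := exists_coloring_nestedCaps L
  obtain ⟨C₂, h2⟩ : ColorRun (wordPow (ascending r) s).crossings (closeUp L) (closeUp L) := by
    have h := hrun s (L.map (·⁻¹)).reverse
    rwa [show q s = p from funext hqs] at h
  rw [hlen] at h1 h3
  have h4 := coloring_append.2 ⟨_, _, _, h2, h3, rfl⟩
  have h5 : Coloring (wordPow (ascending r) s).closureDiagram.slices [] [] (C₁ ∪ (C₂ ∪ C₃)) := by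
    rw [show (wordPow (ascending r) s).closureDiagram.slices =
      nestedCups r ++ ((wordPow (ascending r) s).crossings ++ nestedCaps r) from
        List.append_assoc _ _ _]
    exact coloring_append.2 ⟨_, _, _, h1, h4, rfl⟩
  refine ⟨_, ⟨_, h5, rfl⟩, fun i hi => ?_, fun K hK hpK => ?_⟩
  · refine (Set.subset_sInter fun _ hL => hL.2 : _ ⊆ conjClosure _) (.inl (h1.top_subset ?_))
    simp only [closeUp, Set.mem_ofPred_eq, List.mem_append, hL, List.mem_map, List.mem_range]
    exact .inl ⟨i, hi, rfl⟩
  · rw [conjClosure_subset_iff hK]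
    have hLK : ∀ g ∈ L, g ∈ K := by
      intro g hg
      rw [hL, List.mem_map] at hg
      obtain ⟨i, hi, rfl⟩ := hg
      exact hpK i (List.mem_range.1 hi)
    obtain ⟨L', -, hL', hgen⟩ := h1.nestedCups
    have h6 : ∀ g ∈ closeUp L, g ∈ K := by
      intro g hg
      rw [closeUp, List.mem_append, List.mem_reverse] at hg
      rcases hg with hg | hg
      · exact hLK g hg
      · obtain ⟨b, hb, rfl⟩ := List.mem_map.1 hg
        exact hK.inv_mem (hLK b hb)
    refine Set.union_subset (hgen K hK fun g hg => h6 g ?_) (h4.subset_of_bottom hK (fun x hx => ?_) h6)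
    · rw [hL', closeUp, List.mem_append]
      exact .inl hg
    · rw [List.mem_append] at hx
      rcases hx with hx | hx
      · obtain ⟨g, -, rfl⟩ := List.mem_map.1 hx
        simp
      · obtain ⟨g, -, rfl⟩ := List.mem_map.1 hx
        simp

end TorusColoring

section Companion
open Polynomial

/-- Multiplication by `X` modulo a monic polynomial `B` of degree `M + 1`, on the space of
polynomials of degree at most `M`. -/
noncomputable def mulXMod {M : ℕ} (B : ℂ[X]) (hB : B.Monic) (hd : B.natDegree = M + 1) :
    Module.End ℂ (degreeLT ℂ (M + 1)) :=
  LinearMap.restrict (LinearMap.mulLeft ℂ (X : ℂ[X]) - (lcoeff ℂ M).smulRight B) fun f hf => by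
    rw [mem_degreeLT, degree_lt_iff_coeff_zero] at hf ⊢
    intro m hm
    obtain ⟨m, rfl⟩ := Nat.exists_eq_add_of_le' hm
    simp only [LinearMap.sub_apply, LinearMap.mulLeft_apply, LinearMap.smulRight_apply,
      lcoeff_apply, coeff_sub, coeff_smul, smul_eq_mul]
    rw [← add_assoc, coeff_X_mul]
    rcases m with _ | m
    · rw [zero_add, ← hd, hB.coeff_natDegree, mul_one, sub_self]
    · rw [hf _ (by omega), coeff_eq_zero_of_natDegree_lt (p := B) (by omega), mul_zero, sub_zero]

variable {M : ℕ} {A B : ℂ[X]} (hA : A.Monic) (hAd : A.natDegree = M + 1) (hB : B.Monic)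
  (hBd : B.natDegree = M + 1)

theorem coe_mulXMod (f : degreeLT ℂ (M + 1)) :
    ((mulXMod B hB hBd f : degreeLT ℂ (M + 1)) : ℂ[X]) = X * (f : ℂ[X]) - (f : ℂ[X]).coeff M • B := rfl

theorem dvd_mulXMod_pow (f : degreeLT ℂ (M + 1)) (j : ℕ) :
    B ∣ (((mulXMod B hB hBd ^ j) f : degreeLT ℂ (M + 1)) : ℂ[X]) - X ^ j * (f : ℂ[X]) := by
  induction j with
  | zero => simp
  | succ j ih =>
    obtain ⟨g, hg⟩ := ih
    rw [pow_succ', Module.End.mul_apply, coe_mulXMod]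
    generalize ((mulXMod B hB hBd ^ j) f : degreeLT ℂ (M + 1)) = h at *
    refine ⟨X * g - C ((h : ℂ[X]).coeff M), ?_⟩
    rw [smul_eq_C_mul]
    linear_combination X * hg

theorem mulXMod_pow_eq {n : ℕ} {c : ℂ} (h : B ∣ X ^ n - C c) : mulXMod B hB hBd ^ n = c • 1 := by
  ext1 f
  apply Subtype.ext
  rw [← sub_eq_zero]
  refine eq_zero_of_dvd_of_degree_lt (p := B) ?_ ?_
  · have h1 := (dvd_mulXMod_pow hB hBd f n).add (h.mul_right (f : ℂ[X]))
    convert h1 using 1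
    rw [LinearMap.smul_apply, Module.End.one_apply, Submodule.coe_smul, smul_eq_C_mul]
    ring
  · rw [degree_eq_natDegree hB.ne_zero, hBd]
    exact mem_degreeLT.1 (Submodule.sub_mem _ (Subtype.prop _) (Subtype.prop _))

theorem isUnit_mulXMod {n : ℕ} {c : ℂ} (hn : n ≠ 0) (hc : c ≠ 0) (h : B ∣ X ^ n - C c) :
    IsUnit (mulXMod B hB hBd) := by
  rw [← isUnit_pow_iff hn, mulXMod_pow_eq hB hBd h]
  exact (isUnit_one (M := Module.End ℂ (degreeLT ℂ (M + 1)))).smul (Units.mk0 c hc)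

/-- A product of `N` of the linear factors of `P`. -/
theorem exists_monic_dvd {P : ℂ[X]} (hP : P.Monic) {N : ℕ} (h : N ≤ P.natDegree) :
    ∃ A : ℂ[X], A.Monic ∧ A.natDegree = N ∧ A ∣ P := by
  have hs := IsAlgClosed.splits P
  rw [hs.natDegree_eq_card_roots, ← Multiset.length_toList] at h
  refine ⟨(((P.roots.toList.take N : Multiset ℂ)).map fun a => X - C a).prod,
    monic_multiset_prod_of_monic _ _ fun a _ => monic_X_sub_C a, ?_, ?_⟩
  · rw [natDegree_multiset_prod_X_sub_C_eq_card, Multiset.coe_card, List.length_take]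
    exact min_eq_left h
  · conv_rhs => rw [hs.eq_prod_roots_of_monic hP]
    refine Multiset.prod_dvd_prod_of_le (Multiset.map_le_map ?_)
    conv_rhs => rw [← Multiset.coe_toList P.roots]
    exact Multiset.coe_le.2 (List.take_sublist _ _).subperm

/-- A polynomial of degree at most `M` vanishes if the leading coefficients of its products with the
powers of `X` modulo `B` vanish. -/
theorem eq_zero_of_coeff_mulXMod_pow (f : degreeLT ℂ (M + 1))
    (h : ∀ j ≤ M, (((mulXMod B hB hBd ^ j) f : degreeLT ℂ (M + 1)) : ℂ[X]).coeff M = 0) : f = 0 := by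
  have h1 : ∀ j ≤ M, (((mulXMod B hB hBd ^ j) f : degreeLT ℂ (M + 1)) : ℂ[X]) = X ^ j * (f : ℂ[X]) := by
    intro j
    induction j with
    | zero => simp
    | succ j ih =>
      intro hj
      rw [pow_succ', Module.End.mul_apply, coe_mulXMod, h j (by omega), zero_smul, sub_zero,
        ih (by omega), pow_succ', mul_assoc]
  apply Subtype.ext
  ext m
  rw [Submodule.coe_zero, coeff_zero]
  rcases Nat.lt_or_ge M m with hm | hm
  · exact (degree_lt_iff_coeff_zero _ _).1 (mem_degreeLT.1 f.2) m hm
  · have h2 := h (M - m) (by omega)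
    rw [h1 _ (by omega), coeff_X_pow_mul'] at h2
    simpa [Nat.sub_sub_self hm] using h2

/-- The torus link `T(r,s)` is not the closure of a braid with fewer than `min r s` strands. -/
theorem le_of_closure_eq_torusLink {n r s : ℕ} (β : BraidWord n) (h : β.closure = torusLink r s) :
    min r s ≤ n := by
  rcases Nat.eq_zero_or_pos (min r s) with h0 | h0
  · omega
  obtain ⟨M, hM⟩ : ∃ M, min r s = M + 1 := ⟨min r s - 1, by omega⟩
  have hr : M + 1 ≤ r := by omega
  have hs : M + 1 ≤ s := by omega
  obtain ⟨A, hA, hAd, hAdvd⟩ := exists_monic_dvd (N := M + 1)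
    (monic_X_pow_sub_C (1 : ℂ) (n := s) (by omega)) (by rwa [natDegree_X_pow_sub_C])
  obtain ⟨B, hB, hBd, hBdvd⟩ := exists_monic_dvd (N := M + 1)
    (monic_X_pow_sub_C (2 : ℂ) (n := r) (by omega)) (by rwa [natDegree_X_pow_sub_C])
  -- a common root `a` would have the norm one by `a ^ s = 1`, and not by `a ^ r = 2`
  have hAB : A ≠ B := by
    rintro rfl
    obtain ⟨a, ha⟩ := IsAlgClosed.exists_root A (by
      rw [degree_eq_natDegree hA.ne_zero, hAd]; exact_mod_cast Nat.succ_ne_zero M)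
    have h1 : a ^ s = 1 := by
      have := ha.dvd hAdvd
      simpa [sub_eq_zero] using this
    have h2 : a ^ r = 2 := by
      have := ha.dvd hBdvd
      simpa [sub_eq_zero] using this
    have h3 : ‖a‖ = 1 := Complex.norm_eq_one_of_pow_eq_one h1 (by omega)
    have h4 := congrArg norm h2
    rw [norm_pow, h3, one_pow] at h4
    norm_num at h4
  have hnD := mulXMod_pow_eq hB hBd hBdvd
  have hnE := mulXMod_pow_eq hA hAd hAdvd
  obtain ⟨D, hD⟩ := isUnit_mulXMod hB hBd (by omega) two_ne_zero hBdvd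
  obtain ⟨E, hE⟩ := isUnit_mulXMod hA hAd (by omega) one_ne_zero hAdvd
  have hDr : ∀ g, Commute (D ^ r) g := fun g => Units.ext (by
    simp [hD, hnD])
  have hEs : ∀ g, Commute (E ^ s) g := fun g => Units.ext (by
    simp [hE, hnE])
  set y := E * D⁻¹ with hy
  have hyD : y * D = E := by simp [hy]
  have hrefl : y ∈ pseudoreflections (degreeLT ℂ (M + 1)) := by
    refine ⟨lcoeff ℂ M ∘ₗ (degreeLT ℂ (M + 1)).subtype ∘ₗ (D⁻¹ : (Module.End ℂ _)ˣ).1,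
      ⟨B - A, ?_⟩, fun v => ?_⟩
    · rw [mem_degreeLT]
      have := degree_sub_lt_left (p := B) (q := A) (by rw [degree_eq_natDegree hA.ne_zero,
        degree_eq_natDegree hB.ne_zero, hAd, hBd]) hB.ne_zero (by rw [hA.leadingCoeff, hB.leadingCoeff])
      rwa [degree_eq_natDegree hB.ne_zero, hBd] at this
    · apply Subtype.ext
      have h1 := congrArg (Subtype.val) (units_apply_inv D v)
      rw [hD, coe_mulXMod] at h1
      rw [hy, Units.val_mul, Module.End.mul_apply, hE, coe_mulXMod]
      simp only [Submodule.coe_add, Submodule.coe_smul, LinearMap.comp_apply,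
        Submodule.subtype_apply, lcoeff_apply]
      rw [← h1, smul_sub]
      abel
  obtain ⟨S, hS, hSmem, hSsub⟩ := exists_images_torusLink (r := r) (s := s) (hDr y)
    (hyD ▸ hEs y)
  rw [← h] at hS
  have hdim : Module.finrank ℂ (degreeLT ℂ (M + 1)) = M + 1 := by
    rw [(degreeLTEquiv ℂ (M + 1)).finrank_eq]; simp
  rw [hM, ← hdim]
  refine finrank_le_of_closure β hS (hSsub _ conjClosed_pseudoreflections
    fun i _ => conj_mem_pseudoreflections hrefl _) fun v hv => ?_
  -- a vector that is fixed by the conjugate of `y` by `D ^ i` has a product with a power of `D` on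
  -- which `D` and `E` agree
  have hfix : ∀ i < r, (((D ^ (i + 1))⁻¹ : (Module.End ℂ (degreeLT ℂ (M + 1)))ˣ).1 v : ℂ[X]).coeff M = 0 := by
    intro i hi
    have h1 := hv _ (hSmem i hi)
    set u := ((D ^ (i + 1))⁻¹ : (Module.End ℂ (degreeLT ℂ (M + 1)))ˣ).1 v with hu
    have h2 : E.1 u = D.1 u := by
      have e1 : D ^ i * y * (D ^ i)⁻¹ = D ^ i * (E * (D ^ (i + 1))⁻¹) := by
        rw [hy]; group
      have e2 : (D ^ i)⁻¹ = D * (D ^ (i + 1))⁻¹ := by group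
      rw [e1, Units.val_mul, Module.End.mul_apply, Units.val_mul, Module.End.mul_apply] at h1
      have h3 := congrArg ((D ^ i)⁻¹ : (Module.End ℂ (degreeLT ℂ (M + 1)))ˣ).1 h1
      rwa [units_inv_apply, e2, Units.val_mul, Module.End.mul_apply] at h3
    rw [hE, hD] at h2
    have h3 := congrArg Subtype.val h2
    rw [coe_mulXMod, coe_mulXMod] at h3
    have h4 : (u : ℂ[X]).coeff M • (B - A) = 0 := by rw [smul_sub]; linear_combination h3
    exact (smul_eq_zero.1 h4).resolve_right (sub_ne_zero.2 hAB.symm)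
  refine eq_zero_of_coeff_mulXMod_pow hB hBd v fun j hj => ?_
  have h1 := hfix (r - j - 1) (by omega)
  have h2 : (mulXMod B hB hBd ^ j) v = (2 : ℂ) • ((D ^ (r - j - 1 + 1))⁻¹ : (Module.End ℂ (degreeLT ℂ (M + 1)))ˣ).1 v := by
    have e1 : D ^ j = (D ^ (r - j - 1 + 1))⁻¹ * D ^ r := by
      rw [eq_inv_mul_iff_mul_eq, ← pow_add]
      congr 1
      omega
    have e2 := congrArg (fun g : (Module.End ℂ (degreeLT ℂ (M + 1)))ˣ => g.1 v) e1
    simp only [Units.val_mul, Units.val_pow_eq_pow_val, hD, hnD, Module.End.mul_apply,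
      LinearMap.smul_apply, Module.End.one_apply, map_smul] at e2
    exact e2
  rw [h2, Submodule.coe_smul, coeff_smul, h1, smul_zero]

end Companion
/-! ### Torus links among the twisted links -/

theorem braidIndex_torusLink_three {n : ℕ} (h : 3 ≤ n) : (torusLink 3 n).braidIndex = 3 := by
  refine le_antisymm (Nat.sInf_le ⟨_, rfl⟩) (le_csInf ⟨3, _, rfl⟩ ?_)
  rintro m ⟨β, hβ⟩
  have := le_of_closure_eq_torusLink β hβ
  omega

/-- If `T(r,s)` has braid index three, then `min r s = 3`: it is the closure of a braid on `r`
strands, and on `s` strands if `s ≤ r`, but not on fewer than `min r s` strands. -/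
theorem eq_torusLink_three_of_braidIndex {L : Link} (hL : L.IsTorusLink) (h : L.braidIndex = 3) :
    ∃ n, 3 ≤ n ∧ L = torusLink 3 n := by
  obtain ⟨r, s, hr, hs, rfl⟩ := hL
  have hle : ∀ m (β : BraidWord m), β.closure = torusLink r s → 3 ≤ m := fun m β hβ =>
    h ▸ Nat.sInf_le ⟨β, hβ⟩
  have h3r : 3 ≤ r := hle r _ rfl
  have h3s : 3 ≤ s := by
    by_contra hlt
    obtain ⟨β, hβ⟩ := exists_closure_eq_torusLink (n := r) hs (by omega)
    exact hlt (hle s β hβ)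
  obtain ⟨β, hβ⟩ : ∃ β : BraidWord 3, β.closure = torusLink r s := by
    have hne : {n : ℕ | ∃ β : BraidWord n, β.closure = torusLink r s}.Nonempty := ⟨r, _, rfl⟩
    have := Nat.sInf_mem hne
    rwa [show sInf {n : ℕ | ∃ β : BraidWord n, β.closure = torusLink r s} = 3 from h] at this
  have hmin := le_of_closure_eq_torusLink β hβ
  rcases (show r = 3 ∨ s = 3 by omega) with rfl | rfl
  · exact ⟨s, h3s, rfl⟩
  · exact ⟨r, h3r, torusLink_three_right h3r⟩

theorem torusLink_three_eq_zero (k : ℕ) : torusLink 3 (3 * k) = twistedLink 0 0 (3 * k) :=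
  (twistedLink_zero_zero _).symm

theorem torusLink_three_eq_one (k : ℕ) : torusLink 3 (3 * k + 1) = twistedLink 1 1 (3 * k) := by
  rw [← twistedLink_zero_zero, twistedLink_three_mul_add_one]

theorem torusLink_three_eq_two (k : ℕ) : torusLink 3 (3 * k + 2) = twistedLink 3 1 (3 * k) := by
  rw [← twistedLink_zero_zero, twistedLink_zero_left]

theorem eq_of_twistedLink_eq {x y k x' y' k' : ℕ}
    (h : twistedLink x y (3 * k) = twistedLink x' y' (3 * k')) :
    k = k' ∧ (x = x' ∧ y = y' ∨ x = y' ∧ y = x') :=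
  eq_of_jones_eq (congrArg Link.jones h)

theorem twistedLink_eq_of_jones_eq {x₁ y₁ z₁ x₂ y₂ z₂ : ℕ}
    (h : (twistedLink x₁ y₁ z₁).jones = (twistedLink x₂ y₂ z₂).jones) :
    twistedLink x₁ y₁ z₁ = twistedLink x₂ y₂ z₂ := by
  obtain ⟨x, y, k, h1⟩ := exists_twistedLink_eq x₁ y₁ z₁
  obtain ⟨x', y', k', h2⟩ := exists_twistedLink_eq x₂ y₂ z₂
  rw [h1, h2] at h ⊢
  obtain ⟨rfl, ⟨rfl, rfl⟩ | ⟨rfl, rfl⟩⟩ := eq_of_jones_eq h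
  · rfl
  · exact twistedLink_swap x y k

/-- The parameters of a twisted link in normal form that is a torus link `T(3,n)`. -/
theorem eq_of_twistedLink_eq_torusLink {x y k n : ℕ}
    (h : twistedLink x y (3 * k) = torusLink 3 n) :
    n = 3 * k ∧ x = 0 ∧ y = 0 ∨ n = 3 * k + 1 ∧ x = 1 ∧ y = 1 ∨
      n = 3 * k + 2 ∧ (x = 3 ∧ y = 1 ∨ x = 1 ∧ y = 3) := by
  obtain ⟨j, rfl | rfl | rfl⟩ : ∃ j, n = 3 * j ∨ n = 3 * j + 1 ∨ n = 3 * j + 2 :=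
    ⟨n / 3, by omega⟩
  · rw [torusLink_three_eq_zero] at h
    have := eq_of_twistedLink_eq h
    omega
  · rw [torusLink_three_eq_one] at h
    have := eq_of_twistedLink_eq h
    omega
  · rw [torusLink_three_eq_two] at h
    have := eq_of_twistedLink_eq h
    omega

theorem twistedLink_one_one (z : ℕ) : twistedLink 1 1 z = torusLink 3 (z + 1) := by
  obtain ⟨k, rfl | rfl | rfl⟩ : ∃ k, z = 3 * k ∨ z = 3 * k + 1 ∨ z = 3 * k + 2 :=
    ⟨z / 3, by omega⟩
  · rw [torusLink_three_eq_one]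
  · rw [torusLink_three_eq_two, twistedLink_three_mul_add_one]
  · rw [show 3 * k + 2 + 1 = 3 * (k + 1) by ring, torusLink_three_eq_zero,
      ← twistedLink_succ_succ]

theorem twistedLink_one_three {x y z : ℕ} (h : min x y = 1) (h' : max x y = 3)
    (hz : z ≡ 0 [MOD 3]) : twistedLink x y z = torusLink 3 (z + 2) := by
  obtain ⟨k, rfl⟩ := (Nat.modEq_zero_iff_dvd.1 hz)
  rw [torusLink_three_eq_two]
  obtain ⟨rfl, rfl⟩ | ⟨rfl, rfl⟩ : x = 3 ∧ y = 1 ∨ x = 1 ∧ y = 3 := by omega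
  · rfl
  · exact twistedLink_swap 1 3 k

theorem exists_eq_three_mul_add_two {z : ℕ} (hz : z ≡ 2 [MOD 3]) : ∃ k, z = 3 * k + 2 :=
  ⟨z / 3, (Nat.div_add_mod z 3).symm.trans (congrArg _ hz)⟩

theorem twistedLink_two_four {x y z : ℕ} (h : min x y = 2) (h' : max x y = 4)
    (hz : z ≡ 2 [MOD 3]) : twistedLink x y z = torusLink 3 (z + 3) := by
  obtain ⟨k, rfl⟩ := exists_eq_three_mul_add_two hz
  obtain ⟨x, rfl⟩ : ∃ x', x = x' + 1 := ⟨x - 1, by omega⟩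
  obtain ⟨y, rfl⟩ : ∃ y', y = y' + 1 := ⟨y - 1, by omega⟩
  rw [twistedLink_succ_succ, twistedLink_one_three (by omega) (by omega)
    (Nat.modEq_zero_iff_dvd.2 ⟨_, rfl⟩)]
  congr 1

theorem twistedLink_two_two {z : ℕ} (hz : z ≡ 2 [MOD 3]) :
    twistedLink 2 2 z = torusLink 3 (z + 2) := by
  obtain ⟨k, rfl⟩ := exists_eq_three_mul_add_two hz
  rw [twistedLink_succ_succ, ← torusLink_three_eq_one]
  congr 1

theorem twistedLink_zero_two {x y z : ℕ} (h : min x y = 0) (h' : max x y = 2)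
    (hz : z ≡ 1 [MOD 3]) : twistedLink x y z = torusLink 3 (z + 1) := by
  obtain ⟨k, rfl⟩ : ∃ k, z = 3 * k + 1 :=
    ⟨z / 3, (Nat.div_add_mod z 3).symm.trans (congrArg _ hz)⟩
  rw [twistedLink_three_mul_add_one, torusLink_three_eq_two, show x + y = 2 by omega]

/-- The conditions under which a twisted link is a torus link of braid index three. -/
theorem conditions_of_twistedLink_eq_torusLink {x y z n : ℕ} (hn : 3 ≤ n)
    (h : twistedLink x y z = torusLink 3 n) :
    (x = 0 ∧ y = 0 ∧ 3 ≤ z) ∨ (x = 1 ∧ y = 1 ∧ 2 ≤ z) ∨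
      (min x y = 1 ∧ max x y = 3 ∧ z ≡ 0 [MOD 3] ∧ 3 ≤ z) ∨
      (min x y = 2 ∧ max x y = 4 ∧ z ≡ 2 [MOD 3]) ∨
      (x = 2 ∧ y = 2 ∧ z ≡ 2 [MOD 3]) ∨
      (min x y = 0 ∧ max x y = 2 ∧ z ≡ 1 [MOD 3] ∧ 4 ≤ z) := by
  obtain ⟨k, rfl | rfl | rfl⟩ : ∃ k, z = 3 * k ∨ z = 3 * k + 1 ∨ z = 3 * k + 2 :=
    ⟨z / 3, by omega⟩
  · have h3 : 3 * k ≡ 0 [MOD 3] := by simp [Nat.ModEq]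
    rcases eq_of_twistedLink_eq_torusLink h with ⟨rfl, rfl, rfl⟩ | ⟨hk, rfl, rfl⟩ | ⟨hk, h⟩
    · exact .inl ⟨rfl, rfl, hn⟩
    · exact .inr (.inl ⟨rfl, rfl, by omega⟩)
    · exact .inr (.inr (.inl ⟨by omega, by omega, h3, by omega⟩))
  · have h3 : 3 * k + 1 ≡ 1 [MOD 3] := by simp [Nat.ModEq]
    rw [twistedLink_three_mul_add_one] at h
    rcases eq_of_twistedLink_eq_torusLink h with ⟨-, -, h⟩ | ⟨rfl, h, -⟩ | ⟨hk, h⟩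
    · exact absurd h one_ne_zero
    · exact .inl ⟨by omega, by omega, hn⟩
    · have hxy : x = 1 ∧ y = 1 ∨ min x y = 0 ∧ max x y = 2 := by omega
      rcases hxy with ⟨rfl, rfl⟩ | ⟨h1, h2⟩
      · exact .inr (.inl ⟨rfl, rfl, by omega⟩)
      · exact .inr (.inr (.inr (.inr (.inr ⟨h1, h2, h3, by omega⟩))))
  · have h3 : 3 * k + 2 ≡ 2 [MOD 3] := by simp [Nat.ModEq]
    rcases x with _ | x
    · rw [twistedLink_zero_left] at h
      have := eq_of_twistedLink_eq_torusLink h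
      exact .inl ⟨rfl, by omega, by omega⟩
    · rcases y with _ | y
      · rw [twistedLink_zero_right] at h
        have := eq_of_twistedLink_eq_torusLink h
        exact .inl ⟨by omega, rfl, by omega⟩
      · rw [twistedLink_succ_succ] at h
        rcases eq_of_twistedLink_eq_torusLink h with ⟨-, rfl, rfl⟩ | ⟨-, rfl, rfl⟩ | ⟨-, h⟩
        · exact .inr (.inl ⟨rfl, rfl, by omega⟩)
        · exact .inr (.inr (.inr (.inr (.inl ⟨rfl, rfl, h3⟩))))
        · exact .inr (.inr (.inr (.inl ⟨by omega, by omega, h3⟩)))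

end LinkTheory

theorem mainTheorem2 :
    (∀ x₁ y₁ z₁ x₂ y₂ z₂ : ℕ,
      (LinkTheory.twistedLink x₁ y₁ z₁).jones = (LinkTheory.twistedLink x₂ y₂ z₂).jones →
        LinkTheory.twistedLink x₁ y₁ z₁ = LinkTheory.twistedLink x₂ y₂ z₂) ∧
    (∀ x₁ y₁ z₁ : ℕ, ∃ x y z : ℕ, z ≡ 0 [MOD 3] ∧
      LinkTheory.twistedLink x₁ y₁ z₁ = LinkTheory.twistedLink x y z) ∧
    (∀ x₁ y₁ z₁ : ℕ,
      ((LinkTheory.twistedLink x₁ y₁ z₁).IsTorusLink ∧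
          (LinkTheory.twistedLink x₁ y₁ z₁).braidIndex = 3 ↔
        (x₁ = 0 ∧ y₁ = 0 ∧ 3 ≤ z₁) ∨
        (x₁ = 1 ∧ y₁ = 1 ∧ 2 ≤ z₁) ∨
        (min x₁ y₁ = 1 ∧ max x₁ y₁ = 3 ∧ z₁ ≡ 0 [MOD 3] ∧ 3 ≤ z₁) ∨
        (min x₁ y₁ = 2 ∧ max x₁ y₁ = 4 ∧ z₁ ≡ 2 [MOD 3]) ∨
        (x₁ = 2 ∧ y₁ = 2 ∧ z₁ ≡ 2 [MOD 3]) ∨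
        (min x₁ y₁ = 0 ∧ max x₁ y₁ = 2 ∧ z₁ ≡ 1 [MOD 3] ∧ 4 ≤ z₁)) ∧
      (x₁ = 0 ∧ y₁ = 0 ∧ 3 ≤ z₁ →
        LinkTheory.twistedLink x₁ y₁ z₁ = LinkTheory.torusLink 3 z₁) ∧
      (x₁ = 1 ∧ y₁ = 1 ∧ 2 ≤ z₁ →
        LinkTheory.twistedLink x₁ y₁ z₁ = LinkTheory.torusLink 3 (z₁ + 1)) ∧
      (min x₁ y₁ = 1 ∧ max x₁ y₁ = 3 ∧ z₁ ≡ 0 [MOD 3] ∧ 3 ≤ z₁ →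
        LinkTheory.twistedLink x₁ y₁ z₁ = LinkTheory.torusLink 3 (z₁ + 2)) ∧
      (min x₁ y₁ = 2 ∧ max x₁ y₁ = 4 ∧ z₁ ≡ 2 [MOD 3] →
        LinkTheory.twistedLink x₁ y₁ z₁ = LinkTheory.torusLink 3 (z₁ + 3)) ∧
      (x₁ = 2 ∧ y₁ = 2 ∧ z₁ ≡ 2 [MOD 3] →
        LinkTheory.twistedLink x₁ y₁ z₁ = LinkTheory.torusLink 3 (z₁ + 2)) ∧
      (min x₁ y₁ = 0 ∧ max x₁ y₁ = 2 ∧ z₁ ≡ 1 [MOD 3] ∧ 4 ≤ z₁ →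
        LinkTheory.twistedLink x₁ y₁ z₁ = LinkTheory.torusLink 3 (z₁ + 1))) := by
  refine ⟨fun _ _ _ _ _ _ => LinkTheory.twistedLink_eq_of_jones_eq, fun x₁ y₁ z₁ => ?_,
    fun x y z => ?_⟩
  · obtain ⟨x, y, k, h⟩ := LinkTheory.exists_twistedLink_eq x₁ y₁ z₁
    exact ⟨x, y, 3 * k, by simp [Nat.ModEq], h⟩
  have c1 : x = 0 ∧ y = 0 ∧ 3 ≤ z →
      LinkTheory.twistedLink x y z = LinkTheory.torusLink 3 z := by
    rintro ⟨rfl, rfl, -⟩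
    exact LinkTheory.twistedLink_zero_zero z
  have c2 : x = 1 ∧ y = 1 ∧ 2 ≤ z →
      LinkTheory.twistedLink x y z = LinkTheory.torusLink 3 (z + 1) := by
    rintro ⟨rfl, rfl, -⟩
    exact LinkTheory.twistedLink_one_one z
  have c3 : min x y = 1 ∧ max x y = 3 ∧ z ≡ 0 [MOD 3] ∧ 3 ≤ z →
      LinkTheory.twistedLink x y z = LinkTheory.torusLink 3 (z + 2) := by
    rintro ⟨h1, h2, h3, -⟩
    exact LinkTheory.twistedLink_one_three h1 h2 h3
  have c4 : min x y = 2 ∧ max x y = 4 ∧ z ≡ 2 [MOD 3] →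
      LinkTheory.twistedLink x y z = LinkTheory.torusLink 3 (z + 3) := by
    rintro ⟨h1, h2, h3⟩
    exact LinkTheory.twistedLink_two_four h1 h2 h3
  have c5 : x = 2 ∧ y = 2 ∧ z ≡ 2 [MOD 3] →
      LinkTheory.twistedLink x y z = LinkTheory.torusLink 3 (z + 2) := by
    rintro ⟨rfl, rfl, h3⟩
    exact LinkTheory.twistedLink_two_two h3
  have c6 : min x y = 0 ∧ max x y = 2 ∧ z ≡ 1 [MOD 3] ∧ 4 ≤ z →
      LinkTheory.twistedLink x y z = LinkTheory.torusLink 3 (z + 1) := by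
    rintro ⟨h1, h2, h3, -⟩
    exact LinkTheory.twistedLink_zero_two h1 h2 h3
  refine ⟨⟨?_, ?_⟩, c1, c2, c3, c4, c5, c6⟩
  · rintro ⟨ht, hb⟩
    obtain ⟨n, hn, h⟩ := LinkTheory.eq_torusLink_three_of_braidIndex ht hb
    exact LinkTheory.conditions_of_twistedLink_eq_torusLink hn h
  · have key : ∀ n, 3 ≤ n → LinkTheory.twistedLink x y z = LinkTheory.torusLink 3 n →
        (LinkTheory.twistedLink x y z).IsTorusLink ∧
          (LinkTheory.twistedLink x y z).braidIndex = 3 := by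
      intro n hn h
      rw [h]
      exact ⟨⟨3, n, by omega, by omega, rfl⟩, LinkTheory.braidIndex_torusLink_three hn⟩
    rintro (h | h | h | h | h | h)
    · exact key _ h.2.2 (c1 h)
    · exact key _ (Nat.succ_le_succ h.2.2) (c2 h)
    · exact key _ (Nat.le_add_right_of_le h.2.2.2) (c3 h)
    · exact key _ (Nat.le_add_left 3 z) (c4 h)
    · have hz : 2 ≤ z := (congrArg (· ≤ z) h.2.2).mp (Nat.mod_le z 3)
      exact key (z + 2) (Nat.le_succ_of_le (Nat.succ_le_succ hz)) (c5 h)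
    · exact key _ (Nat.le_add_right_of_le (Nat.le_of_succ_le h.2.2.2)) (c6 h)
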